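/- Let $(\mathcal C,\wedge,S)$ be a symmetric monoidal category with finite coproducts (denoted $\bigvee$) and a zero object, such that for every finite family $(A_i)_{i\in I}$ (including $I=\emptyset$) and every $B$ the canonical morphism $\bigvee_{i}(A_i\wedge B)\to(\bigvee_i A_i)\wedge B$ is an isomorphism. For $A\in\mathcal C$ and a finite pointed set $K$ put $A\wedge K=\bigvee_{K\setminus *}A$; this is functorial in pointed maps of $K$ (summands sent to the base point are mapped by zero), so that $A\wedge S^n$, with $S^n=(S^1)^{\wedge n}$ and $S^1=\Delta^1/\partial\Delta^1$, is a simplicial object of $\mathcal C$. Let $\sigma:P\to T$ be a morphism of $\mathcal C$ and let $E$ be a symmetric ring $T$-spectrum: objects $E_n$ $(n\ge 0)$ of $\mathcal C$ with left actions of the symmetric groups $\Sigma_n$, associative and unital $\Sigma_n\times\Sigma_m$-equivariant multiplications $\mu_{n,m}:E_n\wedge E_m\to E_{n+m}$ with unit $\iota_0:S\to E_0$, and a morphism $\iota_1:T\to E_1$ which is central, i.e. $\chi_{n,1}\circ\mu_{n,1}\circ(E_n\wedge\iota_1)=\mu_{1,n}\circ(\iota_1\wedge E_n)\circ \mathrm{twist}$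 for all $n$. Here $\chi_{n,m}\in\Sigma_{n+m}$ moves the first $n$ elements past the last $m$. $E$ is commutative if $\chi_{n,m}\circ\mu_{n,m}=\mu_{m,n}\circ \mathrm{twist}$ for all $n,m$. Let $\mathcal B$ be a full subcategory of $\mathcal C$ closed under $\wedge$. For $X,Y\in\mathcal B$ and $n\ge0$ consider the simplicial set, pointed at the zero morphism, $$\mathrm{Corr}^{E,\sigma}_n(X,Y)=\mathrm{Hom}_{\mathcal C}(X\wedge P^{\wedge n},\,Y\wedge E_n\wedge S^n),$$ on which $\tau\in\Sigma_n$ acts by $\tau\cdot f=(Y\wedge\tau\wedge\tau)\circ f\circ(X\wedge\tau^{-1})$. The structure map $\mathrm{Corr}^{E,\sigma}_n(X,Y)\wedge S^1\to\mathrm{Corr}^{E,\sigma}_{n+1}(X,Y)$ takes $(f,k)$, with $k$ a simplex of $S^1$ other than the base point, to $$X\wedge P^{\wedge n}\wedge P\xrightarrow{f\wedge\sigma}Y\wedge E_n\wedge S^n\wedge T\cong Y\wedge E_n\wedge T\wedge S^n\to Y\wedge E_{n+1}\wedge S^n\to Y\wedge E_{n+1}\wedge S^{n+1},$$ where the third morphism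 is induced by $\mu_{n,1}\circ(E_n\wedge\iota_1)$ and the last one is the inclusion of summands given by $s\mapsto (s,k)$. For $f\in\mathrm{Corr}^{E,\sigma}_n(X,Y)$ and $g\in\mathrm{Corr}^{E,\sigma}_m(Y,Z)$ let $\phi_{X,Y,Z}(f,g)\in\mathrm{Corr}^{E,\sigma}_{n+m}(X,Z)$ be the composite $$X\wedge P^{\wedge n}\wedge P^{\wedge m}\xrightarrow{f\wedge P^{\wedge m}}Y\wedge E_n\wedge S^n\wedge P^{\wedge m}\cong Y\wedge P^{\wedge m}\wedge E_n\wedge S^n\xrightarrow{g\wedge E_n\wedge S^n}Z\wedge E_m\wedge S^m\wedge E_n\wedge S^n\cong Z\wedge E_n\wedge E_m\wedge S^n\wedge S^m\xrightarrow{\mu_{n,m}}Z\wedge E_{n+m}\wedge S^{n+m}.$$ Then: (1) $\mathcal B$ can be enriched over the closed symmetric monoidal category $Sp^\Sigma_{S^1}$ of symmetric $S^1$-spectra of pointed simplicial sets. Namely, the sequences $(\mathrm{Corr}^{E,\sigma}_0(X,Y),\mathrm{Corr}^{E,\sigma}_1(X,Y),\ldots)$ with the above actions and structure maps are symmetric $S^1$-spectra;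 the pairings $\phi_{X,Y,Z}$ are bimorphisms of symmetric spectra (that is, they define morphisms out of the smash product); and with them as compositions and with the morphisms $X\cong X\wedge S\xrightarrow{X\wedge\iota_0}X\wedge E_0$ as identities one obtains an $Sp^\Sigma_{S^1}$-category $\mathrm{Corr}^{E,\sigma}_*(\mathcal B)$ with the same objects as $\mathcal B$. (2) If $E$ is commutative (and $S\in\mathcal B$), then $\mathrm{Corr}^{E,\sigma}_*(\mathcal B)$ is a symmetric monoidal $Sp^\Sigma_{S^1}$-category with the same monoidal product on objects and the same unit object as in $\mathcal B$. On morphisms, the product takes $f:X\wedge P^{\wedge p}\to X'\wedge E_p\wedge S^p$ and $g:Y\wedge P^{\wedge q}\to Y'\wedge E_q\wedge S^q$ to $$X\wedge Y\wedge P^{\wedge p}\wedge P^{\wedge q}\cong X\wedge P^{\wedge p}\wedge Y\wedge P^{\wedge q}\xrightarrow{f\wedge g}X'\wedge E_p\wedge S^p\wedge Y'\wedge E_q\wedge S^q\cong X'\wedge Y'\wedge E_p\wedge E_q\wedge S^p\wedge S^q\xrightarrow{\mu_{p,q}}X'\wedge Y'\wedge E_{p+q}\wedge S^{p+q},$$ and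 the associativity, unit and symmetry isomorphisms are the images of those of $\mathcal B$ under $(a:X\to Y)\mapsto(X\cong X\wedge S\xrightarrow{a\wedge\iota_0}Y\wedge E_0)$. -/

import Mathlib

open CategoryTheory MonoidalCategory Limits Opposite

noncomputable section

namespace Corr

universe v u w

/-! ### Permutations

Symmetric groups act on the left throughout.  Instead of `Σ_n = Perm (Fin n)` alone, we let all
bijections `Fin n ≃ Fin m` act.  Such a bijection exists only for `n = m`, so this is the groupoid
`∐ₙ Σ_n`, and an action of it is the same as a left action of `Σ_n` for every `n`; the bijections
with `n` and `m` syntactically different serve to identify e.g. level `(n + m) + p` with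
level `n + (m + p)`. -/

/-- The block sum `e × f ∈ Σ_n × Σ_m ⊆ Σ_{n+m}`. -/
def blockSum {n n' m m' : ℕ} (e : Fin n ≃ Fin n') (f : Fin m ≃ Fin m') :
    Fin (n + m) ≃ Fin (n' + m') :=
  finSumFinEquiv.symm.trans ((e.sumCongr f).trans finSumFinEquiv)

/-- The shuffle `χ_{n,m}`, which moves the first `n` elements past the last `m` elements and keeps
the order inside the two blocks. -/
def chi (n m : ℕ) : Fin (n + m) ≃ Fin (m + n) := finAddFlip

/-- The permutation `1 × χ_{1,m}`, regarded as a bijection from `(n + 1) + m` to `(n + m) + 1`. -/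
def chiOne (n m : ℕ) : Fin (n + 1 + m) ≃ Fin (n + m + 1) :=
  (finCongr (Nat.add_assoc n 1 m)).trans
    (blockSum (Equiv.refl (Fin n)) (chi 1 m) : Fin (n + (1 + m)) ≃ Fin (n + (m + 1)))

/-- The permutation `1 × χ_{s,q} × 1`, regarded as a bijection from `(p + s) + (q + t)` to
`(p + q) + (s + t)`. -/
def chiMid (p s q t : ℕ) : Fin (p + s + (q + t)) ≃ Fin (p + q + (s + t)) :=
  finSumFinEquiv.symm.trans
    ((finSumFinEquiv.symm.sumCongr finSumFinEquiv.symm).trans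
      ((Equiv.sumSumSumComm (Fin p) (Fin s) (Fin q) (Fin t)).trans
        ((finSumFinEquiv.sumCongr finSumFinEquiv).trans finSumFinEquiv)))

/-- For a bijection `e` of `{0, …, n}` with `{0, …, m}`, the bijection which is left after the
last element `n` is removed from the source and `e n` from the target (and what remains is
renumbered in order). -/
def removeLast {n m : ℕ} (e : Fin (n + 1) ≃ Fin (m + 1)) : Fin n ≃ Fin m :=
  (finSuccAboveEquiv (Fin.last n)).trans
    ((e.subtypeEquiv (fun _ => (not_congr e.injective.eq_iff).symm)).trans
      (finSuccAboveEquiv (e (Fin.last n))).symm)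

/-! ### Pointed simplicial sets -/

/-- The `ℓ`-simplices of a pointed simplicial set. -/
abbrev Simp (K : SimplicialObject Pointed.{w}) (ℓ : SimplexCategory) : Type w := K.obj (op ℓ)

/-- The base point, as an `ℓ`-simplex. -/
def base (K : SimplicialObject Pointed.{w}) (ℓ : SimplexCategory) : Simp K ℓ := (K.obj (op ℓ)).point

/-- The simplicial operator `θ^*`. -/
def pull (K : SimplicialObject Pointed.{w}) {k ℓ : SimplexCategory} (θ : k ⟶ ℓ) :
    Simp K ℓ → Simp K k :=
  Pointed.Hom.toFun (K.map θ.op)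

/-- The surjective maps `[ℓ] → [1]`, i.e. the `ℓ`-simplices of `Δ¹` outside `∂Δ¹`. They are the
`ℓ`-simplices of `S¹ = Δ¹/∂Δ¹` other than the base point. -/
abbrev Arc (ℓ : SimplexCategory) : Type :=
  {f : ℓ ⟶ (SimplexCategory.mk 1) // Function.Surjective (SimplexCategory.Hom.toOrderHom f)}

instance (ℓ : SimplexCategory) : Finite (Arc ℓ) :=
  have : Finite (Fin (ℓ.len + 1) →o Fin (1 + 1)) := Finite.of_injective _ DFunLike.coe_injective
  have : Finite (ℓ ⟶ (SimplexCategory.mk 1)) :=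
    Finite.of_equiv (Fin (ℓ.len + 1) →o Fin (1 + 1)) SimplexCategory.homEquivOrderHom.symm
  Subtype.finite

/-- The `ℓ`-simplices other than the base point of the `n`-fold smash product
`S^n = S¹ ∧ ⋯ ∧ S¹`. In particular `S^0` has exactly one such simplex for every `ℓ`. -/
abbrev Cell (n : ℕ) (ℓ : SimplexCategory) : Type := Fin n → Arc ℓ

open Classical in
/-- The simplicial operator `θ^*` on `S^n`; the value `none` is the base point. -/
def cellPull (n : ℕ) {k ℓ : SimplexCategory} (θ : k ⟶ ℓ) (s : Cell n ℓ) : Option (Cell n k) :=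
  if h : ∀ i, Function.Surjective (SimplexCategory.Hom.toOrderHom (θ ≫ (s i).1)) then
    some (fun i => ⟨θ ≫ (s i).1, h i⟩)
  else none

lemma cellPull_id (n : ℕ) {ℓ : SimplexCategory} (s : Cell n ℓ) : cellPull n (𝟙 ℓ) s = some s := by
  have h : ∀ i, Function.Surjective (SimplexCategory.Hom.toOrderHom (𝟙 ℓ ≫ (s i).1)) := by
    intro i
    rw [Category.id_comp]
    exact (s i).2
  rw [cellPull, dif_pos h]
  congr 1
  funext i
  exact Subtype.ext (Category.id_comp _)

lemma cellPull_comp (n : ℕ) {j k ℓ : SimplexCategory} (η : j ⟶ k) (θ : k ⟶ ℓ) (s : Cell n ℓ) :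
    cellPull n (η ≫ θ) s = (cellPull n θ s).bind (cellPull n η) := by
  by_cases h : ∀ i, Function.Surjective (SimplexCategory.Hom.toOrderHom ((η ≫ θ) ≫ (s i).1))
  · have h' : ∀ i, Function.Surjective (SimplexCategory.Hom.toOrderHom (θ ≫ (s i).1)) := by
      intro i x
      obtain ⟨y, hy⟩ := h i x
      exact ⟨η.toOrderHom y, hy⟩
    have h'' : ∀ i, Function.Surjective
        (SimplexCategory.Hom.toOrderHom (η ≫ (θ ≫ (s i).1))) := by
      intro i
      rw [← Category.assoc]
      exact h i
    rw [cellPull, dif_pos h, cellPull, dif_pos h', Option.bind_some, cellPull, dif_pos h'']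
    congr 1
  · rw [cellPull, dif_neg h]
    symm
    by_cases h' : ∀ i, Function.Surjective (SimplexCategory.Hom.toOrderHom (θ ≫ (s i).1))
    · rw [cellPull, dif_pos h', Option.bind_some, cellPull, dif_neg]
      intro h''
      apply h
      intro i
      rw [Category.assoc]
      exact h'' i
    · rw [cellPull, dif_neg h', Option.bind_none]

/-- The pointed simplicial circle `S¹ = Δ¹/∂Δ¹`. -/
def circle : SimplicialObject Pointed.{0} where
  obj ℓ := ⟨Option (Arc ℓ.unop), none⟩
  map θ := ⟨fun s => s.bind fun a => (cellPull 1 θ.unop fun _ => a).map fun c => c 0, rfl⟩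
  map_id ℓ := by
    apply Pointed.Hom.ext
    funext s
    cases s with
    | none => rfl
    | some a =>
      change Option.map (fun c : Cell 1 ℓ.unop => c 0) (cellPull 1 (𝟙 ℓ.unop) fun _ => a) = some a
      rw [cellPull_id]
      rfl
  map_comp {_ k j} θ η := by
    apply Pointed.Hom.ext
    funext s
    cases s with
    | none => rfl
    | some a =>
      change Option.map (fun c : Cell 1 j.unop => c 0)
          (cellPull 1 (η.unop ≫ θ.unop) fun _ => a) =
        (Option.map (fun c : Cell 1 k.unop => c 0) (cellPull 1 θ.unop fun _ => a)).bind
          fun b => (cellPull 1 η.unop fun _ => b).map fun c => c 0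
      rw [cellPull_comp]
      cases h : cellPull 1 θ.unop fun _ => a with
      | none => rfl
      | some c =>
        have hc : c = fun _ => c 0 := funext fun i => congrArg c (Subsingleton.elim i 0)
        rw [Option.bind_some, Option.map_some, Option.bind_some, ← hc]

/-! ### Symmetric `S¹`-spectra and bimorphisms -/

/-- The data of a symmetric spectrum of pointed simplicial sets: levels, actions of the symmetric
groups and structure maps `X_n ∧ S¹ → X_{n+1}`, written as maps of two variables.
The axioms are in `SpectrumData.IsSymmetricSpectrum`. -/
structure SpectrumData where
  level : ℕ → SimplicialObject Pointed.{w}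
  act : ∀ {n m : ℕ}, (Fin n ≃ Fin m) → ∀ {ℓ : SimplexCategory},
    Simp (level n) ℓ → Simp (level m) ℓ
  str : ∀ {n : ℕ} {ℓ : SimplexCategory},
    Simp (level n) ℓ → Simp circle ℓ → Simp (level (n + 1)) ℓ

namespace SpectrumData

/-- The iterated structure map `X_n ∧ S^k → X_{n+k}`, where `S^k = S¹ ∧ ⋯ ∧ S¹`. -/
def strIter (X : SpectrumData.{w}) {n : ℕ} {ℓ : SimplexCategory} (x : Simp (X.level n) ℓ) :
    ∀ k : ℕ, (Fin k → Simp circle ℓ) → Simp (X.level (n + k)) ℓ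
  | 0, _ => x
  | k + 1, s => X.str (X.strIter x k (fun i => s i.castSucc)) (s (Fin.last k))

/-- The axioms of a symmetric `S¹`-spectrum: `Σ_n` acts on the pointed simplicial set `X_n` from the
left, the structure maps are maps of pointed simplicial sets `X_n ∧ S¹ → X_{n+1}`, and the
iterated structure maps `X_n ∧ S^k → X_{n+k}` are `Σ_n × Σ_k`-equivariant. -/
structure IsSymmetricSpectrum (X : SpectrumData.{w}) : Prop where
  act_refl : ∀ {n : ℕ} {ℓ : SimplexCategory} (x : Simp (X.level n) ℓ),
    X.act (Equiv.refl (Fin n)) x = x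
  act_trans : ∀ {n m p : ℕ} (e : Fin n ≃ Fin m) (f : Fin m ≃ Fin p) {ℓ : SimplexCategory}
    (x : Simp (X.level n) ℓ), X.act (e.trans f) x = X.act f (X.act e x)
  act_base : ∀ {n m : ℕ} (e : Fin n ≃ Fin m) (ℓ : SimplexCategory),
    X.act e (base (X.level n) ℓ) = base (X.level m) ℓ
  act_pull : ∀ {n m : ℕ} (e : Fin n ≃ Fin m) {k ℓ : SimplexCategory} (θ : k ⟶ ℓ)
    (x : Simp (X.level n) ℓ), X.act e (pull _ θ x) = pull _ θ (X.act e x)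
  str_base_left : ∀ (n : ℕ) {ℓ : SimplexCategory} (s : Simp circle ℓ),
    X.str (base (X.level n) ℓ) s = base (X.level (n + 1)) ℓ
  str_base_right : ∀ {n : ℕ} {ℓ : SimplexCategory} (x : Simp (X.level n) ℓ),
    X.str x (base circle ℓ) = base (X.level (n + 1)) ℓ
  str_pull : ∀ {n : ℕ} {k ℓ : SimplexCategory} (θ : k ⟶ ℓ) (x : Simp (X.level n) ℓ)
    (s : Simp circle ℓ), X.str (pull _ θ x) (pull _ θ s) = pull _ θ (X.str x s)
  strIter_act : ∀ {n n' k k' : ℕ} (e : Fin n ≃ Fin n') (f : Fin k ≃ Fin k')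
    {ℓ : SimplexCategory} (x : Simp (X.level n) ℓ) (s : Fin k → Simp circle ℓ),
    X.strIter (X.act e x) k' (s ∘ f.symm) = X.act (blockSum e f) (X.strIter x k s)

end SpectrumData

/-- A bimorphism `b : (X, Y) → Z` of symmetric spectra, i.e. a morphism `X ∧ Y → Z` out of the smash
product of symmetric spectra: maps of pointed simplicial sets `b_{p,q} : X_p ∧ Y_q → Z_{p+q}`,
written as maps of two variables, which are `Σ_p × Σ_q`-equivariant and make the bilinearity
diagram
`b_{p,q+1} ∘ (X_p ∧ σ_q) = σ_{p+q} ∘ (b_{p,q} ∧ S¹) =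
  (1 × χ_{1,q}) ∘ b_{p+1,q} ∘ (σ_p ∧ Y_q) ∘ (X_p ∧ twist)` commute. -/
structure IsBimorphism (X Y Z : SpectrumData.{w})
    (b : ∀ {p q : ℕ} {ℓ : SimplexCategory},
      Simp (X.level p) ℓ → Simp (Y.level q) ℓ → Simp (Z.level (p + q)) ℓ) : Prop where
  base_left : ∀ (p : ℕ) {q : ℕ} {ℓ : SimplexCategory} (y : Simp (Y.level q) ℓ),
    b (base (X.level p) ℓ) y = base (Z.level (p + q)) ℓ
  base_right : ∀ {p : ℕ} (q : ℕ) {ℓ : SimplexCategory} (x : Simp (X.level p) ℓ),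
    b x (base (Y.level q) ℓ) = base (Z.level (p + q)) ℓ
  map_pull : ∀ {p q : ℕ} {k ℓ : SimplexCategory} (θ : k ⟶ ℓ) (x : Simp (X.level p) ℓ)
    (y : Simp (Y.level q) ℓ), b (pull _ θ x) (pull _ θ y) = pull _ θ (b x y)
  map_act : ∀ {p p' q q' : ℕ} (e : Fin p ≃ Fin p') (f : Fin q ≃ Fin q') {ℓ : SimplexCategory}
    (x : Simp (X.level p) ℓ) (y : Simp (Y.level q) ℓ),
    b (X.act e x) (Y.act f y) = Z.act (blockSum e f) (b x y)
  str_right : ∀ {p q : ℕ} {ℓ : SimplexCategory} (x : Simp (X.level p) ℓ)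
    (y : Simp (Y.level q) ℓ) (s : Simp circle ℓ), b x (Y.str y s) = Z.str (b x y) s
  str_left : ∀ {p q : ℕ} {ℓ : SimplexCategory} (x : Simp (X.level p) ℓ)
    (y : Simp (Y.level q) ℓ) (s : Simp circle ℓ),
    Z.act (chiOne p q) (b (X.str x s) y) = Z.str (b x y) s

/-- A vertex of level zero of `X`, i.e. a morphism from the sphere spectrum to `X`. -/
abbrev SpectrumData.Vertex (X : SpectrumData.{w}) : Type w := Simp (X.level 0) (SimplexCategory.mk 0)

/-- A vertex of level zero, regarded as a (degenerate) `ℓ`-simplex. -/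
def SpectrumData.degen (X : SpectrumData.{w}) (a : X.Vertex) (ℓ : SimplexCategory) :
    Simp (X.level 0) ℓ :=
  pull _ (SimplexCategory.const ℓ (SimplexCategory.mk 0) 0) a

/-! ### Spectral categories -/

/-- The data of a category enriched over symmetric `S¹`-spectra. Compositions
`[X, Y] ∧ [Y, Z] → [X, Z]` are given by bimorphisms, written in diagrammatic order, and units, which
are morphisms from the sphere spectrum to `[X, X]`, by vertices of level zero.
The axioms are in `SpectralCategoryData.IsSpectralCategory`. -/
structure SpectralCategoryData (Ob : Type u) where
  hom : Ob → Ob → SpectrumData.{w}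
  comp : ∀ {X Y Z : Ob} {p q : ℕ} {ℓ : SimplexCategory},
    Simp ((hom X Y).level p) ℓ → Simp ((hom Y Z).level q) ℓ → Simp ((hom X Z).level (p + q)) ℓ
  one : ∀ X : Ob, (hom X X).Vertex

/-- The axioms of a spectral category. -/
structure SpectralCategoryData.IsSpectralCategory {Ob : Type u}
    (A : SpectralCategoryData.{u, w} Ob) : Prop where
  isSymmetricSpectrum_hom : ∀ X Y : Ob, (A.hom X Y).IsSymmetricSpectrum
  isBimorphism_comp : ∀ X Y Z : Ob,
    IsBimorphism (A.hom X Y) (A.hom Y Z) (A.hom X Z) (fun f g => A.comp f g)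
  assoc : ∀ {X Y Z W : Ob} {p q r : ℕ} {ℓ : SimplexCategory} (f : Simp ((A.hom X Y).level p) ℓ)
    (g : Simp ((A.hom Y Z).level q) ℓ) (h : Simp ((A.hom Z W).level r) ℓ),
    (A.hom X W).act (finCongr (Nat.add_assoc p q r)) (A.comp (A.comp f g) h) =
      A.comp f (A.comp g h)
  comp_one : ∀ {X Y : Ob} {p : ℕ} {ℓ : SimplexCategory} (f : Simp ((A.hom X Y).level p) ℓ),
    A.comp f ((A.hom Y Y).degen (A.one Y) ℓ) = f
  one_comp : ∀ {X Y : Ob} {p : ℕ} {ℓ : SimplexCategory} (f : Simp ((A.hom X Y).level p) ℓ),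
    (A.hom X Y).act (finCongr (Nat.zero_add p)) (A.comp ((A.hom X X).degen (A.one X) ℓ) f) = f

/-- The unit of a spectral category as a degenerate `ℓ`-simplex. -/
def SpectralCategoryData.oneAt {Ob : Type u} (A : SpectralCategoryData.{u, w} Ob) (X : Ob)
    (ℓ : SimplexCategory) : Simp ((A.hom X X).level 0) ℓ :=
  (A.hom X X).degen (A.one X) ℓ

/-- Composition in the underlying category, whose morphisms `X → Y` are the vertices of `[X, Y]_0`. -/
def SpectralCategoryData.vcomp {Ob : Type u} (A : SpectralCategoryData.{u, w} Ob) {X Y Z : Ob}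
    (a : (A.hom X Y).Vertex) (b : (A.hom Y Z).Vertex) : (A.hom X Z).Vertex :=
  (A.comp a b : Simp ((A.hom X Z).level (0 + 0)) (SimplexCategory.mk 0))

/-- The data of a symmetric monoidal structure on a spectral category `A`: a tensor product
`A ∧ A → A`, given on objects by `tensorObj` and on morphisms by bimorphisms
`([X, X'], [Y, Y']) → [X ⊗ Y, X' ⊗ Y']`, a unit object, and the associativity, unit and symmetry
isomorphisms with their inverses, all of which are vertices of level zero. -/
structure TensorData {Ob : Type u} (A : SpectralCategoryData.{u, w} Ob) where
  tensorObj : Ob → Ob → Ob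
  unit : Ob
  tensorHom : ∀ {X X' Y Y' : Ob} {p q : ℕ} {ℓ : SimplexCategory},
    Simp ((A.hom X X').level p) ℓ → Simp ((A.hom Y Y').level q) ℓ →
      Simp ((A.hom (tensorObj X Y) (tensorObj X' Y')).level (p + q)) ℓ
  assoc : ∀ X Y Z : Ob,
    (A.hom (tensorObj (tensorObj X Y) Z) (tensorObj X (tensorObj Y Z))).Vertex
  assocInv : ∀ X Y Z : Ob,
    (A.hom (tensorObj X (tensorObj Y Z)) (tensorObj (tensorObj X Y) Z)).Vertex
  leftUnitor : ∀ X : Ob, (A.hom (tensorObj unit X) X).Vertex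
  leftUnitorInv : ∀ X : Ob, (A.hom X (tensorObj unit X)).Vertex
  rightUnitor : ∀ X : Ob, (A.hom (tensorObj X unit) X).Vertex
  rightUnitorInv : ∀ X : Ob, (A.hom X (tensorObj X unit)).Vertex
  braiding : ∀ X Y : Ob, (A.hom (tensorObj X Y) (tensorObj Y X)).Vertex

/-- The tensor product of two morphisms of the underlying category. -/
def TensorData.vtensor {Ob : Type u} {A : SpectralCategoryData.{u, w} Ob} (M : TensorData A)
    {X X' Y Y' : Ob} (a : (A.hom X X').Vertex) (b : (A.hom Y Y').Vertex) :
    (A.hom (M.tensorObj X Y) (M.tensorObj X' Y')).Vertex :=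
  (M.tensorHom a b :
    Simp ((A.hom (M.tensorObj X Y) (M.tensorObj X' Y')).level (0 + 0)) (SimplexCategory.mk 0))

/-- The axioms of a symmetric monoidal spectral category: the tensor product is a spectral functor
`A ∧ A → A` (first three axioms; the permutation in `tensor_comp` comes from the twist in the
composition law of `A ∧ A`), the structure isomorphisms are mutually inverse and natural in the
spectral sense, and the coherence diagrams of a symmetric monoidal category commute. In the
naturality of the braiding, the functor `(X, Y) ↦ Y ⊗ X` involves the twist
`[X, X'] ∧ [Y, Y'] → [Y, Y'] ∧ [X, X']`, hence a shuffle. -/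
structure TensorData.IsSymmetricMonoidal {Ob : Type u} {A : SpectralCategoryData.{u, w} Ob}
    (M : TensorData A) : Prop where
  isBimorphism_tensorHom : ∀ X X' Y Y' : Ob,
    IsBimorphism (A.hom X X') (A.hom Y Y') (A.hom (M.tensorObj X Y) (M.tensorObj X' Y'))
      (fun f g => M.tensorHom f g)
  tensor_comp : ∀ {X X' X'' Y Y' Y'' : Ob} {p q s t : ℕ} {ℓ : SimplexCategory}
    (f : Simp ((A.hom X X').level p) ℓ) (f' : Simp ((A.hom X' X'').level s) ℓ)
    (g : Simp ((A.hom Y Y').level q) ℓ) (g' : Simp ((A.hom Y' Y'').level t) ℓ),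
    A.comp (M.tensorHom f g) (M.tensorHom f' g') =
      (A.hom _ _).act (chiMid p s q t) (M.tensorHom (A.comp f f') (A.comp g g'))
  tensor_one : ∀ X Y : Ob, M.vtensor (A.one X) (A.one Y) = A.one (M.tensorObj X Y)
  assoc_assocInv : ∀ X Y Z : Ob, A.vcomp (M.assoc X Y Z) (M.assocInv X Y Z) = A.one _
  assocInv_assoc : ∀ X Y Z : Ob, A.vcomp (M.assocInv X Y Z) (M.assoc X Y Z) = A.one _
  leftUnitor_leftUnitorInv : ∀ X : Ob,
    A.vcomp (M.leftUnitor X) (M.leftUnitorInv X) = A.one _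
  leftUnitorInv_leftUnitor : ∀ X : Ob,
    A.vcomp (M.leftUnitorInv X) (M.leftUnitor X) = A.one _
  rightUnitor_rightUnitorInv : ∀ X : Ob,
    A.vcomp (M.rightUnitor X) (M.rightUnitorInv X) = A.one _
  rightUnitorInv_rightUnitor : ∀ X : Ob,
    A.vcomp (M.rightUnitorInv X) (M.rightUnitor X) = A.one _
  braiding_braiding : ∀ X Y : Ob, A.vcomp (M.braiding X Y) (M.braiding Y X) = A.one _
  assoc_natural : ∀ {X X' Y Y' Z Z' : Ob} {p q r : ℕ} {ℓ : SimplexCategory}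
    (f : Simp ((A.hom X X').level p) ℓ) (g : Simp ((A.hom Y Y').level q) ℓ)
    (h : Simp ((A.hom Z Z').level r) ℓ),
    (A.hom _ _).act (finCongr (Nat.add_assoc p q r))
        (A.comp (p := p + q + r) (q := 0) (M.tensorHom (M.tensorHom f g) h) ((A.hom _ _).degen (M.assoc X' Y' Z') ℓ)) =
      (A.hom _ _).act (finCongr (Nat.zero_add (p + (q + r))))
        (A.comp ((A.hom _ _).degen (M.assoc X Y Z) ℓ) (M.tensorHom f (M.tensorHom g h)))
  leftUnitor_natural : ∀ {X X' : Ob} {p : ℕ} {ℓ : SimplexCategory}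
    (f : Simp ((A.hom X X').level p) ℓ),
    A.comp (M.tensorHom (A.oneAt M.unit ℓ) f) ((A.hom _ _).degen (M.leftUnitor X') ℓ) =
      A.comp ((A.hom _ _).degen (M.leftUnitor X) ℓ) f
  rightUnitor_natural : ∀ {X X' : Ob} {p : ℕ} {ℓ : SimplexCategory}
    (f : Simp ((A.hom X X').level p) ℓ),
    A.comp (M.tensorHom f (A.oneAt M.unit ℓ)) ((A.hom _ _).degen (M.rightUnitor X') ℓ) =
      (A.hom _ _).act (finCongr (Nat.zero_add p))
        (A.comp ((A.hom _ _).degen (M.rightUnitor X) ℓ) f)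
  braiding_natural : ∀ {X X' Y Y' : Ob} {p q : ℕ} {ℓ : SimplexCategory}
    (f : Simp ((A.hom X X').level p) ℓ) (g : Simp ((A.hom Y Y').level q) ℓ),
    A.comp (p := p + q) (q := 0) (M.tensorHom f g) ((A.hom _ _).degen (M.braiding X' Y') ℓ) =
      (A.hom _ _).act ((finCongr (Nat.zero_add (q + p))).trans (chi q p))
        (A.comp ((A.hom _ _).degen (M.braiding X Y) ℓ) (M.tensorHom g f))
  pentagon : ∀ W X Y Z : Ob,
    A.vcomp (A.vcomp (M.vtensor (M.assoc W X Y) (A.one Z)) (M.assoc W (M.tensorObj X Y) Z))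
        (M.vtensor (A.one W) (M.assoc X Y Z)) =
      A.vcomp (M.assoc (M.tensorObj W X) Y Z) (M.assoc W X (M.tensorObj Y Z))
  triangle : ∀ X Y : Ob,
    A.vcomp (M.assoc X M.unit Y) (M.vtensor (A.one X) (M.leftUnitor Y)) =
      M.vtensor (M.rightUnitor X) (A.one Y)
  hexagon : ∀ X Y Z : Ob,
    A.vcomp (A.vcomp (M.assoc X Y Z) (M.braiding X (M.tensorObj Y Z))) (M.assoc Y Z X) =
      A.vcomp (A.vcomp (M.vtensor (M.braiding X Y) (A.one Z)) (M.assoc Y X Z))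
        (M.vtensor (A.one Y) (M.braiding X Z))

/-! ### Smash products of objects with finite pointed sets -/

section Smash

variable {C : Type u} [Category.{v} C] [HasFiniteCoproducts C]

/-- The object `A ∧ K = ⋁_{K ∖ *} A`, where `K` is the finite pointed set with `K ∖ * = ι`. -/
def smash (A : C) (ι : Type) [Finite ι] : C := ∐ fun _ : ι => A

/-- The inclusion of the summand labelled by `i`. -/
def incl (A : C) {ι : Type} [Finite ι] (i : ι) : A ⟶ smash A ι := Sigma.ι (fun _ : ι => A) i

/-- The morphism `A ∧ K → B` with prescribed restrictions to the summands. -/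
def desc {A B : C} {ι : Type} [Finite ι] (f : ι → (A ⟶ B)) : smash A ι ⟶ B := Sigma.desc f

lemma incl_desc {A B : C} {ι : Type} [Finite ι] (f : ι → (A ⟶ B)) (i : ι) :
    incl A i ≫ desc f = f i := by
  exact colimit.ι_desc _ _

lemma smash_ext {A B : C} {ι : Type} [Finite ι] {f g : smash A ι ⟶ B}
    (h : ∀ i, incl A i ≫ f = incl A i ≫ g) : f = g :=
  Sigma.hom_ext f g h

variable [HasZeroMorphisms C]

/-- The morphism `A ∧ u : A ∧ K → A ∧ L` induced by a pointed map `u : K → L`, where the value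
`none` of `u` is the base point of `L`. -/
def smashMap (A : C) {ι κ : Type} [Finite ι] [Finite κ] (u : ι → Option κ) :
    smash A ι ⟶ smash A κ :=
  desc fun i => (u i).elim 0 (incl A)

lemma smashMap_some (A : C) {ι : Type} [Finite ι] : smashMap A (fun i : ι => some i) = 𝟙 _ := by
  apply smash_ext
  intro i
  rw [smashMap, incl_desc, Category.comp_id]
  rfl

lemma smashMap_comp (A : C) {ι κ μ : Type} [Finite ι] [Finite κ] [Finite μ] (u : ι → Option κ)
    (t : κ → Option μ) : smashMap A u ≫ smashMap A t = smashMap A (fun i => (u i).bind t) := by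
  apply smash_ext
  intro i
  rw [smashMap, ← Category.assoc, incl_desc, smashMap, smashMap, incl_desc]
  cases h : u i with
  | none => simp
  | some k => simp [incl_desc]

end Smash

/-! ### The ambient category -/

section Ambient

variable (C : Type u) [Category.{v} C] [MonoidalCategory C]

/-- The canonical morphism `⋁ᵢ (Aᵢ ∧ B) → (⋁ᵢ Aᵢ) ∧ B` is an isomorphism for every finite (possibly
empty) family. -/
class FinitelyDistributive [HasFiniteCoproducts C] : Prop where
  isIso_desc : ∀ {ι : Type} [Finite ι] (A : ι → C) (B : C),
    IsIso (Limits.Sigma.desc fun i => Sigma.ι A i ▷ B : (∐ fun i => A i ⊗ B) ⟶ (∐ A) ⊗ B)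

/-- A ring object in the category of symmetric sequences in `C`. -/
structure RingObject where
  obj : ℕ → C
  act : ∀ {n m : ℕ}, (Fin n ≃ Fin m) → (obj n ⟶ obj m)
  act_refl : ∀ n : ℕ, act (Equiv.refl (Fin n)) = 𝟙 (obj n)
  act_trans : ∀ {n m p : ℕ} (e : Fin n ≃ Fin m) (f : Fin m ≃ Fin p),
    act (e.trans f) = act e ≫ act f
  mul : ∀ n m : ℕ, obj n ⊗ obj m ⟶ obj (n + m)
  mul_act : ∀ {n n' m m' : ℕ} (e : Fin n ≃ Fin n') (f : Fin m ≃ Fin m'),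
    (act e ⊗ₘ act f) ≫ mul n' m' = mul n m ≫ act (blockSum e f)
  one : 𝟙_ C ⟶ obj 0
  mul_assoc : ∀ n m p : ℕ,
    mul n m ▷ obj p ≫ mul (n + m) p ≫ act (finCongr (Nat.add_assoc n m p)) =
      (α_ (obj n) (obj m) (obj p)).hom ≫ obj n ◁ mul m p ≫ mul n (m + p)
  mul_one : ∀ n : ℕ, (ρ_ (obj n)).inv ≫ obj n ◁ one ≫ mul n 0 = 𝟙 (obj n)
  one_mul : ∀ n : ℕ,
    (λ_ (obj n)).inv ≫ one ▷ obj n ≫ mul 0 n ≫ act (finCongr (Nat.zero_add n)) = 𝟙 (obj n)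

variable {C}

/-- A symmetric ring `T`-spectrum: a ring object `E` with a second unit map `T → E_1` which is
central. -/
structure RingSpectrum [SymmetricCategory C] (T : C) extends RingObject C where
  unit₁ : T ⟶ obj 1
  central : ∀ n : ℕ,
    obj n ◁ unit₁ ≫ mul n 1 ≫ act (chi n 1) =
      (β_ (obj n) T).hom ≫ unit₁ ▷ obj n ≫ mul 1 n

/-- Commutativity of a symmetric ring `T`-spectrum. -/
def RingSpectrum.IsCommutative [SymmetricCategory C] {T : C} (E : RingSpectrum T) : Prop :=
  ∀ n m : ℕ, E.mul n m ≫ E.act (chi n m) = (β_ (E.obj n) (E.obj m)).hom ≫ E.mul m n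

/-! ### Smash powers -/

/-- The power `P^{∧n}`, with `P^{∧0}` the monoidal unit and `P^{∧(n+1)} = P^{∧n} ∧ P`. -/
def pow (P : C) : ℕ → C
  | 0 => 𝟙_ C
  | n + 1 => pow P n ⊗ P

/-- The canonical isomorphism `P^{∧(n+m)} ≅ P^{∧n} ∧ P^{∧m}`. -/
def powAdd (P : C) (n : ℕ) : ∀ m : ℕ, pow P (n + m) ⟶ pow P n ⊗ pow P m
  | 0 => (ρ_ (pow P n)).inv
  | m + 1 => powAdd P n m ▷ P ≫ (α_ (pow P n) (pow P m) P).hom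

variable [SymmetricCategory C]

/-- The exchange of the last two factors, `(A ∧ B) ∧ D ≅ (A ∧ D) ∧ B`. -/
def swapRight (A B D : C) : (A ⊗ B) ⊗ D ⟶ (A ⊗ D) ⊗ B :=
  (α_ A B D).hom ≫ A ◁ (β_ B D).hom ≫ (α_ A D B).inv

/-- The isomorphism of `P^{∧(n+1)}` which moves the last factor to position `i` (counted from `0`)
and keeps the order of the other factors. -/
def powInsert (P : C) : ∀ (n : ℕ), Fin (n + 1) → (pow P n ⊗ P ⟶ pow P (n + 1))
  | 0, _ => 𝟙 _
  | n + 1, i =>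
    if h : i = Fin.last (n + 1) then 𝟙 _
    else swapRight (pow P n) P P ≫ powInsert P n (i.castPred h) ▷ P

/-- The left action of permutations on `P^{∧n}`: the `k`-th factor is moved to
position `e k`. -/
def powAct (P : C) : ∀ {n m : ℕ}, (Fin n ≃ Fin m) → (pow P n ⟶ pow P m)
  | 0, 0, _ => 𝟙 _
  | 0, _ + 1, e => (e.symm 0).elim0
  | _ + 1, 0, e => (e 0).elim0
  | n + 1, m + 1, e => powAct P (removeLast e) ▷ P ≫ powInsert P m (e (Fin.last n))

variable [HasFiniteCoproducts C]

/-- The inverse of the canonical isomorphism `A ∧ B ∧ K → (A ∧ K) ∧ B`. -/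
def distribRight [FinitelyDistributive C] (A : C) (ι : Type) [Finite ι] (B : C) :
    smash A ι ⊗ B ⟶ smash (A ⊗ B) ι :=
  @inv _ _ _ _ (Limits.Sigma.desc fun i => Sigma.ι (fun _ : ι => A) i ▷ B)
    (FinitelyDistributive.isIso_desc (fun _ : ι => A) B)

/-- The canonical isomorphism `A ∧ (B ∧ K) → (A ∧ B) ∧ K`. -/
def distribLeft [FinitelyDistributive C] (A B : C) (ι : Type) [Finite ι] :
    A ⊗ smash B ι ⟶ smash (A ⊗ B) ι :=
  (β_ A (smash B ι)).hom ≫ distribRight B ι A ≫ desc fun i => (β_ B A).hom ≫ incl (A ⊗ B) i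

variable [HasZeroMorphisms C]

/-! ### Correspondences -/

/-- The pointed simplicial set `Hom_C(A, B ∧ S^n)`, with the zero morphism as base point. -/
def homSphere (A B : C) (n : ℕ) : SimplicialObject Pointed.{v} where
  obj ℓ := ⟨A ⟶ smash B (Cell n ℓ.unop), 0⟩
  map θ := ⟨fun f => f ≫ smashMap B (cellPull n θ.unop), zero_comp⟩
  map_id ℓ := by
    apply Pointed.Hom.ext
    funext f
    have h : cellPull n (𝟙 ℓ.unop) = fun s => some s := funext (cellPull_id n)
    change f ≫ smashMap B (cellPull n (𝟙 ℓ.unop)) = f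
    rw [h, smashMap_some, Category.comp_id]
  map_comp θ η := by
    apply Pointed.Hom.ext
    funext f
    have h : cellPull n (η.unop ≫ θ.unop) = fun s => (cellPull n θ.unop s).bind
      (cellPull n η.unop) := funext (cellPull_comp n η.unop θ.unop)
    change f ≫ smashMap B (cellPull n (η.unop ≫ θ.unop)) =
      (f ≫ smashMap B (cellPull n θ.unop)) ≫ smashMap B (cellPull n η.unop)
    rw [h, Category.assoc, smashMap_comp]

/-- An `ℓ`-simplex of the simplicial set of `(E, σ)`-correspondences of level `n` from `X` to `Y`. -/
abbrev CorrHom (P : C) {T : C} (E : RingSpectrum T) (n : ℕ) (ℓ : SimplexCategory) (X Y : C) :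
    Type v :=
  X ⊗ pow P n ⟶ smash (Y ⊗ E.obj n) (Cell n ℓ)

/-- The pointed simplicial set of `(E, σ)`-correspondences of level `n`,
`Hom_C(X ∧ P^{∧n}, Y ∧ E_n ∧ S^n)`. -/
def corrLevel (P : C) {T : C} (E : RingSpectrum T) (X Y : C) (n : ℕ) :
    SimplicialObject Pointed.{v} :=
  homSphere (X ⊗ pow P n) (Y ⊗ E.obj n) n

/-- The action of permutations by conjugation, `e · f = (Y ∧ e ∧ e) ∘ f ∘ (X ∧ e⁻¹)`. Here `e` acts
on `S^n` by moving the `k`-th coordinate to position `e k`. -/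
def corrAct (P : C) {T : C} (E : RingSpectrum T) {X Y : C} {n m : ℕ} (e : Fin n ≃ Fin m)
    {ℓ : SimplexCategory} (f : CorrHom P E n ℓ X Y) : CorrHom P E m ℓ X Y :=
  X ◁ powAct P e.symm ≫ f ≫ desc fun s => Y ◁ E.act e ≫ incl (Y ⊗ E.obj m) (s ∘ e.symm)

variable [FinitelyDistributive C]

/-- The structure map `Hom(X ∧ P^{∧n}, Y ∧ E_n ∧ S^n) ∧ S¹ → Hom(X ∧ P^{∧(n+1)}, Y ∧ E_{n+1} ∧ S^{n+1})`.
It takes `(f, k)`, for `k` different from the base point, to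
`X ∧ P^{∧n} ∧ P → (Y ∧ E_n ∧ S^n) ∧ T ≅ (Y ∧ E_n ∧ T) ∧ S^n → Y ∧ E_{n+1} ∧ S^n → Y ∧ E_{n+1} ∧ S^{n+1}`,
where the first morphism is `f ∧ σ` and the last one is the inclusion of the summands with last
coordinate `k`. -/
def corrStr {P T : C} (σ : P ⟶ T) (E : RingSpectrum T) {X Y : C} {n : ℕ} {ℓ : SimplexCategory}
    (f : CorrHom P E n ℓ X Y) : Option (Arc ℓ) → CorrHom P E (n + 1) ℓ X Y
  | none => 0
  | some k =>
    (α_ X (pow P n) P).inv ≫ (f ⊗ₘ σ) ≫ distribRight (Y ⊗ E.obj n) (Cell n ℓ) T ≫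
      desc fun s =>
        (α_ Y (E.obj n) T).hom ≫ Y ◁ (E.obj n ◁ E.unit₁ ≫ E.mul n 1) ≫
          incl (Y ⊗ E.obj (n + 1)) (Fin.snoc s k : Cell (n + 1) ℓ)

/-- The spectrum `(Corr_0(X, Y), Corr_1(X, Y), Corr_2(X, Y), …)`. -/
def corrSpectrum {P T : C} (σ : P ⟶ T) (E : RingSpectrum T) (X Y : C) : SpectrumData.{v} where
  level n := corrLevel P E X Y n
  act e _ f := corrAct P E e f
  str f k := corrStr σ E f k

/-- The pairing `φ`. It takes `f : X ∧ P^{∧n} → Y ∧ E_n ∧ S^n` and `g : Y ∧ P^{∧m} → Z ∧ E_m ∧ S^m` to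
`X ∧ P^{∧n} ∧ P^{∧m} → Y ∧ E_n ∧ S^n ∧ P^{∧m} ≅ Y ∧ P^{∧m} ∧ E_n ∧ S^n → Z ∧ E_m ∧ S^m ∧ E_n ∧ S^n
  ≅ Z ∧ E_n ∧ E_m ∧ S^n ∧ S^m → Z ∧ E_{n+m} ∧ S^{n+m}`. -/
def corrComp (P : C) {T : C} (E : RingSpectrum T) {X Y Z : C} {n m : ℕ} {ℓ : SimplexCategory}
    (f : CorrHom P E n ℓ X Y) (g : CorrHom P E m ℓ Y Z) : CorrHom P E (n + m) ℓ X Z :=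
  X ◁ powAdd P n m ≫ (α_ X (pow P n) (pow P m)).inv ≫ f ▷ pow P m ≫
    distribRight (Y ⊗ E.obj n) (Cell n ℓ) (pow P m) ≫
      desc fun s =>
        swapRight Y (E.obj n) (pow P m) ≫ g ▷ E.obj n ≫
          distribRight (Z ⊗ E.obj m) (Cell m ℓ) (E.obj n) ≫
            desc fun t =>
              swapRight Z (E.obj m) (E.obj n) ≫ (α_ Z (E.obj n) (E.obj m)).hom ≫
                Z ◁ E.mul n m ≫ incl (Z ⊗ E.obj (n + m)) (Fin.append s t : Cell (n + m) ℓ)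

/-- The vertex of `Corr_0(X, Y)` given by a morphism `a : X → Y`, namely
`X ≅ X ∧ S → Y ∧ S → Y ∧ E_0`. -/
def corrOfHom (P : C) {T : C} (E : RingSpectrum T) {X Y : C} (a : X ⟶ Y) :
    CorrHom P E 0 (SimplexCategory.mk 0) X Y :=
  a ▷ 𝟙_ C ≫ Y ◁ E.one ≫ incl (Y ⊗ E.obj 0) (Fin.elim0 : Cell 0 (SimplexCategory.mk 0))

/-- The pairing `ψ`. It takes `f : X ∧ P^{∧p} → X' ∧ E_p ∧ S^p` and `g : Y ∧ P^{∧q} → Y' ∧ E_q ∧ S^q` to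
`X ∧ Y ∧ P^{∧p} ∧ P^{∧q} ≅ X ∧ P^{∧p} ∧ Y ∧ P^{∧q} → X' ∧ E_p ∧ S^p ∧ Y' ∧ E_q ∧ S^q
  ≅ X' ∧ Y' ∧ E_p ∧ E_q ∧ S^p ∧ S^q → X' ∧ Y' ∧ E_{p+q} ∧ S^{p+q}`. -/
def corrTensorHom (P : C) {T : C} (E : RingSpectrum T) {X X' Y Y' : C} {p q : ℕ}
    {ℓ : SimplexCategory} (f : CorrHom P E p ℓ X X') (g : CorrHom P E q ℓ Y Y') :
    CorrHom P E (p + q) ℓ (X ⊗ Y) (X' ⊗ Y') :=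
  (X ⊗ Y) ◁ powAdd P p q ≫ tensorμ X Y (pow P p) (pow P q) ≫ (f ⊗ₘ g) ≫
    distribRight (X' ⊗ E.obj p) (Cell p ℓ) (smash (Y' ⊗ E.obj q) (Cell q ℓ)) ≫
      desc fun s =>
        distribLeft (X' ⊗ E.obj p) (Y' ⊗ E.obj q) (Cell q ℓ) ≫
          desc fun t =>
            tensorμ X' (E.obj p) Y' (E.obj q) ≫ (X' ⊗ Y') ◁ E.mul p q ≫
              incl ((X' ⊗ Y') ⊗ E.obj (p + q)) (Fin.append s t : Cell (p + q) ℓ)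

/-- The spectral category `Corr_*^{E,σ}(B)` on the objects of the full subcategory `B`. -/
def corrCategory {P T : C} (σ : P ⟶ T) (E : RingSpectrum T) (B : ObjectProperty C) :
    SpectralCategoryData.{u, v} B.FullSubcategory where
  hom X Y := corrSpectrum σ E X.obj Y.obj
  comp f g := corrComp P E f g
  one X := corrOfHom P E (𝟙 X.obj)

/-- The tensor product `ψ` on `Corr_*^{E,σ}(B)`, with the product on objects, the unit object and the
structure isomorphisms of `B`. -/
def corrTensor {P T : C} (σ : P ⟶ T) (E : RingSpectrum T) (B : ObjectProperty C)
    (hB : ∀ X Y : C, B X → B Y → B (X ⊗ Y)) (hS : B (𝟙_ C)) :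
    TensorData (corrCategory σ E B) where
  tensorObj X Y := ⟨X.obj ⊗ Y.obj, hB _ _ X.property Y.property⟩
  unit := ⟨𝟙_ C, hS⟩
  tensorHom f g := corrTensorHom P E f g
  assoc X Y Z := corrOfHom P E (α_ X.obj Y.obj Z.obj).hom
  assocInv X Y Z := corrOfHom P E (α_ X.obj Y.obj Z.obj).inv
  leftUnitor X := corrOfHom P E (λ_ X.obj).hom
  leftUnitorInv X := corrOfHom P E (λ_ X.obj).inv
  rightUnitor X := corrOfHom P E (ρ_ X.obj).hom
  rightUnitorInv X := corrOfHom P E (ρ_ X.obj).inv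
  braiding X Y := corrOfHom P E (β_ X.obj Y.obj).hom

end Ambient

end Corr

end

/-!
Fix a simplicial degree `ℓ`. Since `∧` distributes over finite coproducts, the objects `E_n ∧ S^n_ℓ`
form a symmetric sequence with a unital and associative multiplication again (`sphereRing`), which
is commutative if `E` is, and the `ℓ`-simplices of `Corr_n(X, Y)` may be regarded as morphisms
`X ∧ P^{∧n} ⟶ Y ∧ R_n` for `R` this ring object (`toPowHom`, which is injective because the
canonical morphism `(Y ∧ E_n) ∧ S^n ⟶ Y ∧ (E_n ∧ S^n)` is mono). All coproducts are absorbed into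
`R` in this way, and the actions, compositions, tensor products and structure maps of
correspondences become operations on such morphisms (`PowHom`) which make sense for every
ring object `R`.

For these operations everything follows from the axioms of `R` and coherence:

* Composition and tensor product are pasted from a part which does not involve `R` (`parComp`,
  `parTensor`), the splitting `P^{∧(n+m)} ≅ P^{∧n} ∧ P^{∧m}` and the multiplication of `R`. The laws
  of the first part say that two diagrams of given morphisms and structural isomorphisms agree.
  After the given morphisms have been aligned this is the coherence theorem for symmetric monoidal
  categories, `Structural.eq`. The splitting is compatible with permutations by the same theorem,
  applied to powers of `P` with labelled factors (`Structural.eq_of_pow`).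
* A structure map is the composition with an endomorphism of degree one of the target, given by
  `P ⟶ T ⟶ E_1` and a simplex of `S^1` (`sphereUnit`). Centrality of `T ⟶ E_1` means that these
  endomorphisms commute with all morphisms up to a permutation (`PowHom.comp_ofUnit`). Hence the
  structure maps are compatible with composition in both variables (`PowHom.act_chiOne_comp`), and,
  as adjacent transpositions generate the symmetric groups, the iterated structure maps are
  equivariant (`PowHom.act_sphere`).
* If `R` is commutative, its multiplication satisfies an interchange law
  (`RingObject.IsCommutative.tensorμ_mul`), and so do composition and tensor product
  (`PowHom.tensor_comp`). The compatibility of the tensor product with the structure maps is a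
  special case, since the tensor product of an identity with such an endomorphism is the
  endomorphism of the tensor product given by the same simplex.
* A simplicial operator induces a morphism of ring objects (`spherePull`), and the change of
  coefficients along such a morphism preserves all operations.
-/

noncomputable section

namespace Corr

universe v u w

/-! ### Coherence in symmetric monoidal categories -/

section Coherence

variable {C : Type u} [Category.{v} C] [MonoidalCategory C]

/-- A decoration of an object: a way of writing it as an iterated tensor product of the unit and of
other objects, the atoms, each of which carries a label. An atom may itself be a tensor product. -/
inductive Deco : C → Type u
  | unit : Deco (𝟙_ C)
  | atom {X : C} (i : ℕ) : Deco X
  | tensor {X Y : C} (d : Deco X) (e : Deco Y) : Deco (X ⊗ Y)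

/-- The tensor product of two decorations. -/
infixr:70 " ⊠ " => Deco.tensor

namespace Deco

/-- The labels of the atoms, from left to right. -/
def labels : ∀ {X : C}, Deco X → List ℕ
  | _, unit => []
  | _, atom i => [i]
  | _, tensor d e => d.labels ++ e.labels

/-- The occurrences of the object `A` with the label `i` in the atom with label `j` and object `Y`:
there is one if the labels and the objects agree, and none otherwise. -/
inductive OccAtom (i : ℕ) (A : C) : ℕ → C → Type u
  | here : OccAtom i A i A

/-- The isomorphism `Occ.pull` in the case of a single atom. -/
def OccAtom.pull {i : ℕ} {A : C} : ∀ {j : ℕ} {Y : C}, OccAtom i A j Y → (Y ≅ A ⊗ 𝟙_ C)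
  | _, _, .here => (ρ_ A).symm

/-- The occurrences of the object `A` with the label `i` among the atoms of a decoration. -/
def Occ (i : ℕ) (A : C) : ∀ {X : C}, Deco X → Type u
  | _, unit => PEmpty
  | _, atom (X := Y) j => OccAtom i A j Y
  | _, tensor d e => Occ i A d ⊕ Occ i A e

namespace Occ

variable {i : ℕ} {A : C}

/-- What is left of the object when the atom is replaced by the unit. -/
def restObj : ∀ {X : C} {d : Deco X}, Occ i A d → C
  | _, unit, o => PEmpty.elim o
  | _, atom _, _ => 𝟙_ C
  | _, tensor (X := X) (Y := Y) d e, o =>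
    match (o : Occ i A d ⊕ Occ i A e) with
    | .inl o => restObj o ⊗ Y
    | .inr o => X ⊗ restObj o

/-- The decoration of what is left. -/
def rest : ∀ {X : C} {d : Deco X} (o : Occ i A d), Deco o.restObj
  | _, unit, o => PEmpty.elim o
  | _, atom _, _ => unit
  | _, tensor d e, o =>
    match (o : Occ i A d ⊕ Occ i A e) with
    | .inl o => tensor (rest o) e
    | .inr o => tensor d (rest o)

lemma labels_perm {X : C} {d : Deco X} (o : Occ i A d) :
    d.labels.Perm (i :: o.rest.labels) := by
  induction d with
  | unit => exact o.elim
  | atom j => cases o; exact List.Perm.refl _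
  | tensor d e ih ih' =>
    cases o with
    | inl o => exact (ih o).append_right _
    | inr o => exact ((ih' o).append_left _).trans List.perm_middle

lemma mem_labels {X : C} {d : Deco X} (o : Occ i A d) : i ∈ d.labels :=
  o.labels_perm.mem_iff.2 List.mem_cons_self

lemma eq_of_nodup {X : C} {d : Deco X} (o o' : Occ i A d) (h : d.labels.Nodup) : o = o' := by
  induction d with
  | unit => exact o.elim
  | atom j => cases o; cases o'; rfl
  | tensor d e ih ih' =>
    rw [labels, List.nodup_append'] at h
    cases o with
    | inl o =>
      cases o' with
      | inl o' => rw [ih o o' h.1]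
      | inr o' => exact (h.2.2 o.mem_labels o'.mem_labels).elim
    | inr o =>
      cases o' with
      | inl o' => exact (h.2.2 o'.mem_labels o.mem_labels).elim
      | inr o' => rw [ih' o o' h.2.1]

variable [SymmetricCategory C]

/-- The canonical isomorphism which moves the atom to the front. -/
def pull : ∀ {X : C} {d : Deco X} (o : Occ i A d), X ≅ A ⊗ o.restObj
  | _, unit, o => PEmpty.elim o
  | _, atom _, o =>
    OccAtom.pull o
  | _, tensor (X := X) (Y := Y) d e, o =>
    match (o : Occ i A d ⊕ Occ i A e) with
    | .inl o => whiskerRightIso (pull o) Y ≪≫ α_ _ _ _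
    | .inr o =>
      whiskerLeftIso X (pull o) ≪≫ (α_ _ _ _).symm ≪≫ whiskerRightIso (β_ X A) _ ≪≫ α_ _ _ _

end Occ

lemma exists_occ {X : C} (d : Deco X) (h : d.labels ≠ []) :
    ∃ (i : ℕ) (A : C), Nonempty (Occ i A d) := by
  induction d with
  | unit => exact (h rfl).elim
  | @atom X i => exact ⟨i, X, ⟨OccAtom.here⟩⟩
  | tensor d e ihd ihe =>
    by_cases hd : d.labels = []
    · have he : e.labels ≠ [] := fun he => h (by rw [labels, hd, he]; rfl)
      obtain ⟨i, A, ⟨o⟩⟩ := ihe he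
      exact ⟨i, A, ⟨Sum.inr o⟩⟩
    · obtain ⟨i, A, ⟨o⟩⟩ := ihd hd
      exact ⟨i, A, ⟨Sum.inl o⟩⟩

/-- The canonical isomorphism to the unit from an object decorated without atoms. -/
def unitIso : ∀ {X : C} (d : Deco X), d.labels = [] → (X ≅ 𝟙_ C)
  | _, unit, _ => Iso.refl _
  | _, tensor d e, h =>
    (d.unitIso (List.append_eq_nil_iff.1 h).1 ⊗ᵢ e.unitIso (List.append_eq_nil_iff.1 h).2) ≪≫ λ_ _

lemma unitIso_tensor_hom {X Y : C} (d : Deco X) (e : Deco Y) (h : (d ⊠ e).labels = []) :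
    ((d ⊠ e).unitIso h).hom = (d.unitIso (List.append_eq_nil_iff.1 h).1).hom ▷ Y ≫
      (λ_ Y).hom ≫ (e.unitIso (List.append_eq_nil_iff.1 h).2).hom := by
  simp [unitIso, MonoidalCategory.tensorHom_def]

end Deco

variable [SymmetricCategory C]

open Deco

/-- The inductive definition behind `Structural`. -/
inductive StructuralMap : ∀ {X Y : C}, Deco X → Deco Y → (X ⟶ Y) → Prop
  | id {X : C} (d : Deco X) : StructuralMap d d (𝟙 X)
  | comp {X Y Z : C} {d : Deco X} {e : Deco Y} {k : Deco Z} {f : X ⟶ Y} {g : Y ⟶ Z} :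
    StructuralMap d e f → StructuralMap e k g → StructuralMap d k (f ≫ g)
  | whiskerRight {X Y Z : C} {d : Deco X} {e : Deco Y} (k : Deco Z) {f : X ⟶ Y} :
    StructuralMap d e f → StructuralMap (d ⊠ k) (e ⊠ k) (f ▷ Z)
  | whiskerLeft {X Y Z : C} {d : Deco X} {e : Deco Y} (k : Deco Z) {f : X ⟶ Y} :
    StructuralMap d e f → StructuralMap (k ⊠ d) (k ⊠ e) (Z ◁ f)
  | assoc {X Y Z : C} (d : Deco X) (e : Deco Y) (k : Deco Z) :
    StructuralMap ((d ⊠ e) ⊠ k) (d ⊠ (e ⊠ k)) (α_ X Y Z).hom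
  | assoc_inv {X Y Z : C} (d : Deco X) (e : Deco Y) (k : Deco Z) :
    StructuralMap (d ⊠ (e ⊠ k)) ((d ⊠ e) ⊠ k) (α_ X Y Z).inv
  | leftUnitor {X : C} (d : Deco X) : StructuralMap (unit ⊠ d) d (λ_ X).hom
  | leftUnitor_inv {X : C} (d : Deco X) : StructuralMap d (unit ⊠ d) (λ_ X).inv
  | rightUnitor {X : C} (d : Deco X) : StructuralMap (d ⊠ unit) d (ρ_ X).hom
  | rightUnitor_inv {X : C} (d : Deco X) : StructuralMap d (d ⊠ unit) (ρ_ X).inv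
  | braiding {X Y : C} (d : Deco X) (e : Deco Y) :
    StructuralMap (d ⊠ e) (e ⊠ d) (β_ X Y).hom

namespace StructuralMap

lemma labels_perm {X Y : C} {d : Deco X} {e : Deco Y} {f : X ⟶ Y} (h : StructuralMap d e f) :
    d.labels.Perm e.labels := by
  induction h with
  | comp _ _ ih ih' => exact ih.trans ih'
  | whiskerRight k _ ih => exact ih.append_right _
  | whiskerLeft k _ ih => exact ih.append_left _
  | braiding d e => exact List.perm_append_comm
  | _ => simp [labels]

/-- Structural maps commute with the isomorphisms which move an atom to the front. -/
lemma exists_comp_pull {X Y : C} {d : Deco X} {e : Deco Y} {f : X ⟶ Y} (h : StructuralMap d e f)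
    {i : ℕ} {A : C} (o : Occ i A d) :
    ∃ (o' : Occ i A e) (f' : o.restObj ⟶ o'.restObj), StructuralMap o.rest o'.rest f' ∧
      f ≫ o'.pull.hom = o.pull.hom ≫ A ◁ f' := by
  induction h with
  | id d => exact ⟨o, 𝟙 _, .id _, by simp⟩
  | comp _ _ ih ih' =>
    obtain ⟨o₁, f₁, h₁, e₁⟩ := ih o
    obtain ⟨o₂, f₂, h₂, e₂⟩ := ih' o₁
    exact ⟨o₂, f₁ ≫ f₂, h₁.comp h₂, by
      rw [Category.assoc, e₂, reassoc_of% e₁, MonoidalCategory.whiskerLeft_comp]⟩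
  | @whiskerRight X Y Z d e k f hf ih =>
    obtain o | o := o
    · obtain ⟨o₁, f₁, h₁, e₁⟩ := ih o
      refine ⟨Sum.inl o₁, f₁ ▷ Z, h₁.whiskerRight k, ?_⟩
      change f ▷ Z ≫ o₁.pull.hom ▷ Z ≫ (α_ _ _ _).hom =
        (o.pull.hom ▷ Z ≫ (α_ _ _ _).hom) ≫ A ◁ f₁ ▷ Z
      rw [← comp_whiskerRight_assoc, e₁]
      simp
    · refine ⟨Sum.inr o, f ▷ _, hf.whiskerRight (Occ.rest o), ?_⟩
      change f ▷ Z ≫ Y ◁ o.pull.hom ≫ (α_ _ _ _).inv ≫ (β_ _ _).hom ▷ _ ≫ (α_ _ _ _).hom =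
        (X ◁ o.pull.hom ≫ (α_ _ _ _).inv ≫ (β_ _ _).hom ▷ _ ≫ (α_ _ _ _).hom) ≫ A ◁ f ▷ _
      rw [← whisker_exchange_assoc, associator_inv_naturality_left_assoc,
        ← comp_whiskerRight_assoc, BraidedCategory.braiding_naturality_left]
      simp
  | @whiskerLeft X Y Z d e k f hf ih =>
    obtain o | o := o
    · refine ⟨Sum.inl o, _ ◁ f, hf.whiskerLeft (Occ.rest o), ?_⟩
      change Z ◁ f ≫ o.pull.hom ▷ Y ≫ (α_ _ _ _).hom =
        (o.pull.hom ▷ X ≫ (α_ _ _ _).hom) ≫ A ◁ _ ◁ f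
      rw [whisker_exchange_assoc]
      simp
    · obtain ⟨o₁, f₁, h₁, e₁⟩ := ih o
      refine ⟨Sum.inr o₁, Z ◁ f₁, h₁.whiskerLeft k, ?_⟩
      change Z ◁ f ≫ Z ◁ o₁.pull.hom ≫ (α_ _ _ _).inv ≫ (β_ _ _).hom ▷ _ ≫ (α_ _ _ _).hom =
        (Z ◁ o.pull.hom ≫ (α_ _ _ _).inv ≫ (β_ _ _).hom ▷ _ ≫ (α_ _ _ _).hom) ≫ A ◁ Z ◁ f₁
      rw [← MonoidalCategory.whiskerLeft_comp_assoc, e₁]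
      simp only [MonoidalCategory.whiskerLeft_comp, Category.assoc,
        associator_inv_naturality_right_assoc, whisker_exchange_assoc]
      simp
  | @assoc X Y Z d e k =>
    obtain (o | o) | o := o
    · refine ⟨Sum.inl o, _, .assoc (Occ.rest o) e k, ?_⟩
      change (α_ X Y Z).hom ≫ o.pull.hom ▷ (Y ⊗ Z) ≫ (α_ _ _ _).hom =
        ((o.pull.hom ▷ Y ≫ (α_ _ _ _).hom) ▷ Z ≫ (α_ _ _ _).hom) ≫ A ◁ (α_ _ _ _).hom
      simp
    · refine ⟨Sum.inr (Sum.inl o), _, .assoc d (Occ.rest o) k, ?_⟩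
      change (α_ X Y Z).hom ≫ X ◁ (o.pull.hom ▷ Z ≫ (α_ _ _ _).hom) ≫ (α_ _ _ _).inv ≫
          (β_ _ _).hom ▷ _ ≫ (α_ _ _ _).hom =
        ((X ◁ o.pull.hom ≫ (α_ _ _ _).inv ≫ (β_ _ _).hom ▷ _ ≫ (α_ _ _ _).hom) ▷ Z ≫
          (α_ _ _ _).hom) ≫ A ◁ (α_ _ _ _).hom
      simp
    · refine ⟨Sum.inr (Sum.inr o), _, .assoc d e (Occ.rest o), ?_⟩
      change (α_ X Y Z).hom ≫ X ◁ (Y ◁ o.pull.hom ≫ (α_ _ _ _).inv ≫ (β_ _ _).hom ▷ _ ≫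
          (α_ _ _ _).hom) ≫ (α_ _ _ _).inv ≫ (β_ _ _).hom ▷ _ ≫ (α_ _ _ _).hom =
        ((X ⊗ Y) ◁ o.pull.hom ≫ (α_ _ _ _).inv ≫ (β_ (X ⊗ Y) A).hom ▷ _ ≫ (α_ _ _ _).hom) ≫
          A ◁ (α_ _ _ _).hom
      simp [BraidedCategory.braiding_tensor_left_hom]
  | @assoc_inv X Y Z d e k =>
    obtain o | o | o := o
    · refine ⟨Sum.inl (Sum.inl o), _, .assoc_inv (Occ.rest o) e k, ?_⟩
      change (α_ X Y Z).inv ≫ (o.pull.hom ▷ Y ≫ (α_ _ _ _).hom) ▷ Z ≫ (α_ _ _ _).hom =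
        (o.pull.hom ▷ (Y ⊗ Z) ≫ (α_ _ _ _).hom) ≫ A ◁ (α_ _ _ _).inv
      simp
    · refine ⟨Sum.inl (Sum.inr o), _, .assoc_inv d (Occ.rest o) k, ?_⟩
      change (α_ X Y Z).inv ≫ (X ◁ o.pull.hom ≫ (α_ _ _ _).inv ≫ (β_ _ _).hom ▷ _ ≫
          (α_ _ _ _).hom) ▷ Z ≫ (α_ _ _ _).hom =
        (X ◁ (o.pull.hom ▷ Z ≫ (α_ _ _ _).hom) ≫ (α_ _ _ _).inv ≫ (β_ _ _).hom ▷ _ ≫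
          (α_ _ _ _).hom) ≫ A ◁ (α_ _ _ _).inv
      simp
    · refine ⟨Sum.inr o, _, .assoc_inv d e (Occ.rest o), ?_⟩
      change (α_ X Y Z).inv ≫ (X ⊗ Y) ◁ o.pull.hom ≫ (α_ _ _ _).inv ≫ (β_ (X ⊗ Y) A).hom ▷ _ ≫
          (α_ _ _ _).hom =
        (X ◁ (Y ◁ o.pull.hom ≫ (α_ _ _ _).inv ≫ (β_ _ _).hom ▷ _ ≫ (α_ _ _ _).hom) ≫
          (α_ _ _ _).inv ≫ (β_ _ _).hom ▷ _ ≫ (α_ _ _ _).hom) ≫ A ◁ (α_ _ _ _).inv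
      simp [BraidedCategory.braiding_tensor_left_hom]
  | @leftUnitor X d =>
    obtain o | o := o
    · exact PEmpty.elim o
    · refine ⟨o, _, .leftUnitor (Occ.rest o), ?_⟩
      change (λ_ X).hom ≫ o.pull.hom = (𝟙_ C ◁ o.pull.hom ≫ (α_ _ _ _).inv ≫
        (β_ _ _).hom ▷ _ ≫ (α_ _ _ _).hom) ≫ A ◁ (λ_ _).hom
      simp
  | @leftUnitor_inv X d =>
    refine ⟨Sum.inr o, _, .leftUnitor_inv o.rest, ?_⟩
    change (λ_ X).inv ≫ 𝟙_ C ◁ o.pull.hom ≫ (α_ _ _ _).inv ≫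
      (β_ _ _).hom ▷ _ ≫ (α_ _ _ _).hom = o.pull.hom ≫ A ◁ (λ_ _).inv
    simp
  | @rightUnitor X d =>
    obtain o | o := o
    · refine ⟨o, _, .rightUnitor (Occ.rest o), ?_⟩
      change (ρ_ X).hom ≫ o.pull.hom = (o.pull.hom ▷ 𝟙_ C ≫ (α_ _ _ _).hom) ≫ A ◁ (ρ_ _).hom
      simp
    · exact PEmpty.elim o
  | @rightUnitor_inv X d =>
    refine ⟨Sum.inl o, _, .rightUnitor_inv o.rest, ?_⟩
    change (ρ_ X).inv ≫ o.pull.hom ▷ 𝟙_ C ≫ (α_ _ _ _).hom = o.pull.hom ≫ A ◁ (ρ_ _).inv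
    simp
  | @braiding X Y d e =>
    obtain o | o := o
    · refine ⟨Sum.inr o, _, .braiding (Occ.rest o) e, ?_⟩
      change (β_ X Y).hom ≫ Y ◁ o.pull.hom ≫ (α_ _ _ _).inv ≫ (β_ _ _).hom ▷ _ ≫
        (α_ _ _ _).hom = (o.pull.hom ▷ Y ≫ (α_ _ _ _).hom) ≫ A ◁ (β_ _ _).hom
      rw [← BraidedCategory.braiding_naturality_left_assoc,
        BraidedCategory.braiding_tensor_left_hom]
      simp [← comp_whiskerRight_assoc]
    · refine ⟨Sum.inl o, _, .braiding d (Occ.rest o), ?_⟩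
      change (β_ X Y).hom ≫ o.pull.hom ▷ X ≫ (α_ _ _ _).hom = (X ◁ o.pull.hom ≫
        (α_ _ _ _).inv ≫ (β_ _ _).hom ▷ _ ≫ (α_ _ _ _).hom) ≫ A ◁ (β_ _ _).hom
      rw [← BraidedCategory.braiding_naturality_right_assoc,
        BraidedCategory.braiding_tensor_right_hom]
      simp

/-- A structural map without atoms is compatible with the identifications with the unit, hence is
determined by its source and target. -/
lemma comp_unitIso {X Y : C} {d : Deco X} {e : Deco Y} {f : X ⟶ Y} (h : StructuralMap d e f)
    (hd : d.labels = []) (he : e.labels = []) :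
    f ≫ (e.unitIso he).hom = (d.unitIso hd).hom := by
  induction h with
  | id d => simp
  | comp hf hg ih ih' =>
    have hk := hf.labels_perm.symm.trans (List.Perm.of_eq hd)
    rw [Category.assoc, ih' hk.eq_nil he, ih hd]
  | whiskerRight k hf ih =>
    simp [unitIso_tensor_hom, ← ih (List.append_eq_nil_iff.1 hd).1 (List.append_eq_nil_iff.1 he).1]
  | whiskerLeft k hf ih =>
    simp [unitIso_tensor_hom, ← ih (List.append_eq_nil_iff.1 hd).2 (List.append_eq_nil_iff.1 he).2,
      whisker_exchange_assoc]
  | braiding d e =>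
    simp [unitIso, ← unitors_equal, ← BraidedCategory.braiding_naturality_assoc]
  | assoc d e k => simp [unitIso_tensor_hom]
  | assoc_inv d e k => simp [unitIso_tensor_hom]
  | rightUnitor d => simp [unitIso, unitors_equal]
  | rightUnitor_inv d => simp [unitIso, unitors_equal]
  | _ => simp [unitIso]

/-- The coherence theorem: parallel structural maps between objects whose atoms are labelled
differently are equal. -/
theorem unique {X Y : C} {d : Deco X} {e : Deco Y} {f g : X ⟶ Y} (hf : StructuralMap d e f)
    (hg : StructuralMap d e g) (hd : d.labels.Nodup) : f = g := by
  obtain ⟨n, hn⟩ : ∃ n, d.labels.length = n := ⟨_, rfl⟩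
  -- induction on the number of atoms: one of them is moved to the front and split off
  induction n generalizing X Y with
  | zero =>
    have hd' := List.eq_nil_of_length_eq_zero hn
    have he' : e.labels = [] := (hf.labels_perm.symm.trans (List.Perm.of_eq hd')).eq_nil
    rw [← cancel_mono (e.unitIso he').hom, hf.comp_unitIso hd', hg.comp_unitIso hd']
  | succ n ih =>
    obtain ⟨i, A, ⟨o⟩⟩ := d.exists_occ (by rintro h; simp [h] at hn)
    obtain ⟨o₁, f₁, h₁, e₁⟩ := hf.exists_comp_pull o
    obtain ⟨o₂, f₂, h₂, e₂⟩ := hg.exists_comp_pull o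
    -- this is where the labels have to be different: both maps send the atom to the same place
    obtain rfl : o₁ = o₂ := o₁.eq_of_nodup o₂ (hf.labels_perm.nodup_iff.1 hd)
    rw [← cancel_mono o₁.pull.hom, e₁, e₂]
    have hp := o.labels_perm
    rw [ih h₁ h₂ (List.nodup_cons.1 (hp.nodup_iff.1 hd)).2 (by
      have := hp.length_eq
      simp only [List.length_cons] at this
      omega)]

end StructuralMap

/-- The morphism `f` is composed of associators, unitors and braidings, and takes the decoration `d`
to the decoration `e`. This is a class so that instance search, which works through `f` from left to
right, finds the proof and the decoration `e`. -/
class Structural {X Y : C} (d : Deco X) (e : outParam (Deco Y)) (f : X ⟶ Y) : Prop where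
  out : StructuralMap d e f

namespace Structural

/-- The coherence theorem for symmetric monoidal categories. The labels of the atoms have to be
different, since a braiding of an object with itself need not be the identity. -/
theorem eq {X Y : C} (d : Deco X) {e : Deco Y} {f g : X ⟶ Y} [hf : Structural d e f]
    [hg : Structural d e g] (hd : d.labels.Nodup := by simp [Deco.labels]) : f = g :=
  hf.out.unique hg.out hd

variable {X Y Z : C}

instance id (d : Deco X) : Structural d d (𝟙 X) := ⟨.id d⟩

instance comp (d : Deco X) (e : Deco Y) (k : Deco Z) (f : X ⟶ Y) (g : Y ⟶ Z)
    [hf : Structural d e f] [hg : Structural e k g] : Structural d k (f ≫ g) :=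
  ⟨hf.out.comp hg.out⟩

instance whiskerRight (d : Deco X) (e : Deco Y) (k : Deco Z) (f : X ⟶ Y) [hf : Structural d e f] :
    Structural (d ⊠ k) (e ⊠ k) (f ▷ Z) := ⟨hf.out.whiskerRight k⟩

instance whiskerLeft (d : Deco X) (e : Deco Y) (k : Deco Z) (f : X ⟶ Y) [hf : Structural d e f] :
    Structural (k ⊠ d) (k ⊠ e) (Z ◁ f) := ⟨hf.out.whiskerLeft k⟩

instance tensorHom {X' Y' : C} (d : Deco X) (e : Deco Y) (d' : Deco X') (e' : Deco Y') (f : X ⟶ Y)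
    (f' : X' ⟶ Y') [Structural d e f] [Structural d' e' f'] :
    Structural (d.tensor d') (e.tensor e') (f ⊗ₘ f') := by
  rw [MonoidalCategory.tensorHom_def]
  infer_instance

instance assoc (d : Deco X) (e : Deco Y) (k : Deco Z) :
    Structural ((d ⊠ e) ⊠ k) (d ⊠ (e ⊠ k)) (α_ X Y Z).hom := ⟨.assoc d e k⟩

instance assoc_inv (d : Deco X) (e : Deco Y) (k : Deco Z) :
    Structural (d ⊠ (e ⊠ k)) ((d ⊠ e) ⊠ k) (α_ X Y Z).inv := ⟨.assoc_inv d e k⟩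

instance leftUnitor (d : Deco X) : Structural (unit ⊠ d) d (λ_ X).hom := ⟨.leftUnitor d⟩

instance leftUnitor_inv (d : Deco X) : Structural d (unit ⊠ d) (λ_ X).inv :=
  ⟨.leftUnitor_inv d⟩

instance rightUnitor (d : Deco X) : Structural (d ⊠ unit) d (ρ_ X).hom := ⟨.rightUnitor d⟩

instance rightUnitor_inv (d : Deco X) : Structural d (d ⊠ unit) (ρ_ X).inv :=
  ⟨.rightUnitor_inv d⟩

instance braiding (d : Deco X) (e : Deco Y) : Structural (d ⊠ e) (e ⊠ d) (β_ X Y).hom :=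
  ⟨.braiding d e⟩

instance swapRight (d : Deco X) (e : Deco Y) (k : Deco Z) :
    Structural ((d ⊠ e) ⊠ k) ((d ⊠ k) ⊠ e) (swapRight X Y Z) := by
  unfold Corr.swapRight
  infer_instance

instance tensorμ {W : C} (d : Deco W) (e : Deco X) (k : Deco Y) (l : Deco Z) :
    Structural ((d ⊠ e) ⊠ (k ⊠ l)) ((d ⊠ k) ⊠ (e ⊠ l))
      (MonoidalCategory.tensorμ W X Y Z) := by
  unfold MonoidalCategory.tensorμ
  infer_instance

end Structural

/-- The composite `t` is `s ≫ f ≫ r`. This is a class so that instance search finds `s` and `r`. -/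
class Factors {X Y A B : C} (t : X ⟶ Y) (f : A ⟶ B) (s : outParam (X ⟶ A))
    (r : outParam (B ⟶ Y)) : Prop where
  out : t = s ≫ f ≫ r

namespace Factors

instance (priority := high) first {A B Y : C} (f : A ⟶ B) (r : B ⟶ Y) : Factors (f ≫ r) f (𝟙 A) r :=
  ⟨(Category.id_comp _).symm⟩

instance cons {X X' Y A B : C} (a : X ⟶ X') (t : X' ⟶ Y) (f : A ⟶ B) (s : X' ⟶ A) (r : B ⟶ Y)
    [h : Factors t f s r] : Factors (a ≫ t) f (a ≫ s) r := ⟨by rw [h.out, Category.assoc]⟩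

/-- To compare two composites which contain the morphism `f`, it suffices to compare what comes
after `f` if what comes before it is structural. -/
lemma congr {X Y A B : C} (d : Deco X) (f : A ⟶ B) {e : Deco A} {t t' : X ⟶ Y} {s s' : X ⟶ A}
    {r r' : B ⟶ Y} [h : Factors t f s r] [h' : Factors t' f s' r'] [Structural d e s]
    [Structural d e s'] (hr : r = r') (hd : d.labels.Nodup := by simp [Deco.labels]) : t = t' := by
  rw [h.out, h'.out, Structural.eq d (f := s) (g := s') hd, hr]

end Factors

end Coherence

/-! ### Morphisms with parameters and coefficients -/

section Parametrized

variable {C : Type u} [Category.{v} C] [MonoidalCategory C]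

/-- The effect on a morphism with parameters and coefficients of a change of the parameters and of
the coefficients. -/
def reparam {X Y P D P' D' : C} (a : P' ⟶ P) (d : D ⟶ D') (f : X ⊗ P ⟶ Y ⊗ D) :
    X ⊗ P' ⟶ Y ⊗ D' :=
  X ◁ a ≫ f ≫ Y ◁ d

lemma reparam_id {X Y P D : C} (f : X ⊗ P ⟶ Y ⊗ D) : reparam (𝟙 P) (𝟙 D) f = f := by
  simp [reparam]

lemma reparam_reparam {X Y P D P' D' P'' D'' : C} (a : P' ⟶ P) (d : D ⟶ D') (a' : P'' ⟶ P')
    (d' : D' ⟶ D'') (f : X ⊗ P ⟶ Y ⊗ D) :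
    reparam a' d' (reparam a d f) = reparam (a' ≫ a) (d ≫ d') f := by
  simp [reparam]

lemma reparam_comp_whiskerRight {X Y Z P D P' D' : C} (a : P' ⟶ P) (d : D ⟶ D')
    (f : X ⊗ P ⟶ Y ⊗ D) (b : Y ⟶ Z) : reparam a d f ≫ b ▷ D' = reparam a d (f ≫ b ▷ D) := by
  simp [reparam, whisker_exchange]

lemma whiskerRight_comp_reparam {W X Y P D P' D' : C} (a : P' ⟶ P) (d : D ⟶ D')
    (f : X ⊗ P ⟶ Y ⊗ D) (b : W ⟶ X) : b ▷ P' ≫ reparam a d f = reparam a d (b ▷ P ≫ f) := by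
  simp [reparam, whisker_exchange_assoc]

variable [SymmetricCategory C]

/-- The composite of two morphisms with parameters and coefficients: `f` may be thought of as a
morphism `X → Y` with parameters in `P` and coefficients in `D`. -/
def parComp {X Y Z P Q D F : C} (f : X ⊗ P ⟶ Y ⊗ D) (g : Y ⊗ Q ⟶ Z ⊗ F) :
    X ⊗ (P ⊗ Q) ⟶ Z ⊗ (D ⊗ F) :=
  (α_ X P Q).inv ≫ f ▷ Q ≫ swapRight Y D Q ≫ g ▷ D ≫ swapRight Z F D ≫ (α_ Z D F).hom

/-- The tensor product of two morphisms with parameters and coefficients. -/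
def parTensor {X X' Y Y' P Q D F : C} (f : X ⊗ P ⟶ X' ⊗ D) (g : Y ⊗ Q ⟶ Y' ⊗ F) :
    (X ⊗ Y) ⊗ (P ⊗ Q) ⟶ (X' ⊗ Y') ⊗ (D ⊗ F) :=
  tensorμ X Y P Q ≫ (f ⊗ₘ g) ≫ tensorμ X' D Y' F

lemma swapRight_naturality_left {A A' : C} (f : A ⟶ A') (B D : C) :
    f ▷ B ▷ D ≫ swapRight A' B D = swapRight A B D ≫ f ▷ D ▷ B := by
  simp only [swapRight, associator_naturality_left_assoc, Category.assoc,
    ← whisker_exchange_assoc, associator_inv_naturality_left]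

lemma swapRight_naturality_middle (A : C) {B B' : C} (f : B ⟶ B') (D : C) :
    (A ◁ f) ▷ D ≫ swapRight A B' D = swapRight A B D ≫ (A ⊗ D) ◁ f := by
  simp only [swapRight, associator_naturality_middle_assoc, Category.assoc,
    ← associator_inv_naturality_right, ← MonoidalCategory.whiskerLeft_comp_assoc,
    BraidedCategory.braiding_naturality_left]

lemma swapRight_naturality_right (A B : C) {D D' : C} (f : D ⟶ D') :
    (A ⊗ B) ◁ f ≫ swapRight A B D' = swapRight A B D ≫ (A ◁ f) ▷ B := by
  simp only [swapRight, associator_naturality_right_assoc, Category.assoc,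
    ← associator_inv_naturality_middle, ← MonoidalCategory.whiskerLeft_comp_assoc,
    BraidedCategory.braiding_naturality_right]

lemma swapRight_swapRight (A B D : C) : swapRight A B D ≫ swapRight A D B = 𝟙 _ :=
  Structural.eq (((.atom 0) ⊠ (.atom 1)) ⊠ (.atom 2))

/-- Two objects next to a morphism may be exchanged. -/
lemma whiskerRight_whiskerRight_swap {A A' : C} (f : A ⟶ A') (B D : C) :
    f ▷ B ▷ D = swapRight A B D ≫ f ▷ D ▷ B ≫ swapRight A' D B := by
  rw [← reassoc_of% swapRight_naturality_left, swapRight_swapRight, Category.comp_id]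

lemma whiskerLeft_eq_braiding (A : C) {B B' : C} (f : B ⟶ B') :
    A ◁ f = (β_ A B).hom ≫ f ▷ A ≫ (β_ B' A).hom := by
  rw [BraidedCategory.braiding_naturality_left, SymmetricCategory.symmetry_assoc]

/-- Composition is natural in the parameters and the coefficients. -/
lemma parComp_naturality {X Y Z P Q D F P' Q' D' F' : C} (a : P' ⟶ P) (f : X ⊗ P ⟶ Y ⊗ D)
    (d : D ⟶ D') (b : Q' ⟶ Q) (g : Y ⊗ Q ⟶ Z ⊗ F) (e : F ⟶ F') :
    parComp (reparam a d f) (reparam b e g) = reparam (a ⊗ₘ b) (d ⊗ₘ e) (parComp f g) := by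
  simp only [reparam, parComp, comp_whiskerRight, Category.assoc,
    reassoc_of% swapRight_naturality_middle]
  rw [whisker_exchange_assoc, whisker_exchange_assoc, reassoc_of% swapRight_naturality_right,
    ← reassoc_of% swapRight_naturality_right, ← whisker_exchange_assoc]
  simp only [MonoidalCategory.tensorHom_def, MonoidalCategory.whiskerLeft_comp, Category.assoc,
    associator_naturality_middle_assoc, associator_naturality_right,
    ← associator_inv_naturality_middle_assoc, associator_inv_naturality_right_assoc]

/-- The tensor product is natural in the parameters and the coefficients. -/
lemma parTensor_naturality {X X' Y Y' P Q D F P' Q' D' F' : C} (a : P' ⟶ P) (f : X ⊗ P ⟶ X' ⊗ D)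
    (d : D ⟶ D') (b : Q' ⟶ Q) (g : Y ⊗ Q ⟶ Y' ⊗ F) (e : F ⟶ F') :
    parTensor (reparam a d f) (reparam b e g) = reparam (a ⊗ₘ b) (d ⊗ₘ e) (parTensor f g) := by
  have h₁ : (X ⊗ Y) ◁ (a ⊗ₘ b) ≫ tensorμ X Y P Q = tensorμ X Y P' Q' ≫ (X ◁ a ⊗ₘ Y ◁ b) := by
    simpa using tensorμ_natural (𝟙 X) (𝟙 Y) a b
  have h₂ : (X' ◁ d ⊗ₘ Y' ◁ e) ≫ tensorμ X' D' Y' F' =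
      tensorμ X' D Y' F ≫ (X' ⊗ Y') ◁ (d ⊗ₘ e) := by
    simpa using tensorμ_natural (𝟙 X') d (𝟙 Y') e
  simp only [reparam, parTensor, reassoc_of% h₁, Category.assoc, ← h₂, ← tensorHom_comp_tensorHom]

lemma parComp_reparam_left {X Y Z P Q D F P' D' : C} (a : P' ⟶ P) (d : D ⟶ D') (f : X ⊗ P ⟶ Y ⊗ D)
    (g : Y ⊗ Q ⟶ Z ⊗ F) :
    parComp (reparam a d f) g = reparam (a ▷ Q) (d ▷ F) (parComp f g) := by
  simpa [reparam_id] using parComp_naturality a f d (𝟙 Q) g (𝟙 F)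

lemma parComp_reparam_right {X Y Z P Q D F Q' F' : C} (f : X ⊗ P ⟶ Y ⊗ D) (b : Q' ⟶ Q)
    (e : F ⟶ F') (g : Y ⊗ Q ⟶ Z ⊗ F) :
    parComp f (reparam b e g) = reparam (P ◁ b) (D ◁ e) (parComp f g) := by
  simpa [reparam_id] using parComp_naturality (𝟙 P) f (𝟙 D) b g e

lemma parTensor_reparam_left {X X' Y Y' P Q D F P' D' : C} (a : P' ⟶ P) (d : D ⟶ D')
    (f : X ⊗ P ⟶ X' ⊗ D) (g : Y ⊗ Q ⟶ Y' ⊗ F) :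
    parTensor (reparam a d f) g = reparam (a ▷ Q) (d ▷ F) (parTensor f g) := by
  simpa [reparam_id] using parTensor_naturality a f d (𝟙 Q) g (𝟙 F)

lemma parTensor_reparam_right {X X' Y Y' P Q D F Q' F' : C} (f : X ⊗ P ⟶ X' ⊗ D) (b : Q' ⟶ Q)
    (e : F ⟶ F') (g : Y ⊗ Q ⟶ Y' ⊗ F) :
    parTensor f (reparam b e g) = reparam (P ◁ b) (D ◁ e) (parTensor f g) := by
  simpa [reparam_id] using parTensor_naturality (𝟙 P) f (𝟙 D) b g e

lemma tensorμ_tensorμ (A B D F : C) : tensorμ A B D F ≫ tensorμ A D B F = 𝟙 _ :=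
  Structural.eq ((.atom 0 ⊠ .atom 1) ⊠ (.atom 2 ⊠ .atom 3))

/-- Objects next to two morphisms may be collected on the right. -/
lemma whiskerRight_tensor_whiskerRight {A A' B B' : C} (f : A ⟶ A') (g : B ⟶ B') (D F : C) :
    (f ▷ D ⊗ₘ g ▷ F) = tensorμ A D B F ≫ (f ⊗ₘ g) ▷ (D ⊗ F) ≫ tensorμ A' B' D F := by
  have h : (f ▷ D ⊗ₘ g ▷ F) ≫ tensorμ A' D B' F = tensorμ A D B F ≫ (f ⊗ₘ g) ▷ (D ⊗ F) := by
    simpa using tensorμ_natural f (𝟙 D) g (𝟙 F)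
  rw [← reassoc_of% h, tensorμ_tensorμ, Category.comp_id]

/-- Composition with parameters and coefficients is associative up to the associators. -/
lemma parComp_assoc {X Y Z W P Q R D F G : C} (f : X ⊗ P ⟶ Y ⊗ D) (g : Y ⊗ Q ⟶ Z ⊗ F)
    (h : Z ⊗ R ⟶ W ⊗ G) :
    parComp (parComp f g) h =
      reparam (α_ P Q R).hom (α_ D F G).inv (parComp f (parComp g h)) := by
  simp only [reparam, parComp, comp_whiskerRight, Category.assoc, whiskerRight_tensor,
    whiskerRight_whiskerRight_swap g D R, whiskerRight_whiskerRight_swap h D F]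
  -- both sides now contain `f ▷ Q ▷ R`, `g ▷ R ▷ D` and `h ▷ F ▷ D` in this order, with structural
  -- maps in between
  refine Factors.congr ((.atom 0) ⊠ (((.atom 1) ⊠ (.atom 2)) ⊠ (.atom 3))) (f ▷ Q ▷ R) ?_
  refine Factors.congr ((((.atom 0) ⊠ (.atom 1)) ⊠ (.atom 2)) ⊠ (.atom 3)) (g ▷ R ▷ D) ?_
  refine Factors.congr ((((.atom 0) ⊠ (.atom 1)) ⊠ (.atom 2)) ⊠ (.atom 3)) (h ▷ F ▷ D) ?_
  exact Structural.eq ((((.atom 0) ⊠ (.atom 1)) ⊠ (.atom 2)) ⊠ (.atom 3))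

lemma parComp_whiskerRight_unit {X Y Z P D : C} (f : X ⊗ P ⟶ Y ⊗ D) (b : Y ⟶ Z) :
    parComp f (b ▷ 𝟙_ C) = reparam (ρ_ P).hom (ρ_ D).inv (f ≫ b ▷ D) := by
  simp only [reparam, parComp, whiskerRight_id, comp_whiskerRight, Category.assoc]
  refine Factors.congr ((.atom 0) ⊠ ((.atom 1) ⊠ .unit)) f ?_
  refine Factors.congr ((.atom 0) ⊠ (.atom 1)) (b ▷ D) ?_
  exact Structural.eq ((.atom 0) ⊠ (.atom 1))

lemma whiskerRight_unit_parComp {X Y Z P D : C} (a : X ⟶ Y) (f : Y ⊗ P ⟶ Z ⊗ D) :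
    parComp (a ▷ 𝟙_ C) f = reparam (λ_ P).hom (λ_ D).inv (a ▷ P ≫ f) := by
  simp only [reparam, parComp, whiskerRight_id, comp_whiskerRight, Category.assoc]
  refine Factors.congr ((.atom 0) ⊠ (.unit ⊠ (.atom 1))) (a ▷ P) ?_
  refine Factors.congr ((.atom 0) ⊠ (.atom 1)) f ?_
  exact Structural.eq ((.atom 0) ⊠ (.atom 1))

/-- Morphisms of the form `X ◁ u` commute with all others. -/
lemma parComp_whiskerLeft {X Y P Q D F : C} (f : X ⊗ P ⟶ Y ⊗ D) (u : Q ⟶ F) :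
    parComp f (Y ◁ u) = reparam (β_ P Q).hom (β_ F D).hom (parComp (X ◁ u) f) := by
  simp only [reparam, parComp, Category.assoc, reassoc_of% swapRight_naturality_middle,
    whisker_exchange_assoc]
  refine Factors.congr (.atom 0 ⊠ (.atom 1 ⊠ .atom 2)) (f ▷ Q) ?_
  refine Factors.congr ((.atom 0 ⊠ .atom 1) ⊠ .atom 2) ((Y ⊗ D) ◁ u) ?_
  exact Structural.eq ((.atom 0 ⊠ .atom 1) ⊠ .atom 2)

lemma parTensor_whiskerRight_unit {X X' Y Y' : C} (a : X ⟶ X') (b : Y ⟶ Y') :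
    parTensor (a ▷ 𝟙_ C) (b ▷ 𝟙_ C) =
      reparam (λ_ (𝟙_ C)).hom (λ_ (𝟙_ C)).inv ((a ⊗ₘ b) ▷ 𝟙_ C) := by
  rw [reparam, parTensor, whiskerRight_tensor_whiskerRight]
  simp only [whiskerRight_tensor, whiskerRight_id, Category.assoc]
  refine Factors.congr ((.atom 0 ⊠ .atom 1) ⊠ (.unit ⊠ .unit)) (a ⊗ₘ b) ?_
  exact Structural.eq (.atom 0 ⊠ .atom 1)

/-- The interchange law for composition and tensor product of morphisms with parameters and
coefficients. It needs no commutativity, since the coefficients are not multiplied yet. -/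
lemma parTensor_parComp {X X' X'' Y Y' Y'' P Q S T D F G H : C} (f : X ⊗ P ⟶ X' ⊗ D)
    (f' : X' ⊗ S ⟶ X'' ⊗ G) (g : Y ⊗ Q ⟶ Y' ⊗ F) (g' : Y' ⊗ T ⟶ Y'' ⊗ H) :
    parComp (parTensor f g) (parTensor f' g') =
      reparam (tensorμ P Q S T) (tensorμ D G F H) (parTensor (parComp f f') (parComp g g')) := by
  simp only [reparam, parTensor, parComp, ← tensorHom_comp_tensorHom,
    whiskerRight_tensor_whiskerRight, comp_whiskerRight, Category.assoc]
  refine Factors.congr ((.atom 0 ⊠ .atom 1) ⊠ ((.atom 2 ⊠ .atom 3) ⊠ (.atom 4 ⊠ .atom 5)))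
    ((f ⊗ₘ g) ▷ (S ⊗ T)) ?_
  refine Factors.congr (((.atom 0 ⊠ .atom 1) ⊠ (.atom 2 ⊠ .atom 3)) ⊠ (.atom 4 ⊠ .atom 5))
    ((f' ⊗ₘ g') ▷ (D ⊗ F)) ?_
  exact Structural.eq (((.atom 0 ⊠ .atom 1) ⊠ (.atom 2 ⊠ .atom 3)) ⊠ (.atom 4 ⊠ .atom 5))

lemma parTensor_assoc {X X' Y Y' Z Z' P Q R D F G : C} (f : X ⊗ P ⟶ X' ⊗ D)
    (g : Y ⊗ Q ⟶ Y' ⊗ F) (h : Z ⊗ R ⟶ Z' ⊗ G) :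
    parTensor (parTensor f g) h ≫ (α_ X' Y' Z').hom ▷ _ =
      reparam (α_ P Q R).hom (α_ D F G).inv ((α_ X Y Z).hom ▷ _ ≫ parTensor f (parTensor g h)) := by
  have h₁ : parTensor f g ⊗ₘ h = tensorμ X Y P Q ▷ _ ≫ ((f ⊗ₘ g) ⊗ₘ h) ≫ tensorμ X' D Y' F ▷ _ := by
    rw [parTensor, ← tensorHom_id, ← tensorHom_id, tensorHom_comp_tensorHom,
      tensorHom_comp_tensorHom, Category.id_comp, Category.comp_id]
  have h₂ : f ⊗ₘ parTensor g h = _ ◁ tensorμ Y Z Q R ≫ (α_ _ _ _).inv ≫ ((f ⊗ₘ g) ⊗ₘ h) ≫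
      (α_ _ _ _).hom ≫ _ ◁ tensorμ Y' F Z' G := by
    rw [associator_naturality_assoc, Iso.inv_hom_id_assoc, parTensor, ← id_tensorHom,
      ← id_tensorHom, tensorHom_comp_tensorHom, tensorHom_comp_tensorHom, Category.id_comp,
      Category.comp_id]
  rw [reparam, parTensor, h₁, parTensor, h₂]
  simp only [Category.assoc]
  refine Factors.congr (((.atom 0 ⊠ .atom 1) ⊠ .atom 2) ⊠ ((.atom 3 ⊠ .atom 4) ⊠ .atom 5))
    ((f ⊗ₘ g) ⊗ₘ h) ?_
  exact Structural.eq (((.atom 0 ⊠ .atom 1) ⊠ (.atom 2 ⊠ .atom 3)) ⊠ (.atom 4 ⊠ .atom 5))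

lemma id_parTensor {X Y P D : C} (f : X ⊗ P ⟶ Y ⊗ D) :
    parTensor (𝟙 (𝟙_ C ⊗ 𝟙_ C)) f ≫ (λ_ Y).hom ▷ _ =
      reparam (λ_ P).hom (λ_ D).inv ((λ_ X).hom ▷ _ ≫ f) := by
  simp only [reparam, parTensor, id_tensorHom, tensor_whiskerLeft, id_whiskerLeft,
    MonoidalCategory.whiskerLeft_comp, Category.assoc]
  refine Factors.congr ((.unit ⊠ .atom 0) ⊠ (.unit ⊠ .atom 1)) f ?_
  exact Structural.eq (.atom 0 ⊠ .atom 1)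

lemma parTensor_id {X Y P D : C} (f : X ⊗ P ⟶ Y ⊗ D) :
    parTensor f (𝟙 (𝟙_ C ⊗ 𝟙_ C)) ≫ (ρ_ Y).hom ▷ _ =
      reparam (ρ_ P).hom (ρ_ D).inv ((ρ_ X).hom ▷ _ ≫ f) := by
  simp only [reparam, parTensor, tensorHom_id, whiskerRight_tensor, whiskerRight_id, Category.assoc]
  refine Factors.congr ((.atom 0 ⊠ .unit) ⊠ (.atom 1 ⊠ .unit)) f ?_
  exact Structural.eq (.atom 0 ⊠ .atom 1)

lemma parTensor_braiding {X X' Y Y' P Q D F : C} (f : X ⊗ P ⟶ X' ⊗ D) (g : Y ⊗ Q ⟶ Y' ⊗ F) :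
    parTensor f g ≫ (β_ X' Y').hom ▷ _ =
      reparam (β_ P Q).hom (β_ F D).hom ((β_ X Y).hom ▷ _ ≫ parTensor g f) := by
  have h : (g ⊗ₘ f) = (β_ _ _).hom ≫ (f ⊗ₘ g) ≫ (β_ _ _).hom := by
    rw [BraidedCategory.braiding_naturality, SymmetricCategory.symmetry_assoc]
  rw [reparam, parTensor, parTensor, h]
  simp only [Category.assoc]
  refine Factors.congr ((.atom 0 ⊠ .atom 1) ⊠ (.atom 2 ⊠ .atom 3)) (f ⊗ₘ g) ?_
  exact Structural.eq ((.atom 0 ⊠ .atom 1) ⊠ (.atom 2 ⊠ .atom 3))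

lemma parTensor_whiskerLeft (X Y : C) {P Q D F : C} (u : P ⟶ D) (v : Q ⟶ F) :
    parTensor (X ◁ u) (Y ◁ v) = (X ⊗ Y) ◁ (u ⊗ₘ v) := by
  have h := parTensor_naturality (𝟙 P) (𝟙 (X ⊗ P)) u (𝟙 Q) (𝟙 (Y ⊗ Q)) v
  simpa [reparam, parTensor, tensorμ_tensorμ] using h

end Parametrized

/-! ### Block permutations and smash powers -/

section Perm

@[simp]
lemma blockSum_castAdd {n n' m m' : ℕ} (e : Fin n ≃ Fin n') (f : Fin m ≃ Fin m') (i : Fin n) :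
    blockSum e f (Fin.castAdd m i) = Fin.castAdd m' (e i) := by
  simp [blockSum]

@[simp]
lemma blockSum_natAdd {n n' m m' : ℕ} (e : Fin n ≃ Fin n') (f : Fin m ≃ Fin m') (i : Fin m) :
    blockSum e f (Fin.natAdd n i) = Fin.natAdd n' (f i) := by
  simp [blockSum]

@[simp]
lemma blockSum_symm {n n' m m' : ℕ} (e : Fin n ≃ Fin n') (f : Fin m ≃ Fin m') :
    (blockSum e f).symm = blockSum e.symm f.symm := rfl

lemma chi_castAdd (n m : ℕ) (i : Fin n) : chi n m (Fin.castAdd m i) = Fin.natAdd m i := by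
  simp [chi]

lemma chi_natAdd (n m : ℕ) (i : Fin m) : chi n m (Fin.natAdd n i) = Fin.castAdd n i := by
  simp [chi]

lemma chi_symm (n m : ℕ) : (chi n m).symm = chi m n := rfl

lemma chiMid_symm (p s q t : ℕ) : (chiMid p s q t).symm = chiMid p q s t := rfl

lemma chiMid_castAdd_castAdd (p s q t : ℕ) (i : Fin p) :
    chiMid p s q t (Fin.castAdd _ (Fin.castAdd _ i)) = Fin.castAdd _ (Fin.castAdd _ i) := by
  simp [chiMid]

lemma chiMid_castAdd_natAdd (p s q t : ℕ) (i : Fin s) :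
    chiMid p s q t (Fin.castAdd _ (Fin.natAdd _ i)) = Fin.natAdd _ (Fin.castAdd _ i) := by
  simp [chiMid]

lemma chiMid_natAdd_castAdd (p s q t : ℕ) (i : Fin q) :
    chiMid p s q t (Fin.natAdd _ (Fin.castAdd _ i)) = Fin.castAdd _ (Fin.natAdd _ i) := by
  simp [chiMid]

lemma chiMid_natAdd_natAdd (p s q t : ℕ) (i : Fin t) :
    chiMid p s q t (Fin.natAdd _ (Fin.natAdd _ i)) = Fin.natAdd _ (Fin.natAdd _ i) := by
  simp [chiMid]

lemma finCongr_assoc_castAdd_castAdd (n m p : ℕ) (i : Fin n) :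
    finCongr (Nat.add_assoc n m p) (Fin.castAdd p (Fin.castAdd m i)) = Fin.castAdd (m + p) i :=
  rfl

lemma finCongr_assoc_castAdd_natAdd (n m p : ℕ) (i : Fin m) :
    finCongr (Nat.add_assoc n m p) (Fin.castAdd p (Fin.natAdd n i)) =
      Fin.natAdd n (Fin.castAdd p i) :=
  rfl

lemma finCongr_assoc_natAdd (n m p : ℕ) (i : Fin p) :
    finCongr (Nat.add_assoc n m p) (Fin.natAdd (n + m) i) = Fin.natAdd n (Fin.natAdd m i) :=
  Fin.ext (by simp [Nat.add_assoc])

lemma finCongr_assoc_symm_castAdd (n m p : ℕ) (i : Fin n) :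
    (finCongr (Nat.add_assoc n m p)).symm (Fin.castAdd (m + p) i) =
      Fin.castAdd p (Fin.castAdd m i) :=
  rfl

lemma finCongr_assoc_symm_natAdd_castAdd (n m p : ℕ) (i : Fin m) :
    (finCongr (Nat.add_assoc n m p)).symm (Fin.natAdd n (Fin.castAdd p i)) =
      Fin.castAdd p (Fin.natAdd n i) :=
  rfl

lemma finCongr_assoc_symm_natAdd_natAdd (n m p : ℕ) (i : Fin p) :
    (finCongr (Nat.add_assoc n m p)).symm (Fin.natAdd n (Fin.natAdd m i)) =
      Fin.natAdd (n + m) i :=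
  (Equiv.symm_apply_eq _).2 (finCongr_assoc_natAdd n m p i).symm

/-- The permutation `chiMid` expressed in terms of `chi`. -/
lemma chiMid_eq (p s q t : ℕ) :
    chiMid p s q t = (finCongr (Nat.add_assoc p s (q + t))).trans
      ((blockSum (Equiv.refl (Fin p)) ((finCongr (Nat.add_assoc s q t)).symm.trans
        ((blockSum (chi s q) (Equiv.refl (Fin t))).trans (finCongr (Nat.add_assoc q s t))))).trans
          (finCongr (Nat.add_assoc p q (s + t))).symm) := by
  apply Equiv.ext
  intro i
  induction i using Fin.addCases with
  | left i =>
    induction i using Fin.addCases with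
    | left i =>
      simp only [Equiv.trans_apply, chiMid_castAdd_castAdd, finCongr_assoc_castAdd_castAdd,
        blockSum_castAdd, Equiv.refl_apply, finCongr_assoc_symm_castAdd]
    | right i =>
      simp only [Equiv.trans_apply, chiMid_castAdd_natAdd, finCongr_assoc_castAdd_natAdd,
        blockSum_natAdd, blockSum_castAdd, finCongr_assoc_symm_castAdd, chi_castAdd,
        finCongr_assoc_symm_natAdd_natAdd]
  | right i =>
    induction i using Fin.addCases with
    | left i =>
      simp only [Equiv.trans_apply, chiMid_natAdd_castAdd, finCongr_assoc_natAdd,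
        blockSum_natAdd, blockSum_castAdd, finCongr_assoc_symm_natAdd_castAdd, chi_natAdd,
        finCongr_assoc_castAdd_castAdd]
    | right i =>
      simp only [Equiv.trans_apply, chiMid_natAdd_natAdd, finCongr_assoc_natAdd, blockSum_natAdd,
        Equiv.refl_apply, finCongr_assoc_symm_natAdd_natAdd]

lemma chiOne_eq_chiMid (p q : ℕ) : chiMid p 1 q 0 = chiOne p q := by
  apply Equiv.ext
  intro i
  induction i using Fin.addCases with
  | left i =>
    induction i using Fin.addCases with
    | left i =>
      rw [chiMid_castAdd_castAdd]
      exact (blockSum_castAdd (Equiv.refl (Fin p)) (chi 1 q) i).symm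
    | right i =>
      rw [chiMid_castAdd_natAdd]
      refine Eq.trans ?_ (blockSum_natAdd (Equiv.refl (Fin p)) (chi 1 q) (Fin.castAdd q i)).symm
      rw [chi_castAdd]
      exact Fin.ext (by simp)
  | right i =>
    refine (chiMid_natAdd_castAdd p 1 q 0 i).trans ?_
    refine Eq.trans ?_ (congrArg (blockSum (Equiv.refl (Fin p)) (chi 1 q))
      (finCongr_assoc_natAdd p 1 q i)).symm
    rw [blockSum_natAdd, chi_natAdd]
    rfl

lemma chiMid_zero_one (p q : ℕ) : chiMid p 0 q 1 = Equiv.refl (Fin (p + q + 1)) := by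
  apply Equiv.ext
  intro i
  induction i using Fin.addCases with
  | left i => exact chiMid_castAdd_castAdd p 0 q 1 i
  | right i =>
    induction i using Fin.addCases with
    | left i => exact chiMid_natAdd_castAdd p 0 q 1 i
    | right i =>
      refine (chiMid_natAdd_natAdd p 0 q 1 i).trans (Fin.ext ?_)
      change p + q + (0 + i.val) = p + 0 + (q + i.val)
      omega

/-- The permutation `removeLast e` is the restriction of `e` to the complement of the last
element. -/
lemma succAbove_removeLast {n m : ℕ} (e : Fin (n + 1) ≃ Fin (m + 1)) (k : Fin n) :
    (e (Fin.last n)).succAbove (removeLast e k) = e k.castSucc := by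
  have h := congrArg Subtype.val ((finSuccAboveEquiv (e (Fin.last n))).apply_symm_apply
    (e.subtypeEquiv (fun _ => (not_congr e.injective.eq_iff).symm)
      (finSuccAboveEquiv (Fin.last n) k)))
  rw [finSuccAboveEquiv_apply] at h
  simpa [removeLast, finSuccAboveEquiv_apply] using h

end Perm

section Pow

variable {C : Type u} [Category.{v} C] [MonoidalCategory C]

/-- The decoration of `P^{∧n}` whose `k`-th atom has the label `l k`. -/
def powDeco (P : C) : ∀ (n : ℕ), (Fin n → ℕ) → Deco (pow P n)
  | 0, _ => .unit
  | n + 1, l => powDeco P n (fun i => l i.castSucc) ⊠ .atom (X := P) (l (Fin.last n))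

lemma labels_powDeco (P : C) (n : ℕ) (l : Fin n → ℕ) : (powDeco P n l).labels = List.ofFn l := by
  induction n with
  | zero => rfl
  | succ n ih => rw [List.ofFn_succ', List.concat_eq_append, ← ih]; rfl

variable [SymmetricCategory C]

/-- Parallel structural maps out of a smash power are equal if they send the factors, labelled by
their positions, to the same places. -/
lemma Structural.eq_of_pow {P : C} {n : ℕ} {Y : C} {d e : Deco Y} {f g : pow P n ⟶ Y}
    [hf : Structural (powDeco P n Fin.val) d f] [hg : Structural (powDeco P n Fin.val) e g]
    (h : d = e) : f = g := by
  subst h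
  exact Structural.eq (powDeco P n Fin.val)
    (by rw [labels_powDeco, List.nodup_ofFn]; exact Fin.val_injective)

instance structural_powAdd (P : C) (n m : ℕ) (l : Fin (n + m) → ℕ) :
    Structural (powDeco P (n + m) l)
      (powDeco P n (fun i => l (Fin.castAdd m i)) ⊠ powDeco P m (fun i => l (Fin.natAdd n i)))
      (powAdd P n m) := by
  induction m with
  | zero => exact Structural.rightUnitor_inv _
  | succ m ih =>
    have := ih (fun i => l i.castSucc)
    exact inferInstanceAs (Structural (powDeco P (n + m) (fun i => l i.castSucc) ⊠ .atom _)
      (_ ⊠ (_ ⊠ .atom _)) (powAdd P n m ▷ P ≫ (α_ _ _ _).hom))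

lemma powInsert_last (P : C) (n : ℕ) : powInsert P n (Fin.last n) = 𝟙 _ := by
  cases n with
  | zero => rfl
  | succ n => exact dif_pos rfl

lemma powInsert_castSucc (P : C) (n : ℕ) (i : Fin (n + 1)) :
    powInsert P (n + 1) i.castSucc = swapRight (pow P n) P P ≫ powInsert P n i ▷ P :=
  dif_neg (Fin.castSucc_ne_last i)

/-- The insertion of a factor at the position `i` puts the label of the last factor there. -/
lemma structural_powInsert (P : C) (n : ℕ) (i : Fin (n + 1)) (l : Fin (n + 1) → ℕ) :
    Structural (powDeco P n (fun k => l (i.succAbove k)) ⊠ .atom (l i)) (powDeco P (n + 1) l)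
      (powInsert P n i) := by
  induction i using Fin.lastCases with
  | last =>
    simp only [Fin.succAbove_last, powInsert_last]
    exact Structural.id _
  | cast i =>
    induction n with
    | zero => exact i.elim0
    | succ n ih =>
      rw [powInsert_castSucc]
      have h : Structural (powDeco P n (fun k => l (i.succAbove k).castSucc) ⊠
          .atom (l i.castSucc)) (powDeco P (n + 1) (fun k => l k.castSucc)) (powInsert P n i) := by
        induction i using Fin.lastCases with
        | last =>
          simp only [Fin.succAbove_last, powInsert_last]
          exact Structural.id _
        | cast i => exact ih (fun k => l k.castSucc) i
      -- the second last factor has been exchanged with the last one, which is then inserted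
      have h' := Structural.comp ((powDeco P n (fun k => l (i.succAbove k).castSucc) ⊠
        .atom (X := P) (l (Fin.last _))) ⊠ .atom (X := P) (l i.castSucc)) _ _
        (swapRight (pow P n) P P) (powInsert P n i ▷ P)
      have hd : powDeco P (n + 1) (fun k => l (i.castSucc.succAbove k)) =
          powDeco P n (fun k => l (i.succAbove k).castSucc) ⊠ .atom (l (Fin.last _)) := by
        simp only [powDeco, Fin.castSucc_succAbove_castSucc,
          Fin.succAbove_ne_last_last (Fin.castSucc_ne_last i)]
        rfl
      rw [hd]
      exact h'

/-- The map `powAct P e` moves the `k`-th factor to the position `e k`. Here the labels of the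
target are prescribed, which suits the recursion. -/
lemma structural_powAct_comp (P : C) {n m : ℕ} (e : Fin n ≃ Fin m) (l : Fin m → ℕ) :
    Structural (powDeco P n (fun k => l (e k))) (powDeco P m l) (powAct P e) := by
  induction n generalizing m with
  | zero =>
    cases m with
    | zero => exact Structural.id _
    | succ m => exact (e.symm 0).elim0
  | succ n ih =>
    cases m with
    | zero => exact (e 0).elim0
    | succ m =>
      have h₁ := ih (removeLast e) (fun k => l ((e (Fin.last n)).succAbove k))
      simp only [succAbove_removeLast] at h₁
      have h₂ := structural_powInsert P m (e (Fin.last n)) l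
      exact Structural.comp (powDeco P n (fun k => l (e k.castSucc)) ⊠
        .atom (X := P) (l (e (Fin.last n)))) _ _ (powAct P (removeLast e) ▷ P)
        (powInsert P m (e (Fin.last n)))

/-- The map `powAct P e` moves the `k`-th factor to the position `e k`. -/
instance structural_powAct (P : C) {n m : ℕ} (e : Fin n ≃ Fin m) (l : Fin n → ℕ) :
    Structural (powDeco P n l) (powDeco P m (fun k => l (e.symm k))) (powAct P e) := by
  have h := structural_powAct_comp P e (fun k => l (e.symm k))
  simpa only [Equiv.symm_apply_apply] using h

lemma powAct_refl (P : C) (n : ℕ) : powAct P (Equiv.refl (Fin n)) = 𝟙 _ :=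
  Structural.eq_of_pow rfl

lemma powAct_trans (P : C) {n m p : ℕ} (e : Fin n ≃ Fin m) (f : Fin m ≃ Fin p) :
    powAct P (e.trans f) = powAct P e ≫ powAct P f :=
  Structural.eq_of_pow rfl

lemma powAct_blockSum (P : C) {n n' m m' : ℕ} (e : Fin n ≃ Fin n') (f : Fin m ≃ Fin m') :
    powAct P (blockSum e f) ≫ powAdd P n' m' = powAdd P n m ≫ (powAct P e ⊗ₘ powAct P f) :=
  Structural.eq_of_pow (by simp)

lemma powAdd_assoc (P : C) (n m p : ℕ) :
    powAct P (finCongr (Nat.add_assoc n m p)) ≫ powAdd P n (m + p) ≫ pow P n ◁ powAdd P m p =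
      powAdd P (n + m) p ≫ powAdd P n m ▷ pow P p ≫ (α_ _ _ _).hom :=
  Structural.eq_of_pow (by simp [Nat.add_assoc])

/-- The identification of the zeroth smash power with the unit. -/
def powZeroHom (P : C) : pow P 0 ⟶ 𝟙_ C := 𝟙 _

instance structural_powZeroHom (P : C) (l : Fin 0 → ℕ) :
    Structural (powDeco P 0 l) .unit (powZeroHom P) :=
  Structural.id .unit

/-- The identification of the first smash power with the object. -/
def powOneHom (P : C) : pow P 1 ⟶ P := (λ_ P).hom

instance structural_powOneHom (P : C) (l : Fin 1 → ℕ) :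
    Structural (powDeco P 1 l) (.atom (l 0)) (powOneHom P) :=
  Structural.leftUnitor _

lemma powAdd_zero_left (P : C) (n : ℕ) :
    powAdd P 0 n ≫ powZeroHom P ▷ _ ≫ (λ_ _).hom = powAct P (finCongr (Nat.zero_add n)) :=
  Structural.eq_of_pow (by simp)

lemma powAdd_zero_right (P : C) (n : ℕ) :
    powAdd P n 0 ≫ _ ◁ powZeroHom P ≫ (ρ_ _).hom = 𝟙 _ :=
  Structural.eq_of_pow (by simp)

lemma powAdd_zero_zero (P : C) :
    powAdd P 0 0 ≫ (powZeroHom P ⊗ₘ powZeroHom P) ≫ (λ_ _).hom = powZeroHom P :=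
  Structural.eq_of_pow (n := 0 + 0) (hg := structural_powZeroHom P Fin.val) rfl

lemma powAdd_zero_one (P : C) :
    powAdd P 0 1 ≫ (powZeroHom P ⊗ₘ powOneHom P) ≫ (λ_ P).hom = powOneHom P :=
  Structural.eq_of_pow (n := 0 + 1) (hg := structural_powOneHom P Fin.val) rfl

lemma powAdd_one_zero (P : C) :
    powAdd P 1 0 ≫ (powOneHom P ⊗ₘ powZeroHom P) ≫ (ρ_ P).hom = powOneHom P :=
  Structural.eq_of_pow (n := 1 + 0) (hg := structural_powOneHom P Fin.val) rfl

lemma powAct_chi (P : C) (n m : ℕ) :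
    powAct P (chi n m) ≫ powAdd P m n = powAdd P n m ≫ (β_ _ _).hom :=
  Structural.eq_of_pow (by simp [chi_symm, chi_castAdd, chi_natAdd])

/-- The middle exchange of four smash powers is the action of the block permutation `chiMid`. -/
lemma powAct_chiMid (P : C) (p s q t : ℕ) :
    powAct P (chiMid p s q t) ≫ powAdd P (p + q) (s + t) ≫ (powAdd P p q ⊗ₘ powAdd P s t) =
      powAdd P (p + s) (q + t) ≫ (powAdd P p s ⊗ₘ powAdd P q t) ≫ tensorμ _ _ _ _ :=
  Structural.eq_of_pow (by simp [chiMid_symm, chiMid_castAdd_castAdd, chiMid_castAdd_natAdd,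
    chiMid_natAdd_castAdd, chiMid_natAdd_natAdd])

end Pow

/-! ### Morphisms with coefficients in a ring object -/

section RingObject

variable {C : Type u} [Category.{v} C] [MonoidalCategory C] (R : RingObject C)

namespace RingObject

lemma act_act_symm {n m : ℕ} (e : Fin n ≃ Fin m) : R.act e ≫ R.act e.symm = 𝟙 _ := by
  rw [← R.act_trans, Equiv.self_trans_symm, R.act_refl]

/-- Commutativity of a ring object. -/
def IsCommutative [SymmetricCategory C] : Prop :=
  ∀ n m : ℕ, R.mul n m ≫ R.act (chi n m) = (β_ (R.obj n) (R.obj m)).hom ≫ R.mul m n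

/-- Associativity of the multiplication, solved for the product bracketed to the left. -/
lemma mul_assoc' (n m p : ℕ) :
    (α_ (R.obj n) (R.obj m) (R.obj p)).inv ≫ R.mul n m ▷ R.obj p ≫ R.mul (n + m) p =
      R.obj n ◁ R.mul m p ≫ R.mul n (m + p) ≫ R.act (finCongr (Nat.add_assoc n m p)).symm := by
  have h := congrArg (fun t => (α_ _ _ _).inv ≫ t ≫ R.act (finCongr (Nat.add_assoc n m p)).symm)
    (R.mul_assoc n m p)
  simpa only [Category.assoc, act_act_symm, Category.comp_id, Iso.inv_hom_id_assoc] using h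

lemma one_tensor_mul {A : C} {n : ℕ} (u : A ⟶ R.obj n) :
    (λ_ A).inv ≫ (R.one ⊗ₘ u) ≫ R.mul 0 n ≫ R.act (finCongr (Nat.zero_add n)) = u := by
  rw [MonoidalCategory.tensorHom_def', Category.assoc, ← leftUnitor_inv_naturality_assoc,
    R.one_mul, Category.comp_id]

lemma one_tensor_mul_one {A : C} (u : A ⟶ R.obj 1) :
    (λ_ A).inv ≫ (R.one ⊗ₘ u) ≫ R.mul 0 1 = u := by
  have h := R.one_tensor_mul u
  have h' : R.act (finCongr (Nat.zero_add 1)) = 𝟙 (R.obj 1) := R.act_refl 1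
  exact (congrArg (fun t => (λ_ A).inv ≫ (R.one ⊗ₘ u) ≫ t)
    ((congrArg (R.mul 0 1 ≫ ·) h').trans (Category.comp_id _))).symm.trans h

lemma one_tensor_one_mul :
    (λ_ (𝟙_ C)).inv ≫ (R.one ⊗ₘ R.one) ≫ R.mul 0 0 = R.one := by
  have h := R.one_tensor_mul R.one
  have h' : R.act (finCongr (Nat.zero_add 0)) = 𝟙 (R.obj 0) := R.act_refl 0
  exact (congrArg (fun t => (λ_ _).inv ≫ (R.one ⊗ₘ R.one) ≫ t)
    ((congrArg (R.mul 0 0 ≫ ·) h').trans (Category.comp_id _))).symm.trans h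

lemma tensor_one_mul {A : C} {n : ℕ} (u : A ⟶ R.obj n) :
    (ρ_ A).inv ≫ (u ⊗ₘ R.one) ≫ R.mul n 0 = u := by
  rw [MonoidalCategory.tensorHom_def, Category.assoc, ← rightUnitor_inv_naturality_assoc,
    R.mul_one, Category.comp_id]

variable [SymmetricCategory C] {R}

/-- The interchange law for the multiplication of a commutative ring object. -/
lemma IsCommutative.tensorμ_mul (hR : R.IsCommutative) (p s q t : ℕ) :
    tensorμ (R.obj p) (R.obj s) (R.obj q) (R.obj t) ≫ (R.mul p q ⊗ₘ R.mul s t) ≫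
        R.mul (p + q) (s + t) =
      (R.mul p s ⊗ₘ R.mul q t) ≫ R.mul (p + s) (q + t) ≫ R.act (chiMid p s q t) := by
  -- both products are compared with the product of four factors bracketed to the right
  have h₁ : ∀ a b c d : ℕ, (R.mul a b ⊗ₘ R.mul c d) ≫ R.mul (a + b) (c + d) =
      (α_ _ _ _).hom ≫ R.obj a ◁ (R.obj b ◁ R.mul c d ≫ R.mul b (c + d)) ≫
        R.mul a (b + (c + d)) ≫ R.act (finCongr (Nat.add_assoc a b (c + d))).symm := by
    intro a b c d
    rw [MonoidalCategory.tensorHom_def', Category.assoc]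
    have := R.mul_assoc' a b (c + d)
    rw [Iso.inv_comp_eq] at this
    rw [this]
    simp
  -- commutativity exchanges the two factors in the middle
  have h₂ : ∀ b c d : ℕ, (α_ _ _ _).inv ≫ (β_ (R.obj b) (R.obj c)).hom ▷ R.obj d ≫
      (α_ _ _ _).hom ≫ R.obj c ◁ R.mul b d ≫ R.mul c (b + d) =
        R.obj b ◁ R.mul c d ≫ R.mul b (c + d) ≫ R.act ((finCongr (Nat.add_assoc b c d)).symm.trans
          ((blockSum (chi b c) (Equiv.refl (Fin d))).trans (finCongr (Nat.add_assoc c b d)))) := by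
    intro b c d
    have e₁ := R.mul_act (chi b c) (Equiv.refl (Fin d))
    rw [R.act_refl, tensorHom_id] at e₁
    rw [← R.mul_assoc, ← comp_whiskerRight_assoc, ← hR, R.act_trans, R.act_trans,
      ← reassoc_of% R.mul_assoc' b c d, comp_whiskerRight_assoc, reassoc_of% e₁]
  rw [← Category.assoc (R.mul p s ⊗ₘ R.mul q t), h₁, h₁]
  simp only [tensorμ, Category.assoc, Iso.inv_hom_id_assoc]
  rw [← MonoidalCategory.whiskerLeft_comp_assoc, ← MonoidalCategory.whiskerLeft_comp_assoc,
    ← MonoidalCategory.whiskerLeft_comp_assoc]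
  simp only [Category.assoc]
  rw [h₂ s q t]
  have e₂ := R.mul_act (Equiv.refl (Fin p)) ((finCongr (Nat.add_assoc s q t)).symm.trans
          ((blockSum (chi s q) (Equiv.refl (Fin t))).trans (finCongr (Nat.add_assoc q s t))))
  rw [R.act_refl, id_tensorHom] at e₂
  rw [MonoidalCategory.whiskerLeft_comp_assoc, MonoidalCategory.whiskerLeft_comp_assoc,
    reassoc_of% e₂, ← R.act_trans, ← R.act_trans, MonoidalCategory.whiskerLeft_comp_assoc]
  simp only [← MonoidalCategory.whiskerLeft_comp_assoc]
  congr 4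
  rw [chiMid_eq]
  apply Equiv.ext
  intro k
  simp only [Equiv.trans_apply, Equiv.apply_symm_apply]

variable (R) in
/-- A morphism to the first level of a ring object is central if it commutes with all levels. -/
def IsCentral {P : C} (u : P ⟶ R.obj 1) : Prop :=
  ∀ n : ℕ, R.obj n ◁ u ≫ R.mul n 1 ≫ R.act (chi n 1) =
    (β_ (R.obj n) P).hom ≫ u ▷ R.obj n ≫ R.mul 1 n

lemma IsCentral.comp_left {P T : C} {u : T ⟶ R.obj 1} (hu : R.IsCentral u) (σ : P ⟶ T) :
    R.IsCentral (σ ≫ u) := by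
  intro n
  rw [MonoidalCategory.whiskerLeft_comp_assoc, hu, comp_whiskerRight_assoc,
    BraidedCategory.braiding_naturality_right_assoc]

end RingObject

end RingObject

section PowHom

variable {C : Type u} [Category.{v} C] [MonoidalCategory C]

/-- The morphisms from `X` to `Y` of degree `n`, with parameters in `P^{∧n}` and coefficients in the
`n`-th level of the ring object `R`. -/
abbrev PowHom (P : C) (R : RingObject C) (n : ℕ) (X Y : C) : Type v :=
  X ⊗ pow P n ⟶ Y ⊗ R.obj n

variable {P : C} {R : RingObject C}

namespace PowHom

variable {X Y Z W X' Y' Z' X'' Y'' : C} {n m p n' m' : ℕ}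

variable (P R) in
/-- The morphism of degree zero given by a morphism of `C`. -/
def ofHom (a : X ⟶ Y) : PowHom P R 0 X Y :=
  reparam (powZeroHom P) R.one (a ▷ 𝟙_ C)

/-- The endomorphism of degree one of any object given by a morphism `P ⟶ R.obj 1`. -/
def ofUnit (u : P ⟶ R.obj 1) (X : C) : PowHom P R 1 X X :=
  X ◁ (powOneHom P ≫ u)

lemma ofHom_id (X : C) : ofHom P R (𝟙 X) = X ◁ (powZeroHom P ≫ R.one) := by
  simp [ofHom, reparam]

variable {S : RingObject C} (φ : ∀ n, R.obj n ⟶ S.obj n)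

/-- The change of coefficients along morphisms `φ n : R.obj n ⟶ S.obj n`. -/
def map (f : PowHom P R n X Y) : PowHom P S n X Y :=
  f ≫ Y ◁ φ n

lemma map_eq_reparam (f : PowHom P R n X Y) : map φ f = reparam (𝟙 _) (φ n) f := by
  simp [map, reparam]

lemma map_ofUnit (u : P ⟶ R.obj 1) : map φ (ofUnit u X) = ofUnit (u ≫ φ 1) X := by
  simp [map, ofUnit]

variable [SymmetricCategory C]

/-- The action of permutations by conjugation. -/
def act (e : Fin n ≃ Fin m) (f : PowHom P R n X Y) : PowHom P R m X Y :=
  reparam (powAct P e.symm) (R.act e) f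

/-- Composition, which adds the degrees. -/
def comp (f : PowHom P R n X Y) (g : PowHom P R m Y Z) : PowHom P R (n + m) X Z :=
  reparam (powAdd P n m) (R.mul n m) (parComp f g)

/-- The tensor product, which adds the degrees. -/
def tensor (f : PowHom P R n X X') (g : PowHom P R m Y Y') :
    PowHom P R (n + m) (X ⊗ Y) (X' ⊗ Y') :=
  reparam (powAdd P n m) (R.mul n m) (parTensor f g)

lemma act_refl (f : PowHom P R n X Y) : act (Equiv.refl _) f = f := by
  rw [act, R.act_refl, Equiv.refl_symm, powAct_refl, reparam_id]

lemma act_trans (e : Fin n ≃ Fin m) (e' : Fin m ≃ Fin p) (f : PowHom P R n X Y) :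
    act (e.trans e') f = act e' (act e f) := by
  rw [act, act, act, reparam_reparam, R.act_trans, Equiv.symm_trans, powAct_trans]

lemma act_injective (e : Fin n ≃ Fin m) :
    Function.Injective (act e : PowHom P R n X Y → PowHom P R m X Y) := by
  intro f g h
  rw [← act_refl f, ← act_refl g, ← Equiv.self_trans_symm e, act_trans, act_trans, h]

lemma whiskerRight_comp_act (e : Fin n ≃ Fin m) (a : X ⟶ Y) (f : PowHom P R n Y Z) :
    a ▷ pow P m ≫ act e f = act e (a ▷ pow P n ≫ f) :=
  whiskerRight_comp_reparam _ _ _ _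

lemma comp_act (e : Fin n ≃ Fin n') (e' : Fin m ≃ Fin m') (f : PowHom P R n X Y)
    (g : PowHom P R m Y Z) : comp (act e f) (act e' g) = act (blockSum e e') (comp f g) := by
  rw [comp, comp, act, act, act, parComp_naturality, reparam_reparam, reparam_reparam, R.mul_act,
    blockSum_symm, powAct_blockSum]

lemma tensor_act (e : Fin n ≃ Fin n') (e' : Fin m ≃ Fin m') (f : PowHom P R n X X')
    (g : PowHom P R m Y Y') : tensor (act e f) (act e' g) = act (blockSum e e') (tensor f g) := by
  rw [tensor, tensor, act, act, act, parTensor_naturality, reparam_reparam, reparam_reparam,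
    R.mul_act, blockSum_symm, powAct_blockSum]

lemma comp_assoc (f : PowHom P R n X Y) (g : PowHom P R m Y Z) (h : PowHom P R p Z W) :
    act (finCongr (Nat.add_assoc n m p)) (comp (comp f g) h) = comp f (comp g h) := by
  simp only [comp, act, parComp_reparam_left, parComp_reparam_right, parComp_assoc,
    reparam_reparam, Category.assoc, ← powAdd_assoc, R.mul_assoc, Iso.inv_hom_id_assoc]
  rw [← Category.assoc (powAct P _), ← powAct_trans, Equiv.symm_trans_self, powAct_refl,
    Category.id_comp]

lemma comp_ofHom (f : PowHom P R n X Y) (b : Y ⟶ Z) :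
    comp f (ofHom P R b) = f ≫ b ▷ R.obj n := by
  rw [comp, ofHom, parComp_reparam_right, parComp_whiskerRight_unit, reparam_reparam,
    reparam_reparam, R.mul_one, Category.assoc]
  exact (congrArg (reparam · _ _) (powAdd_zero_right P n)).trans (reparam_id _)

lemma ofHom_comp (a : X ⟶ Y) (f : PowHom P R n Y Z) :
    act (finCongr (Nat.zero_add n)) (comp (ofHom P R a) f) = a ▷ pow P n ≫ f := by
  rw [comp, ofHom, parComp_reparam_left, whiskerRight_unit_parComp, act, reparam_reparam,
    reparam_reparam, reparam_reparam]
  simp only [Category.assoc]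
  rw [R.one_mul, powAdd_zero_left, ← powAct_trans,
    Equiv.symm_trans_self, powAct_refl, reparam_id]

lemma ofHom_comp_ofHom (a : X ⟶ Y) (b : Y ⟶ Z) :
    comp (ofHom P R a) (ofHom P R b) = ofHom P R (a ≫ b) := by
  refine (comp_ofHom _ _).trans ?_
  rw [ofHom, reparam_comp_whiskerRight, ← comp_whiskerRight, ofHom]

/-- The endomorphisms given by a central morphism commute with all morphisms. -/
lemma comp_ofUnit {u : P ⟶ R.obj 1} (hu : R.IsCentral u) (f : PowHom P R n X Y) :
    act (chi n 1) (comp f (ofUnit u Y)) = comp (ofUnit u X) f := by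
  have h : ofUnit u X = reparam (𝟙 _) u (X ◁ powOneHom P) := by simp [ofUnit, reparam]
  rw [comp, ofUnit, parComp_whiskerLeft, ← ofUnit, h, PowHom.comp, parComp_reparam_left, act]
  simp only [reparam_reparam]
  rw [chi_symm, ← Category.assoc (powAct P (chi 1 n)), powAct_chi]
  simp only [Category.assoc, id_whiskerRight, Category.comp_id, SymmetricCategory.symmetry]
  rw [BraidedCategory.braiding_naturality_left_assoc, hu, SymmetricCategory.symmetry_assoc]

/-- The composite of the endomorphisms of `X` given by a family of morphisms to the first level. -/
def sphere (X : C) : ∀ (k : ℕ), (Fin k → (P ⟶ R.obj 1)) → PowHom P R k X X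
  | 0, _ => ofHom P R (𝟙 X)
  | k + 1, v => comp (sphere X k (fun i => v i.castSucc)) (ofUnit (v (Fin.last k)) X)

lemma comp_sphere_succ (f : PowHom P R n X Y) (k : ℕ) (v : Fin (k + 1) → (P ⟶ R.obj 1)) :
    comp f (sphere Y (k + 1) v) =
      comp (comp f (sphere Y k fun i => v i.castSucc)) (ofUnit (v (Fin.last k)) Y) :=
  (comp_assoc f _ _).symm.trans (act_refl (comp (comp f _) (ofUnit _ Y)))

/-- Adjacent central endomorphisms may be exchanged. -/
lemma act_swap_sphere (X : C) (v : Fin (n + 1) → (P ⟶ R.obj 1)) (hv : ∀ i, R.IsCentral (v i))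
    (i : Fin n) : act (Equiv.swap i.castSucc i.succ) (sphere X (n + 1) v) =
      sphere X (n + 1) (fun k => v (Equiv.swap i.castSucc i.succ k)) := by
  induction n with
  | zero => exact i.elim0
  | succ n ih =>
    induction i using Fin.lastCases with
    | last =>
      -- the two factors on the right are exchanged; this is centrality of the last one
      have hs : Equiv.swap (Fin.last n).castSucc (Fin.last n).succ =
          (blockSum (Equiv.refl (Fin n)) (chi 1 1) : Fin (n + (1 + 1)) ≃ Fin (n + (1 + 1))) := by
        apply Equiv.ext
        intro k
        induction k using Fin.lastCases with
        | last =>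
          rw [Fin.succ_last, Equiv.swap_apply_right]
          exact (blockSum_natAdd (Equiv.refl (Fin n)) (chi 1 1) (Fin.natAdd 1 0)).symm
        | cast k =>
          induction k using Fin.lastCases with
          | last =>
            rw [Equiv.swap_apply_left]
            exact (blockSum_natAdd (Equiv.refl (Fin n)) (chi 1 1) (Fin.castAdd 1 0)).symm
          | cast k =>
            rw [Equiv.swap_apply_of_ne_of_ne]
            · exact (blockSum_castAdd (Equiv.refl (Fin n)) (chi 1 1) k).symm
            · simp [Fin.ext_iff, k.2.ne]
            · simp [Fin.ext_iff]; omega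
      have h₁ : ∀ u u' : P ⟶ R.obj 1, ∀ x : PowHom P R n X X,
          (comp (comp x (ofUnit u X)) (ofUnit u' X) : PowHom P R (n + 1 + 1) X X) =
            comp x (comp (ofUnit u X) (ofUnit u' X)) := fun u u' x => by
        rw [← comp_assoc]
        exact (act_refl _).symm
      have h₂ : ∀ u u' : P ⟶ R.obj 1, R.IsCentral u' → ∀ x : PowHom P R n X X,
          act (blockSum (Equiv.refl (Fin n)) (chi 1 1)) (comp x (comp (ofUnit u X) (ofUnit u' X))) =
            comp x (comp (ofUnit u' X) (ofUnit u X)) := fun u u' hu x => by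
        rw [← comp_act, act_refl, comp_ofUnit hu]
      rw [hs]
      simp only [sphere]
      refine (congrArg (act _) (h₁ _ _ _)).trans ((h₂ _ _ (hv _) _).trans ?_)
      refine (h₁ _ _ _).symm.trans ?_
      have e₁ : Equiv.swap (Fin.last n).castSucc (Fin.last n).succ (Fin.last (n + 1)) =
          (Fin.last n).castSucc := Equiv.swap_apply_right _ _
      have e₂ : Equiv.swap (Fin.last n).castSucc (Fin.last n).succ (Fin.last n).castSucc =
          Fin.last (n + 1) := Equiv.swap_apply_left _ _
      have e₃ : ∀ k : Fin n, Equiv.swap (Fin.last n).castSucc (Fin.last n).succ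
          k.castSucc.castSucc = k.castSucc.castSucc := fun k =>
        Equiv.swap_apply_of_ne_of_ne (by simp [Fin.ext_iff, k.2.ne]) (by simp [Fin.ext_iff]; omega)
      rw [← hs, e₁, e₂]
      simp only [e₃]
    | cast i =>
      -- the factor on the right is not moved
      have hs : Equiv.swap i.castSucc.castSucc i.castSucc.succ =
          blockSum (Equiv.swap i.castSucc i.succ) (Equiv.refl (Fin 1)) := by
        apply Equiv.ext
        intro k
        induction k using Fin.lastCases with
        | last =>
          rw [Equiv.swap_apply_of_ne_of_ne]
          · exact (blockSum_natAdd _ (Equiv.refl (Fin 1)) 0).symm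
          · simp [Fin.ext_iff]; omega
          · simp [Fin.ext_iff]; omega
        | cast k =>
          refine Eq.trans ?_ (blockSum_castAdd _ (Equiv.refl (Fin 1)) k).symm
          exact ((Fin.castSucc_injective (n + 1)).swap_apply i.castSucc i.succ k)
      rw [hs]
      refine (comp_act _ _ _ _).symm.trans ?_
      rw [act_refl, ih _ (fun k => hv _)]
      have e₁ : blockSum (Equiv.swap i.castSucc i.succ) (Equiv.refl (Fin 1)) (Fin.last (n + 1)) =
          Fin.last (n + 1) := blockSum_natAdd _ (Equiv.refl (Fin 1)) 0
      have e₂ : ∀ k : Fin (n + 1), blockSum (Equiv.swap i.castSucc i.succ) (Equiv.refl (Fin 1))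
          k.castSucc = (Equiv.swap i.castSucc i.succ k).castSucc :=
        blockSum_castAdd _ (Equiv.refl (Fin 1))
      rw [sphere.eq_2 X (n + 1), e₁]
      simp only [e₂]

/-- Permuting the factors of a composite of central endomorphisms. -/
lemma act_sphere (X : C) {k k' : ℕ} (e : Fin k ≃ Fin k') (v : Fin k → (P ⟶ R.obj 1))
    (hv : ∀ i, R.IsCentral (v i)) :
    act e (sphere X k v) = sphere X k' (fun i => v (e.symm i)) := by
  obtain rfl : k = k' := by simpa using Fintype.card_congr e
  cases k with
  | zero =>
    obtain rfl : e = Equiv.refl _ := Subsingleton.elim _ _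
    exact act_refl _
  | succ k =>
    have he : e ∈ Submonoid.closure (Set.range fun i : Fin k => Equiv.swap i.castSucc i.succ) := by
      rw [Equiv.Perm.mclosure_swap_castSucc_succ]
      trivial
    induction he using Submonoid.closure_induction generalizing v with
    | mem e he =>
      obtain ⟨i, rfl⟩ := he
      exact act_swap_sphere X v hv i
    | one => exact act_refl _
    | mul e f _ _ he hf =>
      refine (act_trans f e _).trans ?_
      rw [hf v hv, he _ (fun i => hv _)]
      rfl

/-- The interchange law. The composites are multiplied in the order `n, n', m, m'` on the left and
`n, m, n', m'` on the right, hence the commutativity and the permutation. -/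
lemma tensor_comp (hR : R.IsCommutative) (f : PowHom P R n X X') (f' : PowHom P R m X' X'')
    (g : PowHom P R n' Y Y') (g' : PowHom P R m' Y' Y'') :
    comp (tensor f g) (tensor f' g') =
      act (chiMid n m n' m') (tensor (comp f f') (comp g g')) := by
  rw [comp, tensor, tensor, parComp_naturality, parTensor_parComp, tensor, comp, comp,
    parTensor_naturality, act]
  simp only [reparam_reparam, Category.assoc]
  rw [hR.tensorμ_mul, ← powAct_chiMid, chiMid_symm]

lemma tensor_assoc (f : PowHom P R n X X') (g : PowHom P R m Y Y') (h : PowHom P R p Z Z') :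
    act (finCongr (Nat.add_assoc n m p)) (tensor (tensor f g) h ≫ (α_ X' Y' Z').hom ▷ _) =
      (α_ X Y Z).hom ▷ _ ≫ tensor f (tensor g h) := by
  simp only [tensor, act, parTensor_reparam_left, parTensor_reparam_right,
    reparam_reparam, reparam_comp_whiskerRight, whiskerRight_comp_reparam, parTensor_assoc,
    Category.assoc, ← powAdd_assoc, R.mul_assoc, Iso.inv_hom_id_assoc]
  rw [← Category.assoc (powAct P _), ← powAct_trans, Equiv.symm_trans_self, powAct_refl,
    Category.id_comp]

lemma ofHom_tensor (f : PowHom P R n X Y) :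
    act (finCongr (Nat.zero_add n)) (tensor (ofHom P R (𝟙 (𝟙_ C))) f ≫ (λ_ Y).hom ▷ _) =
      (λ_ X).hom ▷ _ ≫ f := by
  simp only [tensor, act, ofHom, id_whiskerRight, parTensor_reparam_left, reparam_reparam,
    reparam_comp_whiskerRight, id_parTensor, Category.assoc, powAdd_zero_left, R.one_mul]
  rw [← powAct_trans, Equiv.symm_trans_self, powAct_refl, reparam_id]

lemma tensor_ofHom (f : PowHom P R n X Y) :
    tensor f (ofHom P R (𝟙 (𝟙_ C))) ≫ (ρ_ Y).hom ▷ R.obj n = (ρ_ X).hom ▷ _ ≫ f := by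
  rw [tensor, ofHom, id_whiskerRight, parTensor_reparam_right, reparam_reparam]
  refine (reparam_comp_whiskerRight _ _ _ _).trans ?_
  rw [parTensor_id, reparam_reparam, R.mul_one, Category.assoc]
  exact (congrArg (reparam · _ _) (powAdd_zero_right P n)).trans (reparam_id _)

lemma tensor_braiding (hR : R.IsCommutative) (f : PowHom P R n X X') (g : PowHom P R m Y Y') :
    tensor f g ≫ (β_ X' Y').hom ▷ _ = (β_ X Y).hom ▷ _ ≫ act (chi m n) (tensor g f) := by
  simp only [tensor, act, reparam_comp_whiskerRight, whiskerRight_comp_reparam, parTensor_braiding,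
    reparam_reparam]
  rw [chi_symm, powAct_chi, hR]

lemma ofHom_tensor_ofHom (a : X ⟶ X') (b : Y ⟶ Y') :
    tensor (ofHom P R a) (ofHom P R b) = ofHom P R (a ⊗ₘ b) := by
  rw [tensor, ofHom, ofHom, parTensor_naturality, parTensor_whiskerRight_unit, reparam_reparam,
    reparam_reparam, Category.assoc, powAdd_zero_zero, R.one_tensor_one_mul, ofHom]

lemma ofHom_tensor_ofUnit (u : P ⟶ R.obj 1) (X Y : C) :
    tensor (ofHom P R (𝟙 X)) (ofUnit u Y) = ofUnit u (X ⊗ Y) := by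
  have h := congrArg (fun t => (powAdd P 0 1 ≫ (powZeroHom P ⊗ₘ powOneHom P) ≫ (λ_ P).hom) ≫ t)
    (R.one_tensor_mul_one u)
  simp only [Category.assoc, Iso.hom_inv_id_assoc] at h
  rw [tensor, ofHom_id, ofUnit, parTensor_whiskerLeft, reparam, ← MonoidalCategory.whiskerLeft_comp,
    ← MonoidalCategory.whiskerLeft_comp, ofUnit, ← tensorHom_comp_tensorHom]
  simp only [Category.assoc]
  rw [h, reassoc_of% powAdd_zero_one P]

lemma ofUnit_tensor_ofHom (u : P ⟶ R.obj 1) (X Y : C) :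
    tensor (ofUnit u X) (ofHom P R (𝟙 Y)) = ofUnit u (X ⊗ Y) := by
  have h := congrArg (fun t => (powAdd P 1 0 ≫ (powOneHom P ⊗ₘ powZeroHom P) ≫ (ρ_ P).hom) ≫ t)
    (R.tensor_one_mul u)
  simp only [Category.assoc, Iso.hom_inv_id_assoc] at h
  rw [tensor, ofHom_id, ofUnit, parTensor_whiskerLeft, reparam, ← MonoidalCategory.whiskerLeft_comp,
    ← MonoidalCategory.whiskerLeft_comp, ofUnit, ← tensorHom_comp_tensorHom]
  simp only [Category.assoc]
  refine (congrArg _ h).trans ?_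
  rw [reassoc_of% powAdd_one_zero P]

/-- Composition is linear over central endomorphisms of degree one in the first variable, up to
moving the new factor past the second variable. -/
lemma act_chiOne_comp {u : P ⟶ R.obj 1} (hu : R.IsCentral u) (f : PowHom P R n X Y)
    (g : PowHom P R m Y Z) :
    act (chiOne n m) (comp (comp f (ofUnit u Y)) g) = comp (comp f g) (ofUnit u Z) := by
  have h : act (chi 1 m) (comp (ofUnit u Y) g) = comp g (ofUnit u Z) := by
    rw [← comp_ofUnit hu, ← act_trans]
    have : (chi m 1).trans (chi 1 m) = Equiv.refl _ := by
      rw [← chi_symm, Equiv.symm_trans_self]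
    rw [this, act_refl]
  have h' := comp_act (Equiv.refl (Fin n)) (chi 1 m) f (comp (ofUnit u Y) g)
  rw [act_refl, h] at h'
  rw [chiOne, act_trans, comp_assoc]
  refine h'.symm.trans ?_
  exact (comp_assoc f g (ofUnit u Z)).symm.trans (act_refl (comp (comp f g) (ofUnit u Z)))

lemma comp_id (f : PowHom P R n X Y) : comp f (ofHom P R (𝟙 Y)) = f := by
  rw [comp_ofHom, id_whiskerRight, Category.comp_id]

/-- Tensor products are linear over the endomorphisms of degree one in the second variable. -/
lemma tensor_comp_ofUnit (hR : R.IsCommutative) (u : P ⟶ R.obj 1) (f : PowHom P R n X X')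
    (g : PowHom P R m Y Y') :
    tensor f (comp g (ofUnit u Y')) = comp (tensor f g) (ofUnit u (X' ⊗ Y')) := by
  -- the endomorphism of `X' ⊗ Y'` is the tensor product of `𝟙 X'` with that of `Y'`
  rw [← ofHom_tensor_ofUnit, tensor_comp hR, comp_id, chiMid_zero_one]
  exact (act_refl _).symm

/-- Tensor products are linear over the endomorphisms of degree one in the first variable, up to
moving the new factor past the second variable. -/
lemma act_chiOne_tensor (hR : R.IsCommutative) (u : P ⟶ R.obj 1) (f : PowHom P R n X X')
    (g : PowHom P R m Y Y') :
    act (chiOne n m) (tensor (comp f (ofUnit u X')) g) =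
      comp (tensor f g) (ofUnit u (X' ⊗ Y')) := by
  rw [← ofUnit_tensor_ofHom, tensor_comp hR, comp_id, chiOne_eq_chiMid]

variable {φ}

lemma map_act (e : Fin n ≃ Fin m) (h : φ n ≫ S.act e = R.act e ≫ φ m) (f : PowHom P R n X Y) :
    act e (map φ f) = map φ (act e f) := by
  rw [map_eq_reparam, map_eq_reparam, act, act, reparam_reparam, reparam_reparam, h,
    Category.comp_id, Category.id_comp]

lemma map_comp (h : (φ n ⊗ₘ φ m) ≫ S.mul n m = R.mul n m ≫ φ (n + m)) (f : PowHom P R n X Y)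
    (g : PowHom P R m Y Z) : comp (map φ f) (map φ g) = map φ (comp f g) := by
  rw [map_eq_reparam, map_eq_reparam, map_eq_reparam, comp, comp, parComp_naturality,
    reparam_reparam, reparam_reparam, h, id_tensorHom_id, Category.comp_id, Category.id_comp]

lemma map_tensor (h : (φ n ⊗ₘ φ m) ≫ S.mul n m = R.mul n m ≫ φ (n + m)) (f : PowHom P R n X X')
    (g : PowHom P R m Y Y') : tensor (map φ f) (map φ g) = map φ (tensor f g) := by
  rw [map_eq_reparam, map_eq_reparam, map_eq_reparam, tensor, tensor, parTensor_naturality,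
    reparam_reparam, reparam_reparam, h, id_tensorHom_id, Category.comp_id, Category.id_comp]

end PowHom

end PowHom

/-! ### The ring objects of simplices -/

section SmashTensor

variable {C : Type u} [Category.{v} C] [MonoidalCategory C] [HasFiniteCoproducts C]
  {A B D Z : C} {ι κ μ : Type} [Finite ι] [Finite κ] [Finite μ]

/-- The canonical morphism `(A ∧ B) ∧ K → A ∧ (B ∧ K)`, inverse to `distribLeft`. -/
def gather (A B : C) (ι : Type) [Finite ι] : smash (A ⊗ B) ι ⟶ A ⊗ smash B ι :=
  desc fun i => A ◁ incl B i

lemma incl_gather (i : ι) : incl (A ⊗ B) i ≫ gather A B ι = A ◁ incl B i :=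
  incl_desc _ _

variable [FinitelyDistributive C]

lemma incl_whiskerRight_distribRight (i : ι) :
    incl A i ▷ B ≫ distribRight A ι B = incl (A ⊗ B) i := by
  have := FinitelyDistributive.isIso_desc (fun _ : ι => A) B
  exact (IsIso.comp_inv_eq (Limits.Sigma.desc fun i => Sigma.ι (fun _ : ι => A) i ▷ B)).2
    (Limits.Sigma.ι_desc (fun i => Sigma.ι (fun _ : ι => A) i ▷ B) i).symm

lemma whiskerRight_smash_ext {f g : smash A ι ⊗ B ⟶ D}
    (h : ∀ i, incl A i ▷ B ≫ f = incl A i ▷ B ≫ g) : f = g := by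
  have := FinitelyDistributive.isIso_desc (fun _ : ι => A) B
  refine (cancel_epi (Limits.Sigma.desc fun i => Sigma.ι (fun _ : ι => A) i ▷ B)).1
    (Limits.Sigma.hom_ext _ _ fun i => ?_)
  have hi : Sigma.ι (fun _ : ι => A ⊗ B) i ≫
      Limits.Sigma.desc (fun i => Sigma.ι (fun _ : ι => A) i ▷ B) = incl A i ▷ B :=
    Limits.Sigma.ι_desc _ _
  exact (Category.assoc _ _ _).symm.trans ((congrArg (· ≫ f) hi).trans ((h i).trans
    ((congrArg (· ≫ g) hi).symm.trans (Category.assoc _ _ _))))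

/-- Whiskering preserves zero morphisms: they factor through the empty coproduct, which is preserved
by whiskering and has only one morphism to any object. -/
lemma zero_whiskerRight [HasZeroMorphisms C] : (0 : A ⟶ B) ▷ Z = 0 := by
  have h : (0 : smash A (Fin 0) ⟶ B) ▷ Z = 0 := whiskerRight_smash_ext fun i => i.elim0
  have h' : (0 : A ⟶ B) = (0 : A ⟶ smash A (Fin 0)) ≫ 0 := zero_comp.symm
  rw [h', comp_whiskerRight, h, comp_zero]

variable [SymmetricCategory C]

lemma whiskerLeft_zero [HasZeroMorphisms C] : Z ◁ (0 : A ⟶ B) = 0 := by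
  rw [whiskerLeft_eq_braiding, zero_whiskerRight, zero_comp, comp_zero]

lemma whiskerLeft_incl_distribLeft (i : ι) :
    A ◁ incl B i ≫ distribLeft A B ι = incl (A ⊗ B) i := by
  rw [distribLeft, BraidedCategory.braiding_naturality_right_assoc,
    reassoc_of% incl_whiskerRight_distribRight, incl_desc, SymmetricCategory.symmetry_assoc]

lemma whiskerLeft_smash_ext {f g : A ⊗ smash B ι ⟶ D}
    (h : ∀ i, A ◁ incl B i ≫ f = A ◁ incl B i ≫ g) : f = g := by
  rw [← cancel_epi (β_ _ _).hom]
  apply whiskerRight_smash_ext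
  intro i
  simp only [BraidedCategory.braiding_naturality_left_assoc, h]

lemma smash_tensor_smash_ext {f g : smash A ι ⊗ smash B κ ⟶ D}
    (h : ∀ i j, (incl A i ⊗ₘ incl B j) ≫ f = (incl A i ⊗ₘ incl B j) ≫ g) : f = g := by
  apply whiskerRight_smash_ext
  intro i
  apply whiskerLeft_smash_ext
  intro j
  simpa only [MonoidalCategory.tensorHom_def', Category.assoc] using h i j

/-- Morphisms out of a triple product of copowers may be compared on the summands. -/
lemma smash_tensor_smash_tensor_smash_ext {f g : (smash A ι ⊗ smash B κ) ⊗ smash D μ ⟶ Z}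
    (h : ∀ i j k, ((incl A i ⊗ₘ incl B j) ⊗ₘ incl D k) ≫ f =
      ((incl A i ⊗ₘ incl B j) ⊗ₘ incl D k) ≫ g) : f = g := by
  -- distributivity is only available for a copower next to a single object, so the factors are
  -- moved to the outside one after the other
  rw [← cancel_epi (α_ _ _ _).inv]
  apply whiskerRight_smash_ext
  intro i
  rw [← cancel_epi (α_ A (smash B κ) (smash D μ)).hom]
  apply whiskerLeft_smash_ext
  intro k
  rw [← cancel_epi ((β_ (smash B κ) A).hom ▷ D), ← cancel_epi (α_ (smash B κ) A D).inv]
  apply whiskerRight_smash_ext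
  intro j
  have key : ∀ t : (smash A ι ⊗ smash B κ) ⊗ smash D μ ⟶ Z,
      incl B j ▷ (A ⊗ D) ≫ (α_ _ A D).inv ≫ (β_ _ A).hom ▷ D ≫ (A ⊗ _) ◁ incl D k ≫
          (α_ A _ _).hom ≫ incl A i ▷ (_ ⊗ _) ≫ (α_ _ _ _).inv ≫ t =
        (α_ B A D).inv ≫ (β_ B A).hom ▷ D ≫ ((incl A i ⊗ₘ incl B j) ⊗ₘ incl D k) ≫ t := by
    intro t
    rw [← associator_naturality_left_assoc, Iso.hom_inv_id_assoc,
      associator_inv_naturality_left_assoc, ← comp_whiskerRight_assoc,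
      BraidedCategory.braiding_naturality_left, comp_whiskerRight_assoc, ← whisker_exchange_assoc]
    simp only [MonoidalCategory.tensorHom_def', Category.assoc, comp_whiskerRight]
  rw [key, key, h]

/-- The morphism out of a product of two copowers with prescribed restrictions to the summands. -/
def desc₂ (f : ι → κ → (A ⊗ B ⟶ D)) : smash A ι ⊗ smash B κ ⟶ D :=
  distribRight A ι (smash B κ) ≫ desc fun i => distribLeft A B κ ≫ desc fun j => f i j

lemma incl_tensor_incl_desc₂ (f : ι → κ → (A ⊗ B ⟶ D)) (i : ι) (j : κ) :
    (incl A i ⊗ₘ incl B j) ≫ desc₂ f = f i j := by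
  rw [MonoidalCategory.tensorHom_def', Category.assoc, desc₂,
    reassoc_of% incl_whiskerRight_distribRight, incl_desc,
    reassoc_of% whiskerLeft_incl_distribLeft, incl_desc]

lemma comp_incl_tensor_comp_incl_desc₂ {A' B' : C} (a : A' ⟶ A) (b : B' ⟶ B)
    (f : ι → κ → (A ⊗ B ⟶ D)) (i : ι) (j : κ) :
    (a ≫ incl A i ⊗ₘ b ≫ incl B j) ≫ desc₂ f = (a ⊗ₘ b) ≫ f i j := by
  rw [← tensorHom_comp_tensorHom, Category.assoc, incl_tensor_incl_desc₂]

lemma gather_distribLeft : gather A B ι ≫ distribLeft A B ι = 𝟙 _ := by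
  apply smash_ext
  intro i
  rw [reassoc_of% incl_gather, whiskerLeft_incl_distribLeft, Category.comp_id]

instance : Mono (gather A B ι) :=
  mono_of_mono_fac gather_distribLeft

end SmashTensor

section SphereRing

variable {C : Type u} [Category.{v} C] [MonoidalCategory C] [SymmetricCategory C]
  [HasFiniteCoproducts C] [FinitelyDistributive C] (E : RingObject C) (ℓ : SimplexCategory)

/-- The ring object of `ℓ`-simplices of `E ∧ S`, with levels `E_n ∧ S^n`. The summands of the `n`-th
level correspond to the `n`-tuples of `ℓ`-simplices of `S^1` other than the base point; permutations
act on the tuples, and the multiplication concatenates them. -/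
def sphereRing : RingObject C where
  obj n := smash (E.obj n) (Cell n ℓ)
  act {n m} e := desc fun s => E.act e ≫ incl (E.obj m) (s ∘ e.symm)
  act_refl n := by
    apply smash_ext
    intro s
    rw [incl_desc, E.act_refl]
    simp
  act_trans e f := by
    apply smash_ext
    intro s
    rw [incl_desc, ← Category.assoc, incl_desc, Category.assoc, incl_desc, E.act_trans,
      Category.assoc]
    rfl
  mul n m := desc₂ fun s t => E.mul n m ≫ incl (E.obj (n + m)) (Fin.append s t)
  mul_act {n n' m m'} e f := by
    apply smash_tensor_smash_ext
    intro s t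
    have h : Fin.append (s ∘ e.symm) (t ∘ f.symm) = Fin.append s t ∘ (blockSum e f).symm := by
      rw [← Fin.append_castAdd_natAdd (f := Fin.append s t ∘ (blockSum e f).symm)]
      simp only [Function.comp_apply, blockSum_symm, blockSum_castAdd, blockSum_natAdd,
        Fin.append_left, Fin.append_right]
      rfl
    rw [tensorHom_comp_tensorHom_assoc, incl_desc, incl_desc, comp_incl_tensor_comp_incl_desc₂,
      reassoc_of% E.mul_act, reassoc_of% incl_tensor_incl_desc₂, Category.assoc, incl_desc, h]
  one := E.one ≫ incl (E.obj 0) Fin.elim0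
  mul_assoc n m p := by
    apply smash_tensor_smash_tensor_smash_ext
    intro s t r
    have h : Fin.append (Fin.append s t) r ∘ (finCongr (Nat.add_assoc n m p)).symm =
        Fin.append s (Fin.append t r) := by
      rw [Fin.append_assoc]
      rfl
    have h₁ := comp_incl_tensor_comp_incl_desc₂ (E.mul n m) (𝟙 (E.obj p))
      (fun s t => E.mul (n + m) p ≫ incl (E.obj (n + m + p)) (Fin.append s t : Cell _ ℓ))
      (Fin.append s t) r
    have h₂ := comp_incl_tensor_comp_incl_desc₂ (𝟙 (E.obj n)) (E.mul m p)
      (fun s t => E.mul n (m + p) ≫ incl (E.obj (n + (m + p))) (Fin.append s t : Cell _ ℓ))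
      s (Fin.append t r)
    rw [Category.id_comp] at h₁ h₂
    rw [← MonoidalCategory.tensorHom_id, tensorHom_comp_tensorHom_assoc, Category.comp_id,
      associator_naturality_assoc, ← MonoidalCategory.id_tensorHom, tensorHom_comp_tensorHom_assoc,
      Category.comp_id, incl_tensor_incl_desc₂, incl_tensor_incl_desc₂, reassoc_of% h₁, h₂,
      incl_desc, h, tensorHom_id, reassoc_of% E.mul_assoc, id_tensorHom]
  mul_one n := by
    apply smash_ext
    intro s
    have h : Fin.append s (Fin.elim0 : Cell 0 ℓ) = s := by
      rw [Fin.append_elim0]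
      rfl
    have h₁ := comp_incl_tensor_comp_incl_desc₂ (𝟙 (E.obj n)) E.one
      (fun s t => E.mul n 0 ≫ incl (E.obj (n + 0)) (Fin.append s t : Cell _ ℓ)) s Fin.elim0
    rw [Category.id_comp, MonoidalCategory.tensorHom_def, Category.assoc] at h₁
    rw [rightUnitor_inv_naturality_assoc, h₁, h, id_tensorHom, reassoc_of% E.mul_one,
      Category.comp_id]
    rfl
  one_mul n := by
    apply smash_ext
    intro s
    have h : Fin.append (Fin.elim0 : Cell 0 ℓ) s ∘ (finCongr (Nat.zero_add n)).symm = s := by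
      rw [Fin.elim0_append]
      rfl
    have h₁ := comp_incl_tensor_comp_incl_desc₂ E.one (𝟙 (E.obj n))
      (fun s t => E.mul 0 n ≫ incl (E.obj (0 + n)) (Fin.append s t : Cell _ ℓ)) Fin.elim0 s
    rw [Category.id_comp, MonoidalCategory.tensorHom_def', Category.assoc] at h₁
    rw [leftUnitor_inv_naturality_assoc, reassoc_of% h₁, incl_desc, h, tensorHom_id,
      reassoc_of% E.one_mul, Category.comp_id]

variable {E ℓ}

/-- The inclusion `E_n → E_n ∧ S^n` of a summand. -/
def sphereIncl {n : ℕ} (s : Cell n ℓ) : E.obj n ⟶ (sphereRing E ℓ).obj n := incl (E.obj n) s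

lemma sphereRing_hom_ext {n : ℕ} {Z : C} {f g : (sphereRing E ℓ).obj n ⟶ Z}
    (h : ∀ s : Cell n ℓ, sphereIncl s ≫ f = sphereIncl s ≫ g) : f = g :=
  smash_ext h

lemma sphereRing_whiskerRight_hom_ext {n : ℕ} {B Z : C} {f g : (sphereRing E ℓ).obj n ⊗ B ⟶ Z}
    (h : ∀ s : Cell n ℓ, sphereIncl s ▷ B ≫ f = sphereIncl s ▷ B ≫ g) : f = g :=
  whiskerRight_smash_ext h

lemma sphereRing_tensor_hom_ext {n m : ℕ} {Z : C}
    {f g : (sphereRing E ℓ).obj n ⊗ (sphereRing E ℓ).obj m ⟶ Z}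
    (h : ∀ (s : Cell n ℓ) (t : Cell m ℓ),
      (sphereIncl s ⊗ₘ sphereIncl t) ≫ f = (sphereIncl s ⊗ₘ sphereIncl t) ≫ g) : f = g :=
  smash_tensor_smash_ext h

lemma sphereIncl_act {n m : ℕ} (s : Cell n ℓ) (e : Fin n ≃ Fin m) :
    sphereIncl s ≫ (sphereRing E ℓ).act e = E.act e ≫ sphereIncl (s ∘ e.symm) :=
  incl_desc _ _

lemma sphereIncl_tensor_sphereIncl_mul {n m : ℕ} (s : Cell n ℓ) (t : Cell m ℓ) :
    (sphereIncl s ⊗ₘ sphereIncl t) ≫ (sphereRing E ℓ).mul n m =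
      E.mul n m ≫ sphereIncl (Fin.append s t) :=
  incl_tensor_incl_desc₂ _ _ _

lemma sphereRing_one : (sphereRing E ℓ).one = E.one ≫ sphereIncl Fin.elim0 := rfl

lemma append_comp_chi_symm {n m : ℕ} {α : Type} (s : Fin n → α) (t : Fin m → α) :
    Fin.append s t ∘ (chi n m).symm = Fin.append t s := by
  rw [← Fin.append_castAdd_natAdd (f := Fin.append s t ∘ (chi n m).symm)]
  simp only [Function.comp_apply, chi_symm, chi_castAdd, chi_natAdd, Fin.append_left,
    Fin.append_right]

/-- Commutativity carries over, since the blocks of the sphere coordinates are exchanged as well. -/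
lemma isCommutative_sphereRing (hE : E.IsCommutative) : (sphereRing E ℓ).IsCommutative := by
  intro n m
  apply sphereRing_tensor_hom_ext
  intro s t
  rw [BraidedCategory.braiding_naturality_assoc, sphereIncl_tensor_sphereIncl_mul,
    reassoc_of% sphereIncl_tensor_sphereIncl_mul, sphereIncl_act, append_comp_chi_symm,
    reassoc_of% hE]

variable [HasZeroMorphisms C]

lemma isCentral_zero (R : RingObject C) (P : C) : R.IsCentral (0 : P ⟶ R.obj 1) := by
  intro n
  rw [whiskerLeft_zero, zero_whiskerRight, zero_comp, zero_comp, comp_zero]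

variable (ℓ) in
/-- The morphism `P → E_1 ∧ S^1` given by a morphism `P → E_1` and a simplex of `S^1`. -/
def sphereUnit {P : C} (u : P ⟶ E.obj 1) : Option (Arc ℓ) → (P ⟶ (sphereRing E ℓ).obj 1)
  | none => 0
  | some k => u ≫ sphereIncl fun _ => k

/-- The degree one morphisms used by the structure maps are central, at the base point for trivial
reasons. -/
lemma isCentral_sphereUnit {P : C} {u : P ⟶ E.obj 1} (hu : E.IsCentral u) (k : Option (Arc ℓ)) :
    (sphereRing E ℓ).IsCentral (sphereUnit ℓ u k) := by
  cases k with
  | none => exact isCentral_zero _ _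
  | some k =>
    intro n
    apply sphereRing_whiskerRight_hom_ext
    intro s
    rw [sphereUnit, BraidedCategory.braiding_naturality_left_assoc,
      MonoidalCategory.whiskerLeft_comp_assoc, ← whisker_exchange_assoc (sphereIncl s) u,
      comp_whiskerRight_assoc, whisker_exchange_assoc u (sphereIncl s),
      ← MonoidalCategory.tensorHom_def_assoc,
      ← MonoidalCategory.tensorHom_def'_assoc, sphereIncl_tensor_sphereIncl_mul,
      reassoc_of% sphereIncl_tensor_sphereIncl_mul, sphereIncl_act, append_comp_chi_symm,
      reassoc_of% hu]

end SphereRing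

section Pull

variable {C : Type u} [Category.{v} C] [MonoidalCategory C] [SymmetricCategory C]
  [HasFiniteCoproducts C] [HasZeroMorphisms C] [FinitelyDistributive C] (E : RingObject C)
  {k ℓ : SimplexCategory} (θ : k ⟶ ℓ)

/-- The simplicial operator `θ^*` on `E_n ∧ S^n`. -/
def spherePull (n : ℕ) : (sphereRing E ℓ).obj n ⟶ (sphereRing E k).obj n :=
  smashMap (E.obj n) (cellPull n θ)

lemma sphereIncl_spherePull {n : ℕ} (s : Cell n ℓ) :
    sphereIncl s ≫ spherePull E θ n = (cellPull n θ s).elim 0 sphereIncl :=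
  incl_desc _ _

lemma cellPull_eq_some {n : ℕ} {s : Cell n ℓ} {s' : Cell n k} :
    cellPull n θ s = some s' ↔ ∀ i, (s' i).1 = θ ≫ (s i).1 := by
  rw [cellPull]
  split_ifs with h
  · rw [Option.some_inj, funext_iff]
    exact forall_congr' fun i => by rw [Subtype.ext_iff, eq_comm]
  · refine iff_of_false (by simp) fun h' => h fun i => ?_
    rw [← h' i]
    exact (s' i).2

lemma cellPull_eq_none {n : ℕ} {s : Cell n ℓ} : cellPull n θ s = none ↔
    ∃ i, ¬ Function.Surjective (SimplexCategory.Hom.toOrderHom (θ ≫ (s i).1)) := by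
  rw [cellPull]
  split_ifs with h <;> simpa using h

/-- The simplicial operators on `S^n ∧ S^m`: a pair is sent to the base point if one of its
components is. -/
lemma cellPull_append {n m : ℕ} (s : Cell n ℓ) (t : Cell m ℓ) :
    cellPull (n + m) θ (Fin.append s t) = (cellPull n θ s).bind fun s' =>
      (cellPull m θ t).map fun t' => Fin.append s' t' := by
  cases hs : cellPull n θ s with
  | none =>
    obtain ⟨i, hi⟩ := (cellPull_eq_none θ).1 hs
    exact (cellPull_eq_none θ).2 ⟨Fin.castAdd m i, by rwa [Fin.append_left]⟩
  | some s' =>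
    cases ht : cellPull m θ t with
    | none =>
      obtain ⟨i, hi⟩ := (cellPull_eq_none θ).1 ht
      exact (cellPull_eq_none θ).2 ⟨Fin.natAdd n i, by rwa [Fin.append_right]⟩
    | some t' =>
      refine (cellPull_eq_some (s' := Fin.append s' t') θ).2 fun i => ?_
      rw [cellPull_eq_some] at hs ht
      induction i using Fin.addCases with
      | left i => rw [Fin.append_left, Fin.append_left, hs]
      | right i => rw [Fin.append_right, Fin.append_right, ht]

lemma cellPull_comp_symm {n m : ℕ} (e : Fin n ≃ Fin m) (s : Cell n ℓ) :
    cellPull m θ (s ∘ e.symm) = (cellPull n θ s).map fun s' => s' ∘ e.symm := by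
  cases hs : cellPull n θ s with
  | none =>
    obtain ⟨i, hi⟩ := (cellPull_eq_none θ).1 hs
    exact (cellPull_eq_none θ).2 ⟨e i, by rwa [Function.comp_apply, e.symm_apply_apply]⟩
  | some s' =>
    exact (cellPull_eq_some θ).2 fun i => (cellPull_eq_some θ).1 hs (e.symm i)

/-- Simplicial operators are equivariant. -/
lemma spherePull_act {n m : ℕ} (e : Fin n ≃ Fin m) :
    spherePull E θ n ≫ (sphereRing E k).act e = (sphereRing E ℓ).act e ≫ spherePull E θ m := by
  apply sphereRing_hom_ext
  intro s
  rw [reassoc_of% sphereIncl_spherePull, reassoc_of% sphereIncl_act, sphereIncl_spherePull,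
    cellPull_comp_symm]
  cases cellPull n θ s with
  | none => simp
  | some s' => exact sphereIncl_act _ _

/-- Simplicial operators are multiplicative. -/
lemma spherePull_mul (n m : ℕ) :
    (spherePull E θ n ⊗ₘ spherePull E θ m) ≫ (sphereRing E k).mul n m =
      (sphereRing E ℓ).mul n m ≫ spherePull E θ (n + m) := by
  apply sphereRing_tensor_hom_ext
  intro s t
  rw [reassoc_of% sphereIncl_tensor_sphereIncl_mul, sphereIncl_spherePull, cellPull_append,
    tensorHom_comp_tensorHom_assoc, sphereIncl_spherePull, sphereIncl_spherePull]
  cases cellPull n θ s with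
  | none => simp [MonoidalCategory.tensorHom_def, zero_whiskerRight]
  | some s' =>
    cases cellPull m θ t with
    | none => simp [MonoidalCategory.tensorHom_def, whiskerLeft_zero]
    | some t' => exact sphereIncl_tensor_sphereIncl_mul _ _

variable {E}

/-- The simplicial operator `θ^*` on `S^1`. -/
def circlePull (s : Option (Arc ℓ)) : Option (Arc k) := pull circle θ s

lemma sphereUnit_spherePull {P : C} (u : P ⟶ E.obj 1) (s : Option (Arc ℓ)) :
    sphereUnit ℓ u s ≫ spherePull E θ 1 = sphereUnit k u (circlePull θ s) := by
  cases s with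
  | none => exact zero_comp
  | some a =>
    rw [sphereUnit, Category.assoc, sphereIncl_spherePull]
    change _ = sphereUnit k u ((cellPull 1 θ fun _ => a).map fun c => c 0)
    cases cellPull 1 θ fun _ => a with
    | none => exact comp_zero
    | some c =>
      have hc : c = fun _ => c 0 := funext fun i => congrArg c (Subsingleton.elim i 0)
      rw [hc]
      rfl

end Pull

/-! ### Correspondences as morphisms with coefficients in the ring objects of simplices -/

section

variable {C : Type u} [Category.{v} C] [MonoidalCategory C] {P : C}
  {R : RingObject C} {n : ℕ} {X Y : C}

lemma powAdd_whiskerLeft_powOneHom (P : C) (n : ℕ) :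
    powAdd P n 1 ≫ pow P n ◁ powOneHom P = 𝟙 (pow P (n + 1)) := by
  simp [powAdd, powOneHom, pow]

variable [SymmetricCategory C]

/-- Composition with an endomorphism of degree one, in the form in which structure maps are
defined. -/
lemma PowHom.comp_ofUnit_eq (f : PowHom P R n X Y) (u : P ⟶ R.obj 1) :
    PowHom.comp f (PowHom.ofUnit u Y) = (α_ X (pow P n) P).inv ≫ f ▷ P ≫ (Y ⊗ R.obj n) ◁ u ≫
      (α_ Y (R.obj n) (R.obj 1)).hom ≫ Y ◁ R.mul n 1 := by
  rw [PowHom.comp, PowHom.ofUnit, reparam, parComp, reassoc_of% swapRight_naturality_middle,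
    reassoc_of% swapRight_swapRight, MonoidalCategory.whiskerLeft_comp]
  simp only [Category.assoc]
  rw [← whisker_exchange_assoc f, ← associator_inv_naturality_right_assoc,
    ← MonoidalCategory.whiskerLeft_comp_assoc, powAdd_whiskerLeft_powOneHom]
  exact congrArg (· ≫ _) (MonoidalCategory.whiskerLeft_id _ _) |>.trans (Category.id_comp _)

end

section Correspondences

variable {C : Type u} [Category.{v} C] [MonoidalCategory C] [SymmetricCategory C]
  [HasFiniteCoproducts C] [FinitelyDistributive C] {P T : C} {σ : P ⟶ T}
  {E : RingSpectrum T} {k ℓ : SimplexCategory} {n m : ℕ} {X X' Y Y' Z : C}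

variable (E ℓ n Y) in
/-- The canonical morphism `(Y ∧ E_n) ∧ S^n → Y ∧ (E_n ∧ S^n)`, an isomorphism by distributivity. -/
def sphereGather : smash (Y ⊗ E.obj n) (Cell n ℓ) ⟶ Y ⊗ (sphereRing E.toRingObject ℓ).obj n :=
  gather Y (E.obj n) (Cell n ℓ)

instance : Mono (sphereGather E ℓ n Y) :=
  inferInstanceAs (Mono (gather Y (E.obj n) (Cell n ℓ)))

lemma incl_sphereGather (s : Cell n ℓ) :
    incl (Y ⊗ E.obj n) s ≫ sphereGather E ℓ n Y = Y ◁ sphereIncl s :=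
  incl_gather _

/-- A correspondence `X ∧ P^{∧n} → Y ∧ E_n ∧ S^n`, regarded as a morphism from `X` to `Y` with
coefficients in the ring object of simplices of `E`. -/
def toPowHom (f : CorrHom P E n ℓ X Y) : PowHom P (sphereRing E.toRingObject ℓ) n X Y :=
  f ≫ sphereGather E ℓ n Y

lemma toPowHom_def (f : CorrHom P E n ℓ X Y) : toPowHom f = f ≫ sphereGather E ℓ n Y := rfl

lemma toPowHom_injective : Function.Injective
    (toPowHom : CorrHom P E n ℓ X Y → PowHom P (sphereRing E.toRingObject ℓ) n X Y) :=
  fun _ _ h => (cancel_mono (sphereGather E ℓ n Y)).1 h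

lemma toPowHom_corrComp (f : CorrHom P E n ℓ X Y) (g : CorrHom P E m ℓ Y Z) :
    toPowHom (corrComp P E f g) = PowHom.comp (toPowHom f) (toPowHom g) := by
  rw [toPowHom_def, corrComp, PowHom.comp, reparam, parComp]
  simp only [Category.assoc]
  congr 2
  rw [toPowHom_def f, comp_whiskerRight_assoc]
  congr 1
  apply whiskerRight_smash_ext
  intro s
  rw [reassoc_of% incl_whiskerRight_distribRight, reassoc_of% incl_desc, ← comp_whiskerRight_assoc,
    incl_sphereGather, reassoc_of% swapRight_naturality_middle]
  simp only [Category.assoc]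
  congr 1
  rw [toPowHom_def g, whisker_exchange_assoc, comp_whiskerRight_assoc]
  congr 1
  apply whiskerRight_smash_ext
  intro t
  rw [reassoc_of% incl_whiskerRight_distribRight, reassoc_of% incl_desc, ← comp_whiskerRight_assoc,
    incl_sphereGather, ← whisker_exchange_assoc, reassoc_of% swapRight_naturality_middle,
    reassoc_of% swapRight_naturality_right, ← whisker_exchange_assoc,
    associator_naturality_middle_assoc, associator_naturality_right_assoc]
  simp only [Category.assoc, incl_sphereGather]
  rw [← MonoidalCategory.whiskerLeft_comp, ← MonoidalCategory.whiskerLeft_comp,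
    ← MonoidalCategory.whiskerLeft_comp, ← MonoidalCategory.tensorHom_def'_assoc,
    sphereIncl_tensor_sphereIncl_mul]

lemma toPowHom_corrTensorHom (f : CorrHom P E n ℓ X X') (g : CorrHom P E m ℓ Y Y') :
    toPowHom (corrTensorHom P E f g) = PowHom.tensor (toPowHom f) (toPowHom g) := by
  have h : ∀ (s : Cell n ℓ) (t : Cell m ℓ),
      (X' ◁ sphereIncl (E := E.toRingObject) s ⊗ₘ Y' ◁ sphereIncl (E := E.toRingObject) t) ≫
          tensorμ X' _ Y' _ =
        tensorμ X' _ Y' _ ≫ (X' ⊗ Y') ◁ (sphereIncl s ⊗ₘ sphereIncl t) := by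
    intro s t
    simpa using tensorμ_natural (𝟙 X') (sphereIncl s) (𝟙 Y') (sphereIncl t)
  rw [toPowHom_def, corrTensorHom, PowHom.tensor, reparam, parTensor]
  simp only [Category.assoc]
  congr 2
  rw [toPowHom_def, toPowHom_def, ← tensorHom_comp_tensorHom_assoc]
  congr 1
  apply smash_tensor_smash_ext
  intro s t
  rw [MonoidalCategory.tensorHom_def', Category.assoc, Category.assoc,
    reassoc_of% incl_whiskerRight_distribRight, reassoc_of% incl_desc, Category.assoc,
    reassoc_of% whiskerLeft_incl_distribLeft, reassoc_of% incl_desc,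
    ← MonoidalCategory.tensorHom_def'_assoc,
    tensorHom_comp_tensorHom_assoc, incl_sphereGather, incl_sphereGather, reassoc_of% h]
  simp only [Category.assoc, incl_sphereGather]
  rw [← MonoidalCategory.whiskerLeft_comp, ← MonoidalCategory.whiskerLeft_comp,
    sphereIncl_tensor_sphereIncl_mul]

lemma toPowHom_corrOfHom (a : X ⟶ Y) :
    toPowHom (corrOfHom P E a) =
      PowHom.ofHom P (sphereRing E.toRingObject (SimplexCategory.mk 0)) a := by
  -- the identification of `P^{∧0}` with the unit, the identity, is left out in `corrOfHom`
  have h : corrOfHom P E a = X ◁ powZeroHom P ≫ a ▷ 𝟙_ C ≫ Y ◁ E.one ≫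
      incl (Y ⊗ E.obj 0) (Fin.elim0 : Cell 0 (SimplexCategory.mk 0)) :=
    (Category.id_comp _).symm.trans
      (congrArg (· ≫ corrOfHom P E a) (MonoidalCategory.whiskerLeft_id X (pow P 0)).symm)
  rw [toPowHom_def, h]
  simp only [Category.assoc]
  rw [incl_sphereGather, ← MonoidalCategory.whiskerLeft_comp, ← sphereRing_one, PowHom.ofHom,
    reparam]

lemma toPowHom_corrAct (e : Fin n ≃ Fin m) (f : CorrHom P E n ℓ X Y) :
    toPowHom (corrAct P E e f) = PowHom.act e (toPowHom f) := by
  have h : (desc fun s : Cell n ℓ => Y ◁ E.act e ≫ incl (Y ⊗ E.obj m) (s ∘ e.symm : Cell m ℓ)) ≫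
      sphereGather E ℓ m Y = sphereGather E ℓ n Y ≫ Y ◁ (sphereRing E.toRingObject ℓ).act e := by
    apply smash_ext
    intro s
    rw [reassoc_of% incl_desc, Category.assoc, incl_sphereGather, reassoc_of% incl_sphereGather,
      ← MonoidalCategory.whiskerLeft_comp, ← MonoidalCategory.whiskerLeft_comp, sphereIncl_act]
  rw [toPowHom_def, corrAct, Category.assoc, Category.assoc, h, PowHom.act, reparam, toPowHom_def,
    Category.assoc]

variable [HasZeroMorphisms C]

lemma toPowHom_zero : toPowHom (0 : CorrHom P E n ℓ X Y) = 0 :=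
  zero_comp

/-- A structure map is the composition with an endomorphism of degree one of the target. -/
lemma toPowHom_corrStr (f : CorrHom P E n ℓ X Y) (k : Option (Arc ℓ)) :
    toPowHom (corrStr σ E f k) =
      PowHom.comp (toPowHom f) (PowHom.ofUnit (sphereUnit ℓ (σ ≫ E.unit₁) k) Y) := by
  rw [PowHom.comp_ofUnit_eq]
  cases k with
  | none =>
    rw [sphereUnit, whiskerLeft_zero, corrStr, toPowHom_zero, zero_comp, comp_zero, comp_zero]
    rfl
  | some k =>
    rw [toPowHom_def, toPowHom_def, corrStr, sphereUnit, MonoidalCategory.tensorHom_def]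
    refine (Category.assoc _ _ _).trans (congrArg ((α_ X (pow P n) P).inv ≫ ·) ?_)
    simp only [Category.assoc]
    rw [comp_whiskerRight_assoc]
    congr 1
    apply whiskerRight_smash_ext
    intro s
    -- the structure map appends a coordinate, the product a tuple of length one
    have hs : (Fin.snoc s k : Cell (n + 1) ℓ) = Fin.append s (fun _ => k) :=
      (Fin.append_right_eq_snoc s (fun _ => k)).symm
    rw [← whisker_exchange_assoc (incl _ s) σ, reassoc_of% incl_whiskerRight_distribRight,
      reassoc_of% incl_desc, ← comp_whiskerRight_assoc, incl_sphereGather, ← whisker_exchange_assoc,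
      associator_naturality_middle_assoc, associator_naturality_right_assoc, hs]
    simp only [Category.assoc, incl_sphereGather]
    rw [associator_naturality_right_assoc]
    simp only [← MonoidalCategory.whiskerLeft_comp, Category.assoc]
    rw [← sphereIncl_tensor_sphereIncl_mul, MonoidalCategory.tensorHom_def']
    simp only [MonoidalCategory.whiskerLeft_comp, Category.assoc]

/-- A simplicial operator is the change of coefficients along a morphism of ring objects. -/
lemma toPowHom_pull {θ : k ⟶ ℓ} (f : CorrHom P E n ℓ X Y) :
    toPowHom (pull (corrLevel P E X Y n) θ f : CorrHom P E n k X Y) =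
      PowHom.map (spherePull E.toRingObject θ) (toPowHom f) := by
  have h : smashMap (Y ⊗ E.obj n) (cellPull n θ) ≫ sphereGather E k n Y =
      sphereGather E ℓ n Y ≫ Y ◁ spherePull E.toRingObject θ n := by
    apply smash_ext
    intro s
    rw [smashMap, reassoc_of% incl_desc, reassoc_of% incl_sphereGather,
      ← MonoidalCategory.whiskerLeft_comp, sphereIncl_spherePull]
    cases cellPull n θ s with
    | none => exact zero_comp.trans whiskerLeft_zero.symm
    | some s' => exact incl_sphereGather _
  change (f ≫ smashMap (Y ⊗ E.obj n) (cellPull n θ)) ≫ sphereGather E k n Y = _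
  rw [Category.assoc, h, PowHom.map, toPowHom_def, Category.assoc]

lemma toPowHom_degen (a : X ⟶ Y) :
    toPowHom ((corrSpectrum σ E X Y).degen (corrOfHom P E a) ℓ : CorrHom P E 0 ℓ X Y) =
      PowHom.ofHom P (sphereRing E.toRingObject ℓ) a := by
  refine (toPowHom_pull _).trans ?_
  rw [toPowHom_corrOfHom, PowHom.map, PowHom.ofHom, reparam, Category.assoc, Category.assoc,
    ← MonoidalCategory.whiskerLeft_comp, sphereRing_one, Category.assoc, sphereIncl_spherePull,
    (cellPull_eq_some (s' := Fin.elim0) _).2 (fun i => i.elim0)]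
  rfl

end Correspondences

/-! ### The spectral category of correspondences -/

section Correspondences

variable {C : Type u} [Category.{v} C] [MonoidalCategory C] [SymmetricCategory C]
  [HasFiniteCoproducts C] {P T : C} {E : RingSpectrum T} {ℓ : SimplexCategory} {n m p : ℕ}
  {X X' X'' Y Y' Y'' Z Z' W : C}

lemma corrAct_zero [HasZeroMorphisms C] (e : Fin n ≃ Fin m) :
    corrAct P E e (0 : CorrHom P E n ℓ X Y) = 0 := by
  rw [corrAct, zero_comp, comp_zero]

variable [FinitelyDistributive C]

lemma corrAct_trans (e : Fin n ≃ Fin m) (e' : Fin m ≃ Fin p) (f : CorrHom P E n ℓ X Y) :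
    corrAct P E (e.trans e') f = corrAct P E e' (corrAct P E e f) := by
  apply toPowHom_injective
  rw [toPowHom_corrAct, toPowHom_corrAct, toPowHom_corrAct, PowHom.act_trans]

lemma corrComp_corrAct {n' m' : ℕ} (e : Fin n ≃ Fin n') (e' : Fin m ≃ Fin m')
    (f : CorrHom P E n ℓ X Y) (g : CorrHom P E m ℓ Y Z) :
    corrComp P E (corrAct P E e f) (corrAct P E e' g) =
      corrAct P E (blockSum e e') (corrComp P E f g) := by
  apply toPowHom_injective
  rw [toPowHom_corrComp, toPowHom_corrAct, toPowHom_corrAct, toPowHom_corrAct, toPowHom_corrComp,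
    PowHom.comp_act]

lemma corrTensorHom_corrAct {n' m' : ℕ} (e : Fin n ≃ Fin n') (e' : Fin m ≃ Fin m')
    (f : CorrHom P E n ℓ X X') (g : CorrHom P E m ℓ Y Y') :
    corrTensorHom P E (corrAct P E e f) (corrAct P E e' g) =
      corrAct P E (blockSum e e') (corrTensorHom P E f g) := by
  apply toPowHom_injective
  rw [toPowHom_corrTensorHom, toPowHom_corrAct, toPowHom_corrAct, toPowHom_corrAct,
    toPowHom_corrTensorHom, PowHom.tensor_act]

lemma corrComp_assoc (f : CorrHom P E n ℓ X Y) (g : CorrHom P E m ℓ Y Z)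
    (h : CorrHom P E p ℓ Z W) :
    corrAct P E (finCongr (Nat.add_assoc n m p)) (corrComp P E (corrComp P E f g) h) =
      corrComp P E f (corrComp P E g h) := by
  apply toPowHom_injective
  rw [toPowHom_corrAct, toPowHom_corrComp, toPowHom_corrComp, toPowHom_corrComp,
    toPowHom_corrComp, PowHom.comp_assoc]

/-- Composition of vertices. The degree `0 + 0` is replaced by `0`, so that equations between
vertices can be rewritten. -/
def corrVComp (f : CorrHom P E 0 (SimplexCategory.mk 0) X Y)
    (g : CorrHom P E 0 (SimplexCategory.mk 0) Y Z) :
    CorrHom P E 0 (SimplexCategory.mk 0) X Z :=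
  corrComp P E f g

/-- The tensor product of vertices, in degree `0` instead of `0 + 0`. -/
def corrVTensor (f : CorrHom P E 0 (SimplexCategory.mk 0) X X')
    (g : CorrHom P E 0 (SimplexCategory.mk 0) Y Y') :
    CorrHom P E 0 (SimplexCategory.mk 0) (X ⊗ Y) (X' ⊗ Y') :=
  corrTensorHom P E f g

lemma corrVComp_corrOfHom (a : X ⟶ Y) (b : Y ⟶ Z) :
    corrVComp (corrOfHom P E a) (corrOfHom P E b) = corrOfHom P E (a ≫ b) := by
  apply toPowHom_injective
  refine (toPowHom_corrComp _ _).trans ?_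
  rw [toPowHom_corrOfHom, toPowHom_corrOfHom]
  exact (PowHom.ofHom_comp_ofHom _ _).trans (toPowHom_corrOfHom _).symm

lemma corrVTensor_corrOfHom (a : X ⟶ X') (b : Y ⟶ Y') :
    corrVTensor (corrOfHom P E a) (corrOfHom P E b) = corrOfHom P E (a ⊗ₘ b) := by
  apply toPowHom_injective
  refine (toPowHom_corrTensorHom _ _).trans ?_
  rw [toPowHom_corrOfHom, toPowHom_corrOfHom]
  exact (PowHom.ofHom_tensor_ofHom _ _).trans (toPowHom_corrOfHom _).symm

lemma corrTensorHom_comp (hE : E.IsCommutative) {p q s t : ℕ} (f : CorrHom P E p ℓ X X')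
    (f' : CorrHom P E s ℓ X' X'') (g : CorrHom P E q ℓ Y Y') (g' : CorrHom P E t ℓ Y' Y'') :
    corrComp P E (corrTensorHom P E f g) (corrTensorHom P E f' g') =
      corrAct P E (chiMid p s q t) (corrTensorHom P E (corrComp P E f f') (corrComp P E g g')) := by
  apply toPowHom_injective
  rw [toPowHom_corrComp, toPowHom_corrTensorHom, toPowHom_corrTensorHom, toPowHom_corrAct,
    toPowHom_corrTensorHom, toPowHom_corrComp, toPowHom_corrComp,
    PowHom.tensor_comp (isCommutative_sphereRing hE)]

variable [HasZeroMorphisms C] (σ : P ⟶ T)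

variable (E) in
lemma isCentral_unit (ℓ : SimplexCategory) (s : Option (Arc ℓ)) :
    (sphereRing E.toRingObject ℓ).IsCentral (sphereUnit ℓ (σ ≫ E.unit₁) s) :=
  isCentral_sphereUnit (RingObject.IsCentral.comp_left E.central σ) s

/-- The iterated structure maps on correspondences. -/
abbrev corrStrIter (f : CorrHom P E n ℓ X Y) (k : ℕ) (s : Fin k → Option (Arc ℓ)) :
    CorrHom P E (n + k) ℓ X Y :=
  (corrSpectrum σ E X Y).strIter f k s

/-- Iterated structure maps are compositions with products of central endomorphisms. -/
lemma toPowHom_corrStrIter (f : CorrHom P E n ℓ X Y) (k : ℕ) (s : Fin k → Option (Arc ℓ)) :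
    toPowHom (corrStrIter σ f k s) =
      PowHom.comp (toPowHom f)
        (PowHom.sphere Y k fun i => sphereUnit ℓ (σ ≫ E.unit₁) (s i)) := by
  induction k with
  | zero => exact (PowHom.comp_id _).symm
  | succ k ih =>
    rw [PowHom.comp_sphere_succ, ← ih]
    exact toPowHom_corrStr _ _

lemma corrStr_zero (s : Option (Arc ℓ)) :
    corrStr σ E (0 : CorrHom P E n ℓ X Y) s = 0 := by
  apply toPowHom_injective
  rw [toPowHom_corrStr, toPowHom_zero, PowHom.comp_ofUnit_eq, zero_whiskerRight, zero_comp,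
    comp_zero, toPowHom_zero]
  rfl

/-- The simplicial operator `θ^*` on correspondences. -/
abbrev corrPull {k : SimplexCategory} (θ : k ⟶ ℓ) (f : CorrHom P E n ℓ X Y) :
    CorrHom P E n k X Y :=
  pull (corrLevel P E X Y n) θ f

lemma corrAct_pull {k : SimplexCategory} (θ : k ⟶ ℓ) (e : Fin n ≃ Fin m)
    (f : CorrHom P E n ℓ X Y) :
    corrAct P E e (corrPull θ f) = corrPull θ (corrAct P E e f) := by
  apply toPowHom_injective
  rw [toPowHom_corrAct, toPowHom_pull, toPowHom_pull, toPowHom_corrAct,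
    PowHom.map_act _ (spherePull_act _ _ _)]

lemma corrStr_pull {k : SimplexCategory} (θ : k ⟶ ℓ) (f : CorrHom P E n ℓ X Y)
    (s : Option (Arc ℓ)) :
    corrStr σ E (corrPull θ f) (circlePull θ s) = corrPull θ (corrStr σ E f s) := by
  apply toPowHom_injective
  rw [toPowHom_corrStr, toPowHom_pull, toPowHom_pull, toPowHom_corrStr,
    ← PowHom.map_comp (spherePull_mul _ _ _ _), PowHom.map_ofUnit, sphereUnit_spherePull]

lemma corrStrIter_corrAct (e : Fin n ≃ Fin m) {k k' : ℕ} (e' : Fin k ≃ Fin k')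
    (f : CorrHom P E n ℓ X Y) (s : Fin k → Option (Arc ℓ)) :
    corrStrIter σ (corrAct P E e f) k' (s ∘ e'.symm) =
      corrAct P E (blockSum e e') (corrStrIter σ f k s) := by
  apply toPowHom_injective
  rw [toPowHom_corrAct, toPowHom_corrStrIter, toPowHom_corrStrIter, toPowHom_corrAct,
    ← PowHom.comp_act,
    PowHom.act_sphere _ _ _ fun i => isCentral_unit E σ ℓ (s i)]
  rfl

variable (E X Y) in
lemma isSymmetricSpectrum_corrSpectrum : (corrSpectrum σ E X Y).IsSymmetricSpectrum where
  act_refl _ := toPowHom_injective ((toPowHom_corrAct _ _).trans (PowHom.act_refl _))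
  act_trans e f _ x := corrAct_trans e f x
  act_base e _ := corrAct_zero e
  act_pull e _ _ θ x := corrAct_pull θ e x
  str_base_left _ _ s := corrStr_zero σ s
  str_base_right _ := rfl
  str_pull θ x s := corrStr_pull σ θ x s
  strIter_act e f _ x s := corrStrIter_corrAct σ e f x s

lemma zero_corrComp (g : CorrHom P E m ℓ Y Z) :
    corrComp P E (0 : CorrHom P E n ℓ X Y) g = 0 := by
  apply toPowHom_injective
  rw [toPowHom_corrComp, toPowHom_zero, toPowHom_zero, PowHom.comp, parComp, zero_whiskerRight,
    zero_comp, comp_zero, reparam, zero_comp, comp_zero]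

lemma corrComp_zero (f : CorrHom P E n ℓ X Y) :
    corrComp P E f (0 : CorrHom P E m ℓ Y Z) = 0 := by
  apply toPowHom_injective
  rw [toPowHom_corrComp, toPowHom_zero, toPowHom_zero, PowHom.comp, parComp, zero_whiskerRight,
    zero_comp, comp_zero, comp_zero, comp_zero, reparam, zero_comp, comp_zero]

lemma corrComp_pull {k : SimplexCategory} (θ : k ⟶ ℓ) (f : CorrHom P E n ℓ X Y)
    (g : CorrHom P E m ℓ Y Z) :
    corrComp P E (corrPull θ f) (corrPull θ g) = corrPull θ (corrComp P E f g) := by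
  apply toPowHom_injective
  rw [toPowHom_corrComp, toPowHom_pull, toPowHom_pull, toPowHom_pull, toPowHom_corrComp,
    PowHom.map_comp (spherePull_mul _ _ _ _)]

lemma corrComp_corrStr (f : CorrHom P E n ℓ X Y) (g : CorrHom P E m ℓ Y Z)
    (s : Option (Arc ℓ)) :
    corrComp P E f (corrStr σ E g s) = corrStr σ E (corrComp P E f g) s := by
  apply toPowHom_injective
  rw [toPowHom_corrComp, toPowHom_corrStr, toPowHom_corrStr, toPowHom_corrComp,
    ← PowHom.comp_assoc]
  exact PowHom.act_refl (PowHom.comp (PowHom.comp _ _) (PowHom.ofUnit _ _))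

lemma corrStr_corrComp (f : CorrHom P E n ℓ X Y) (g : CorrHom P E m ℓ Y Z)
    (s : Option (Arc ℓ)) :
    corrAct P E (chiOne n m) (corrComp P E (corrStr σ E f s) g) =
      corrStr σ E (corrComp P E f g) s := by
  apply toPowHom_injective
  rw [toPowHom_corrAct, toPowHom_corrComp, toPowHom_corrStr, toPowHom_corrStr, toPowHom_corrComp,
    PowHom.act_chiOne_comp (isCentral_unit E σ ℓ s)]

variable (E X Y Z) in
lemma isBimorphism_corrComp :
    IsBimorphism (corrSpectrum σ E X Y) (corrSpectrum σ E Y Z) (corrSpectrum σ E X Z)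
      (fun f g => corrComp P E f g) where
  base_left _ _ _ g := zero_corrComp g
  base_right _ _ f := corrComp_zero f
  map_pull θ f g := corrComp_pull θ f g
  map_act e e' _ f g := corrComp_corrAct e e' f g
  str_right f g s := corrComp_corrStr σ f g s
  str_left f g s := corrStr_corrComp σ f g s

lemma zero_corrTensorHom (g : CorrHom P E m ℓ Y Y') :
    corrTensorHom P E (0 : CorrHom P E n ℓ X X') g = 0 := by
  apply toPowHom_injective
  rw [toPowHom_corrTensorHom, toPowHom_zero, toPowHom_zero, PowHom.tensor, parTensor,
    MonoidalCategory.tensorHom_def, zero_whiskerRight, zero_comp, zero_comp, comp_zero, reparam,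
    zero_comp, comp_zero]

lemma corrTensorHom_zero (f : CorrHom P E n ℓ X X') :
    corrTensorHom P E f (0 : CorrHom P E m ℓ Y Y') = 0 := by
  apply toPowHom_injective
  rw [toPowHom_corrTensorHom, toPowHom_zero, toPowHom_zero, PowHom.tensor, parTensor,
    MonoidalCategory.tensorHom_def, whiskerLeft_zero, comp_zero, zero_comp, comp_zero, reparam,
    zero_comp, comp_zero]

lemma corrTensorHom_pull {k : SimplexCategory} (θ : k ⟶ ℓ) (f : CorrHom P E n ℓ X X')
    (g : CorrHom P E m ℓ Y Y') :
    corrTensorHom P E (corrPull θ f) (corrPull θ g) = corrPull θ (corrTensorHom P E f g) := by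
  apply toPowHom_injective
  rw [toPowHom_corrTensorHom, toPowHom_pull, toPowHom_pull, toPowHom_pull,
    toPowHom_corrTensorHom, PowHom.map_tensor (spherePull_mul _ _ _ _)]

lemma corrTensorHom_corrStr (hE : E.IsCommutative) (f : CorrHom P E n ℓ X X')
    (g : CorrHom P E m ℓ Y Y') (s : Option (Arc ℓ)) :
    corrTensorHom P E f (corrStr σ E g s) = corrStr σ E (corrTensorHom P E f g) s := by
  apply toPowHom_injective
  rw [toPowHom_corrTensorHom, toPowHom_corrStr, toPowHom_corrStr, toPowHom_corrTensorHom,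
    PowHom.tensor_comp_ofUnit (isCommutative_sphereRing hE)]

lemma corrStr_corrTensorHom (hE : E.IsCommutative) (f : CorrHom P E n ℓ X X')
    (g : CorrHom P E m ℓ Y Y') (s : Option (Arc ℓ)) :
    corrAct P E (chiOne n m) (corrTensorHom P E (corrStr σ E f s) g) =
      corrStr σ E (corrTensorHom P E f g) s := by
  apply toPowHom_injective
  rw [toPowHom_corrAct, toPowHom_corrTensorHom, toPowHom_corrStr, toPowHom_corrStr,
    toPowHom_corrTensorHom, PowHom.act_chiOne_tensor (isCommutative_sphereRing hE)]

variable (E X X' Y Y') in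
lemma isBimorphism_corrTensorHom (hE : E.IsCommutative) :
    IsBimorphism (corrSpectrum σ E X X') (corrSpectrum σ E Y Y')
      (corrSpectrum σ E (X ⊗ Y) (X' ⊗ Y')) (fun f g => corrTensorHom P E f g) where
  base_left _ _ _ g := zero_corrTensorHom g
  base_right _ _ f := corrTensorHom_zero f
  map_pull θ f g := corrTensorHom_pull θ f g
  map_act e e' _ f g := corrTensorHom_corrAct e e' f g
  str_right f g s := corrTensorHom_corrStr σ hE f g s
  str_left f g s := corrStr_corrTensorHom σ hE f g s

/-- The degenerate `ℓ`-simplex on the vertex given by a morphism of `C`. -/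
abbrev corrDegen (ℓ : SimplexCategory) (a : X ⟶ Y) : CorrHom P E 0 ℓ X Y :=
  (corrSpectrum σ E X Y).degen (corrOfHom P E a) ℓ

/-- Composing with a morphism of `C` changes neither degree nor coefficients. -/
lemma corrComp_corrDegen (f : CorrHom P E n ℓ X Y) (b : Y ⟶ Z) :
    toPowHom (corrComp P E f (corrDegen σ ℓ b) : CorrHom P E n ℓ X Z) =
      toPowHom f ≫ b ▷ _ := by
  refine (toPowHom_corrComp _ _).trans ?_
  rw [toPowHom_degen, PowHom.comp_ofHom]

/-- Precomposing with a morphism of `C`, after the degree `0 + n` has been identified with `n`. -/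
lemma corrDegen_corrComp (a : X ⟶ Y) (f : CorrHom P E n ℓ Y Z) :
    toPowHom (corrAct P E (finCongr (Nat.zero_add n)) (corrComp P E (corrDegen σ ℓ a) f)) =
      a ▷ pow P n ≫ toPowHom f := by
  rw [toPowHom_corrAct, toPowHom_corrComp, toPowHom_degen, PowHom.ofHom_comp]

variable (E) in
lemma isSpectralCategory_corrCategory (B : ObjectProperty C) :
    (corrCategory σ E B).IsSpectralCategory where
  isSymmetricSpectrum_hom X Y := isSymmetricSpectrum_corrSpectrum E X.obj Y.obj σ
  isBimorphism_comp X Y Z := isBimorphism_corrComp E X.obj Y.obj Z.obj σ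
  assoc f g h := corrComp_assoc f g h
  comp_one {_ Y _ _} f := toPowHom_injective <|
    (corrComp_corrDegen σ f (𝟙 Y.obj)).trans (by rw [id_whiskerRight, Category.comp_id])
  one_comp {X _ _ _} f := toPowHom_injective <|
    (corrDegen_corrComp σ (𝟙 X.obj) f).trans (by rw [id_whiskerRight, Category.id_comp])

lemma associator_natural (f : CorrHom P E n ℓ X X') (g : CorrHom P E m ℓ Y Y')
    (h : CorrHom P E p ℓ Z Z') :
    corrAct P E (finCongr (Nat.add_assoc n m p))
        (corrComp (m := 0) P E (corrTensorHom P E (corrTensorHom P E f g) h)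
          (corrDegen σ ℓ (α_ X' Y' Z').hom)) =
      corrAct P E (finCongr (Nat.zero_add (n + (m + p))))
        (corrComp P E (corrDegen σ ℓ (α_ X Y Z).hom)
          (corrTensorHom P E f (corrTensorHom P E g h))) := by
  apply toPowHom_injective
  refine Eq.trans ?_ (corrDegen_corrComp σ _ _).symm
  refine (toPowHom_corrAct _ _).trans ?_
  refine (congrArg _ (corrComp_corrDegen σ _ _)).trans ?_
  rw [toPowHom_corrTensorHom, toPowHom_corrTensorHom, toPowHom_corrTensorHom,
    toPowHom_corrTensorHom]
  exact PowHom.tensor_assoc _ _ _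

lemma leftUnitor_natural (f : CorrHom P E n ℓ X Y) :
    corrComp (m := 0) P E (corrTensorHom P E (corrDegen σ ℓ (𝟙 (𝟙_ C))) f)
        (corrDegen σ ℓ (λ_ Y).hom) =
      corrComp P E (corrDegen σ ℓ (λ_ X).hom) f := by
  have h : toPowHom (corrAct P E (finCongr (Nat.zero_add n))
      (corrComp (m := 0) P E (corrTensorHom P E (corrDegen σ ℓ (𝟙 (𝟙_ C))) f)
        (corrDegen σ ℓ (λ_ Y).hom) : CorrHom P E (0 + n) ℓ _ _)) =
      toPowHom (corrAct P E (finCongr (Nat.zero_add n))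
        (corrComp P E (corrDegen σ ℓ (λ_ X).hom) f)) := by
    rw [corrDegen_corrComp]
    refine (toPowHom_corrAct _ _).trans ?_
    refine (congrArg _ (corrComp_corrDegen σ _ _)).trans ?_
    rw [toPowHom_corrTensorHom, toPowHom_degen]
    exact PowHom.ofHom_tensor _
  -- the permutation in the other compatibilities is the same on both sides, and is cancelled here
  rw [toPowHom_corrAct, toPowHom_corrAct] at h
  exact toPowHom_injective (PowHom.act_injective _ h)

lemma rightUnitor_natural (f : CorrHom P E n ℓ X Y) :
    corrComp P E (corrTensorHom P E f (corrDegen σ ℓ (𝟙 (𝟙_ C)))) (corrDegen σ ℓ (ρ_ Y).hom) =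
      corrAct P E (finCongr (Nat.zero_add n)) (corrComp P E (corrDegen σ ℓ (ρ_ X).hom) f) := by
  apply toPowHom_injective
  refine (corrComp_corrDegen σ _ _).trans ?_
  refine Eq.trans ?_ (corrDegen_corrComp σ _ _).symm
  rw [toPowHom_corrTensorHom, toPowHom_degen]
  exact PowHom.tensor_ofHom _

lemma braiding_natural (hE : E.IsCommutative) (f : CorrHom P E n ℓ X X')
    (g : CorrHom P E m ℓ Y Y') :
    corrComp (m := 0) P E (corrTensorHom P E f g) (corrDegen σ ℓ (β_ X' Y').hom) =
      corrAct P E ((finCongr (Nat.zero_add (m + n))).trans (chi m n))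
        (corrComp P E (corrDegen σ ℓ (β_ X Y).hom) (corrTensorHom P E g f)) := by
  apply toPowHom_injective
  refine (corrComp_corrDegen σ _ _).trans ?_
  rw [corrAct_trans, toPowHom_corrAct, corrDegen_corrComp, toPowHom_corrTensorHom,
    toPowHom_corrTensorHom, PowHom.tensor_braiding (isCommutative_sphereRing hE),
    PowHom.whiskerRight_comp_act]

variable (E) in
lemma isSymmetricMonoidal_corrTensor (hE : E.IsCommutative) (B : ObjectProperty C)
    (hB : ∀ X Y : C, B X → B Y → B (X ⊗ Y)) (hS : B (𝟙_ C)) :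
    (corrTensor σ E B hB hS).IsSymmetricMonoidal where
  isBimorphism_tensorHom X X' Y Y' :=
    isBimorphism_corrTensorHom E X.obj X'.obj Y.obj Y'.obj σ hE
  tensor_comp f f' g g' := corrTensorHom_comp hE f f' g g'
  tensor_one X Y := by
    change corrVTensor (corrOfHom P E (𝟙 X.obj)) (corrOfHom P E (𝟙 Y.obj)) =
      corrOfHom P E (𝟙 (X.obj ⊗ Y.obj))
    rw [corrVTensor_corrOfHom, id_tensorHom_id]
  assoc_assocInv X Y Z :=
    (corrVComp_corrOfHom _ _).trans (congrArg _ (α_ X.obj Y.obj Z.obj).hom_inv_id)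
  assocInv_assoc X Y Z :=
    (corrVComp_corrOfHom _ _).trans (congrArg _ (α_ X.obj Y.obj Z.obj).inv_hom_id)
  leftUnitor_leftUnitorInv X :=
    (corrVComp_corrOfHom _ _).trans (congrArg _ (λ_ X.obj).hom_inv_id)
  leftUnitorInv_leftUnitor X :=
    (corrVComp_corrOfHom _ _).trans (congrArg _ (λ_ X.obj).inv_hom_id)
  rightUnitor_rightUnitorInv X :=
    (corrVComp_corrOfHom _ _).trans (congrArg _ (ρ_ X.obj).hom_inv_id)
  rightUnitorInv_rightUnitor X :=
    (corrVComp_corrOfHom _ _).trans (congrArg _ (ρ_ X.obj).inv_hom_id)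
  braiding_braiding X Y :=
    (corrVComp_corrOfHom _ _).trans (congrArg _ (SymmetricCategory.symmetry X.obj Y.obj))
  assoc_natural f g h := associator_natural σ f g h
  leftUnitor_natural f := leftUnitor_natural σ f
  rightUnitor_natural f := rightUnitor_natural σ f
  braiding_natural f g := braiding_natural σ hE f g
  pentagon W X Y Z := by
    change corrVComp (corrVComp (corrVTensor (corrOfHom P E (α_ W.obj X.obj Y.obj).hom)
        (corrOfHom P E (𝟙 Z.obj))) (corrOfHom P E (α_ W.obj (X.obj ⊗ Y.obj) Z.obj).hom))
        (corrVTensor (corrOfHom P E (𝟙 W.obj)) (corrOfHom P E (α_ X.obj Y.obj Z.obj).hom)) =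
      corrVComp (corrOfHom P E (α_ (W.obj ⊗ X.obj) Y.obj Z.obj).hom)
        (corrOfHom P E (α_ W.obj X.obj (Y.obj ⊗ Z.obj)).hom)
    simp only [corrVComp_corrOfHom, corrVTensor_corrOfHom, tensorHom_id, id_tensorHom,
      Category.assoc, MonoidalCategory.pentagon]
  triangle X Y := by
    change corrVComp (corrOfHom P E (α_ X.obj (𝟙_ C) Y.obj).hom)
        (corrVTensor (corrOfHom P E (𝟙 X.obj)) (corrOfHom P E (λ_ Y.obj).hom)) =
      corrVTensor (corrOfHom P E (ρ_ X.obj).hom) (corrOfHom P E (𝟙 Y.obj))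
    simp only [corrVComp_corrOfHom, corrVTensor_corrOfHom, tensorHom_id, id_tensorHom,
      MonoidalCategory.triangle]
  hexagon X Y Z := by
    change corrVComp (corrVComp (corrOfHom P E (α_ X.obj Y.obj Z.obj).hom)
        (corrOfHom P E (β_ X.obj (Y.obj ⊗ Z.obj)).hom))
        (corrOfHom P E (α_ Y.obj Z.obj X.obj).hom) =
      corrVComp (corrVComp (corrVTensor (corrOfHom P E (β_ X.obj Y.obj).hom)
        (corrOfHom P E (𝟙 Z.obj))) (corrOfHom P E (α_ Y.obj X.obj Z.obj).hom))
        (corrVTensor (corrOfHom P E (𝟙 Y.obj)) (corrOfHom P E (β_ X.obj Z.obj).hom))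
    simp only [corrVComp_corrOfHom, corrVTensor_corrOfHom, tensorHom_id, id_tensorHom,
      Category.assoc, BraidedCategory.hexagon_forward]

end Correspondences

end Corr

end

theorem mainTheorem6 {C : Type*} [Category* C] [MonoidalCategory C] [SymmetricCategory C]
    [HasFiniteCoproducts C] [HasZeroObject C] [HasZeroMorphisms C] [Corr.FinitelyDistributive C]
    {P T : C} (σ : P ⟶ T) (E : Corr.RingSpectrum T)
    (B : ObjectProperty C) (hB : ∀ X Y : C, B X → B Y → B (X ⊗ Y)) :
    (Corr.corrCategory σ E B).IsSpectralCategory ∧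
      (E.IsCommutative → ∀ hS : B (𝟙_ C), (Corr.corrTensor σ E B hB hS).IsSymmetricMonoidal) := by
  exact ⟨Corr.isSpectralCategory_corrCategory E σ B,
    fun hE hS => Corr.isSymmetricMonoidal_corrTensor E σ hE B hB hS⟩
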